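/- Let $\textsf{RCA}_0^\omega$ be Kohlenbach's base theory of higher-order Reverse Mathematics: classical arithmetic in all finite types with $0$, $S$, the combinators $\Pi,\Sigma$, the recursor $R_0$ of type $0$, the axiom of extensionality, induction for quantifier-free formulas, and quantifier-free choice $\textsf{QF-AC}^{1,0}$. Real numbers are represented by fast-converging sequences of (codes of) rationals, functions $\mathbb R\to\mathbb R$ by functionals of type $1\to1$ that respect equality of reals, and subsets of $\mathbb R$ by characteristic functions $\mathbb R\to\{0,1\}$; closures, interiors, boundaries and inverse images are used as shorthand for their defining formulas. The topological notions for subsets of $[0,1]$ are relative to $[0,1]$. For $f:[0,1]\to\mathbb R$ we say that 1. $f$ has the *Young condition* if for every $x\in(0,1]$ there is a sequence $(x_n)_{n\in\mathbb N}$ in $[0,x)$ with $x_n\to x$ and $f(x_n)\to f(x)$, and for every $x\in[0,1)$ there is a sequence $(y_n)_{n\in\mathbb N}$ in $(x,1]$ with $y_n\to x$ and $f(y_n)\to f(x)$; 2. $f$ is *almost continuous (Husain)* if for any $x\in[0,1]$ and any open $G\subset\mathbb R$ containing $f(x)$, the set $\overline{f^{-1}(G)}$ is a neighbourhood of $x$;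 3. $f$ is *graph continuous* if there is a continuous $g:[0,1]\to\mathbb R$ whose graph is contained in the closure (in $\mathbb R^2$) of the graph of $f$; 4. $f$ is *of Cesàro type* if there are non-empty open $U\subset[0,1]$ and $V\subset\mathbb R$ such that $U\subset\overline{f^{-1}(\{y\})}$ for all $y\in V$; 5. $f$ is *peripherally continuous* if for any $x\in[0,1]$ and open intervals $U\ni x$ and $V\ni f(x)$ there is an open $W\subset U$ with $x\in W$ and $f(\partial W)\subset V$; 6. $f$ is *pre-continuous* if for any open $G\subset\mathbb R$ the set $f^{-1}(G)$ is pre-open, where $S$ is pre-open if $S\subset\mathrm{int}(\overline S)$; 7. $f$ is *$\mathcal C$-continuous* if for any open $G\subset\mathbb R$ the set $f^{-1}(G)$ is a $\mathcal C$-set, i.e. of the form $O\cap A$ with $O$ open and $A$ pre-open. A *supremum functional* for a class $\Gamma$ of functions $[0,1]\to\mathbb R$ is a functional $\Xi:(\mathbb R\to\mathbb R)\to\overline{\mathbb R}$, with $\overline{\mathbb R}=\mathbb R\cup\{+\infty,-\infty\}$, such that $\Xi(f)=\sup_{x\in[0,1]}f(x)$ for every $f$ in $\Gamma$. **Theorem.**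 Let $\Gamma$ be any one of the following seven classes: the functions with the Young condition, the almost continuous (Husain) functions, the graph continuous functions, the functions that are *not* of Cesàro type, the peripherally continuous functions, the pre-continuous functions, the $\mathcal C$-continuous functions. Then $\textsf{RCA}_0^\omega$ proves (equivalently, every model of $\textsf{RCA}_0^\omega$ satisfies) that the following are equivalent: - Kleene's $(\exists^3)$: $(\exists E)(\forall Y:\mathbb N^{\mathbb N}\to\mathbb N)\big(E(Y)=0\leftrightarrow(\exists f\in\mathbb N^{\mathbb N})(Y(f)=0)\big)$; - Kleene's $(\exists^2)$: $(\exists E:\mathbb N^{\mathbb N}\to\mathbb N)(\forall f\in\mathbb N^{\mathbb N})\big(E(f)=0\leftrightarrow(\exists n\in\mathbb N)(f(n)=0)\big)$, together with the existence of a supremum functional for $\Gamma$. -/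

import Mathlib

universe u

namespace HigherOrderRM

/-! ## The language of all finite types and its structures -/

/-- The finite types: `nat` is the type `0`, and `fn σ τ` is the type `σ → τ`. -/
inductive Ty : Type
  | nat : Ty
  | fn : Ty → Ty → Ty
  deriving DecidableEq

/-- The type `1 = 0 → 0` of elements of Baire space. -/
abbrev Ty.one : Ty := .fn .nat .nat

/-- The type `2 = 1 → 0`. -/
abbrev Ty.two : Ty := .fn .one .nat

/-- The type `3 = 2 → 0`. -/
abbrev Ty.three : Ty := .fn .two .nat

/-- The type `1 → 1` of (representatives of) functions on the reals. -/
abbrev Ty.realFn : Ty := .fn .one .one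

/-- A (Henkin) structure for the language of arithmetic in all finite types with the constants
`0`, `S`, the combinators `Π` and `Σ` of all types, and the recursor `R₀` of type `0`.
The objects of type `σ → τ` need not be all functions from the objects of type `σ` to those of
type `τ`, and the objects of type `0` need not be the standard natural numbers. -/
structure TypeStr : Type (u + 1) where
  /-- the objects of a given type -/
  el : Ty → Type u
  /-- application -/
  app : ∀ {σ τ : Ty}, el (.fn σ τ) → el σ → el τ
  zero : el .nat
  succ : el .one
  /-- the combinator `Π` -/
  combK : ∀ σ τ : Ty, el (.fn σ (.fn τ σ))
  /-- the combinator `Σ` -/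
  combS : ∀ ρ σ τ : Ty, el (.fn (.fn ρ (.fn σ τ)) (.fn (.fn ρ σ) (.fn ρ τ)))
  /-- the recursor `R₀` -/
  recr : el (.fn .nat (.fn .nat (.fn (.fn .nat .one) .nat)))

/-- The terms of the language; `var σ i` is the `i`-th variable of type `σ`. -/
inductive Term : Ty → Type
  | var (σ : Ty) (i : ℕ) : Term σ
  | zero : Term .nat
  | succ : Term .one
  | combK (σ τ : Ty) : Term (.fn σ (.fn τ σ))
  | combS (ρ σ τ : Ty) : Term (.fn (.fn ρ (.fn σ τ)) (.fn (.fn ρ σ) (.fn ρ τ)))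
  | recr : Term (.fn .nat (.fn .nat (.fn (.fn .nat .one) .nat)))
  | app {σ τ : Ty} (s : Term (.fn σ τ)) (t : Term σ) : Term τ

/-- The quantifier-free formulas. The prime formulas are the equations between terms of type `0`;
equality at higher types is a defined notion that involves quantifiers. -/
inductive QFFormula : Type
  | eq (s t : Term .nat) : QFFormula
  | neg (A : QFFormula) : QFFormula
  | and (A B : QFFormula) : QFFormula
  | or (A B : QFFormula) : QFFormula
  | imp (A B : QFFormula) : QFFormula

namespace TypeStr

instance (M : TypeStr.{u}) (σ τ : Ty) :
    CoeFun (M.el (.fn σ τ)) (fun _ => M.el σ → M.el τ) := ⟨M.app⟩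

variable (M : TypeStr.{u})

/-- An assignment of objects to the variables. -/
abbrev Valuation : Type u := (σ : Ty) → ℕ → M.el σ

/-- The assignment `v` with the value of the `i`-th variable of type `σ` changed to `a`. -/
def Valuation.set {M : TypeStr.{u}} (v : M.Valuation) (σ : Ty) (i : ℕ) (a : M.el σ) :
    M.Valuation :=
  Function.update v σ (Function.update (v σ) i a)

/-- The value of a term. -/
def eval (v : M.Valuation) : {σ : Ty} → Term σ → M.el σ
  | _, .var σ i => v σ i
  | _, .zero => M.zero
  | _, .succ => M.succ
  | _, .combK σ τ => M.combK σ τ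
  | _, .combS ρ σ τ => M.combS ρ σ τ
  | _, .recr => M.recr
  | _, .app s t => M.app (eval v s) (eval v t)

/-- Satisfaction of a quantifier-free formula. -/
def Sat (v : M.Valuation) : QFFormula → Prop
  | .eq s t => M.eval v s = M.eval v t
  | .neg A => ¬ Sat v A
  | .and A B => Sat v A ∧ Sat v B
  | .or A B => Sat v A ∨ Sat v B
  | .imp A B => Sat v A → Sat v B

/-- Equality at all finite types, defined pointwise from equality at type `0`. -/
def Eqv : (σ : Ty) → M.el σ → M.el σ → Prop
  | .nat, x, y => x = y
  | .fn σ τ, f, g => ∀ x : M.el σ, Eqv τ (f x) (g x)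

/-- `M` is a model of Kohlenbach's base theory `RCA₀^ω = E-PRA^ω + QF-AC^{1,0}`. -/
structure ModelsRCA₀ω : Prop where
  succ_ne_zero : ∀ x : M.el .nat, M.succ x ≠ M.zero
  succ_inj : ∀ x y : M.el .nat, M.succ x = M.succ y → x = y
  combK_eq : ∀ (σ τ : Ty) (x : M.el σ) (y : M.el τ), M.Eqv σ (M.combK σ τ x y) x
  combS_eq : ∀ (ρ σ τ : Ty) (x : M.el (.fn ρ (.fn σ τ))) (y : M.el (.fn ρ σ)) (z : M.el ρ),
    M.Eqv τ (M.combS ρ σ τ x y z) (x z (y z))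
  recr_zero : ∀ (y : M.el .nat) (z : M.el (.fn .nat .one)), M.recr M.zero y z = y
  recr_succ : ∀ (x y : M.el .nat) (z : M.el (.fn .nat .one)),
    M.recr (M.succ x) y z = z (M.recr x y z) x
  /-- the axiom of extensionality -/
  ext : ∀ (σ τ : Ty) (z : M.el (.fn σ τ)) (x y : M.el σ), M.Eqv σ x y → M.Eqv τ (z x) (z y)
  /-- induction for quantifier-free formulas, with parameters of arbitrary types -/
  qfInd : ∀ (A : QFFormula) (v : M.Valuation) (i : ℕ),
    M.Sat (v.set .nat i M.zero) A →
    (∀ n : M.el .nat, M.Sat (v.set .nat i n) A → M.Sat (v.set .nat i (M.succ n)) A) →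
    ∀ n : M.el .nat, M.Sat (v.set .nat i n) A
  /-- choice from type `1` to type `0` for quantifier-free formulas, with parameters of arbitrary
  types -/
  qfAC : ∀ (A : QFFormula) (v : M.Valuation) (i j : ℕ),
    (∀ f : M.el .one, ∃ n : M.el .nat, M.Sat ((v.set .one i f).set .nat j n) A) →
    ∃ F : M.el .two, ∀ f : M.el .one, M.Sat ((v.set .one i f).set .nat j (F f)) A

/-! ## Kleene's quantifiers -/

/-- Kleene's `(∃²)`. -/
def Exists2 : Prop :=
  ∃ E : M.el .two, ∀ f : M.el .one, E f = M.zero ↔ ∃ n : M.el .nat, f n = M.zero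

/-- Kleene's `(∃³)`. -/
def Exists3 : Prop :=
  ∃ E : M.el .three, ∀ Y : M.el .two, E Y = M.zero ↔ ∃ f : M.el .one, Y f = M.zero

/-! ## Arithmetic inside a structure

From here on, every quantifier in a definition ranges over objects of the structure, so that each
definition is the interpretation in `M` of a formula of the language of all finite types. -/

/-- The natural numbers of the structure. -/
abbrev Nt : Type u := M.el .nat

/-- The object `λ r. λ x. g r`. -/
def ignoreSnd (g : M.el .one) : M.el (.fn .nat .one) :=
  M.combS .nat .nat .one (M.combK (.fn .nat .one) .nat (M.combK .nat .nat)) g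

/-- `a + b`, by recursion on `b`. -/
def add (a b : M.Nt) : M.Nt := M.recr b a (M.ignoreSnd M.succ)

/-- The object `λ r. r + a`. -/
def addRight (a : M.Nt) : M.el .one :=
  M.combS .nat (.fn .nat .one) .nat (M.recr a)
    (M.combK (.fn .nat .one) .nat (M.ignoreSnd M.succ))

/-- `a * b`, by recursion on `b`. -/
def mul (a b : M.Nt) : M.Nt := M.recr b M.zero (M.ignoreSnd (M.addRight a))

/-- The object `λ r. r + r`. -/
def double : M.el .one :=
  M.combS .nat (.fn .nat .one) .nat
    (M.combS .nat .nat (.fn (.fn .nat .one) .nat) M.recr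
      (M.combS .nat .one .nat (M.combK .nat .one) (M.combK .nat .nat)))
    (M.combK (.fn .nat .one) .nat (M.ignoreSnd M.succ))

/-- The number `1`. -/
def one : M.Nt := M.succ M.zero

/-- The number `2`. -/
def two : M.Nt := M.succ M.one

/-- `2 ^ n`, by recursion on `n`. -/
def pow2 (n : M.Nt) : M.Nt := M.recr n M.one (M.ignoreSnd M.double)

/-- `a ≤ b` for natural numbers. -/
def NLe (a b : M.Nt) : Prop := ∃ c : M.Nt, M.add a c = b

/-- `a < b` for natural numbers. -/
def NLt (a b : M.Nt) : Prop := M.NLe (M.succ a) b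

section checks

variable {M}

theorem ModelsRCA₀ω.ignoreSnd_app (h : M.ModelsRCA₀ω) (g : M.el .one) (r x : M.Nt) :
    M.ignoreSnd g r x = g r := by
  have h1 := h.combS_eq .nat .nat .one (M.combK (.fn .nat .one) .nat (M.combK .nat .nat)) g r x
  have h2 := h.combK_eq (.fn .nat .one) .nat (M.combK .nat .nat) r (g r) x
  have h3 := h.combK_eq .nat .nat (g r) x
  exact h1.trans (h2.trans h3)

theorem ModelsRCA₀ω.add_zero (h : M.ModelsRCA₀ω) (a : M.Nt) : M.add a M.zero = a :=
  h.recr_zero _ _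

theorem ModelsRCA₀ω.add_succ (h : M.ModelsRCA₀ω) (a b : M.Nt) :
    M.add a (M.succ b) = M.succ (M.add a b) :=
  (h.recr_succ _ _ _).trans (h.ignoreSnd_app _ _ _)

theorem ModelsRCA₀ω.addRight_app (h : M.ModelsRCA₀ω) (a r : M.Nt) :
    M.addRight a r = M.add r a := by
  have h1 := h.combS_eq .nat (.fn .nat .one) .nat (M.recr a)
    (M.combK (.fn .nat .one) .nat (M.ignoreSnd M.succ)) r
  exact h1.trans (h.ext _ _ (M.recr a r) _ _ (h.combK_eq (.fn .nat .one) .nat _ r))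

theorem ModelsRCA₀ω.mul_zero (h : M.ModelsRCA₀ω) (a : M.Nt) : M.mul a M.zero = M.zero :=
  h.recr_zero _ _

theorem ModelsRCA₀ω.mul_succ (h : M.ModelsRCA₀ω) (a b : M.Nt) :
    M.mul a (M.succ b) = M.add (M.mul a b) a :=
  (h.recr_succ _ _ _).trans ((h.ignoreSnd_app _ _ _).trans (h.addRight_app _ _))

theorem ModelsRCA₀ω.double_app (h : M.ModelsRCA₀ω) (r : M.Nt) : M.double r = M.add r r := by
  have h1 := h.combS_eq .nat (.fn .nat .one) .nat
    (M.combS .nat .nat (.fn (.fn .nat .one) .nat) M.recr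
      (M.combS .nat .one .nat (M.combK .nat .one) (M.combK .nat .nat)))
    (M.combK (.fn .nat .one) .nat (M.ignoreSnd M.succ)) r
  have h2 := h.combS_eq .nat .nat (.fn (.fn .nat .one) .nat) M.recr
    (M.combS .nat .one .nat (M.combK .nat .one) (M.combK .nat .nat)) r
  have h3 := h.combS_eq .nat .one .nat (M.combK .nat .one) (M.combK .nat .nat) r
  have h4 := h.combK_eq .nat .one r (M.combK .nat .nat r)
  have h5 : M.combS .nat .one .nat (M.combK .nat .one) (M.combK .nat .nat) r = r := h3.trans h4
  rw [h5] at h2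
  exact h1.trans ((h2 _).trans
    (h.ext _ _ (M.recr r r) _ _ (h.combK_eq (.fn .nat .one) .nat _ r)))

theorem ModelsRCA₀ω.pow2_zero (h : M.ModelsRCA₀ω) : M.pow2 M.zero = M.one :=
  h.recr_zero _ _

theorem ModelsRCA₀ω.pow2_succ (h : M.ModelsRCA₀ω) (n : M.Nt) :
    M.pow2 (M.succ n) = M.add (M.pow2 n) (M.pow2 n) :=
  (h.recr_succ _ _ _).trans ((h.ignoreSnd_app _ _ _).trans (h.double_app _))

end checks

/-! ## Rational numbers inside a structure -/

/-- The fraction `(pos - neg) / den` (with `den` nonzero in all uses). -/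
structure Frac where
  pos : M.Nt
  neg : M.Nt
  den : M.Nt

namespace Frac

variable {M}

/-- `q + r`. -/
def add (q r : Frac M) : Frac M :=
  ⟨M.add (M.mul q.pos r.den) (M.mul r.pos q.den),
   M.add (M.mul q.neg r.den) (M.mul r.neg q.den), M.mul q.den r.den⟩

/-- `q - r`. -/
def sub (q r : Frac M) : Frac M := q.add ⟨r.neg, r.pos, r.den⟩

/-- `q ≤ r`. -/
def Le (q r : Frac M) : Prop :=
  M.NLe (M.add (M.mul q.pos r.den) (M.mul r.neg q.den))
    (M.add (M.mul r.pos q.den) (M.mul q.neg r.den))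

/-- `q < r`. -/
def Lt (q r : Frac M) : Prop :=
  M.NLt (M.add (M.mul q.pos r.den) (M.mul r.neg q.den))
    (M.add (M.mul r.pos q.den) (M.mul q.neg r.den))

/-- `|q - r| ≤ e`. -/
def DistLe (q r e : Frac M) : Prop := (q.sub r).Le e ∧ (r.sub q).Le e

/-- `|q - r| < e`. -/
def DistLt (q r e : Frac M) : Prop := (q.sub r).Lt e ∧ (r.sub q).Lt e

end Frac

/-- `0` as a fraction. -/
def fracZero : Frac M := ⟨M.zero, M.zero, M.one⟩

/-- `1` as a fraction. -/
def fracOne : Frac M := ⟨M.one, M.zero, M.one⟩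

/-- `2 ^ (-n)` as a fraction. -/
def inv2 (n : M.Nt) : Frac M := ⟨M.one, M.zero, M.pow2 n⟩

/-- `2 ^ (-n + 1)` as a fraction. -/
def twoInv2 (n : M.Nt) : Frac M := ⟨M.two, M.zero, M.pow2 n⟩

/-- `c` is the Cantor code of the pair `(n, m)`, that is, `2 c = (n + m) ^ 2 + 3 n + m`. -/
def IsPair (c n m : M.Nt) : Prop :=
  M.add c c = M.add (M.mul (M.add n m) (M.add n m)) (M.add (M.add n (M.add n n)) m)

/-- `c` is the code of the rational number `q`: the code of the pair `(n, m)` stands for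
`(n / 2) / (m + 1)` if `n` is even, and for `- ((n + 1) / 2) / (m + 1)` if `n` is odd. -/
def Codes (c : M.Nt) (q : Frac M) : Prop :=
  ∃ n m : M.Nt, M.IsPair c n m ∧ q.den = M.succ m ∧
    ((n = M.add q.pos q.pos ∧ q.neg = M.zero) ∨ (M.succ n = M.add q.neg q.neg ∧ q.pos = M.zero))

instance : Nonempty (Frac M) := ⟨M.fracZero⟩

/-- The rational number with the code `c`. -/
noncomputable def decode (c : M.Nt) : Frac M := Classical.epsilon (M.Codes c)

/-! ## Real numbers inside a structure -/

/-- The sequence of rational numbers coded by an object of type `1`. -/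
noncomputable def seq (x : M.el .one) (n : M.Nt) : Frac M := M.decode (x n)

section sequences

variable {M}

/-- The sequence of rationals converges fast: `|q_n - q_{n+i}| < 2 ^ (-n)`. -/
def FastCauchy (q : M.Nt → Frac M) : Prop :=
  ∀ n i : M.Nt, (q n).DistLt (q (M.add n i)) (M.inv2 n)

/-- The reals given by `q` and `r` are equal. -/
def SeqEq (q r : M.Nt → Frac M) : Prop := ∀ n : M.Nt, (q n).DistLe (r n) (M.twoInv2 n)

/-- `q ≤ r` for the reals given by `q` and `r`, that is, `q_n ≤ r_n + 2 ^ (-n + 1)` for all `n`. -/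
def SeqLe (q r : M.Nt → Frac M) : Prop := ∀ n : M.Nt, (q n).Le ((r n).add (M.twoInv2 n))

end sequences

/-- The (representatives of) real numbers: fast-converging sequences of rationals. -/
def Reals : Set (M.el .one) := {x | FastCauchy (M.seq x)}

/-- `x =_ℝ y`. -/
def REq (x y : M.el .one) : Prop := SeqEq (M.seq x) (M.seq y)

/-- `x ≤_ℝ y`. -/
def RLe (x y : M.el .one) : Prop := SeqLe (M.seq x) (M.seq y)

/-- `x <_ℝ y`. -/
def RLt (x y : M.el .one) : Prop := ¬ M.RLe y x

/-- `|x - y| < 2 ^ (-k)` for reals: `|x_n - y_n| + 2 ^ (-n + 1) < 2 ^ (-k)` for some `n`. -/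
def Near (k : M.Nt) (x y : M.el .one) : Prop :=
  ∃ n : M.Nt, (((M.seq x n).sub (M.seq y n)).add (M.twoInv2 n)).Lt (M.inv2 k) ∧
    (((M.seq y n).sub (M.seq x n)).add (M.twoInv2 n)).Lt (M.inv2 k)

/-- `0 < x` for reals. -/
def RPos (x : M.el .one) : Prop := ¬ SeqLe (M.seq x) (fun _ => M.fracZero)

/-- `x < 1` for reals. -/
def RLtOne (x : M.el .one) : Prop := ¬ SeqLe (fun _ => M.fracOne) (M.seq x)

/-- The unit interval `[0,1]`. -/
def UnitI : Set (M.el .one) :=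
  {x | x ∈ M.Reals ∧ SeqLe (fun _ => M.fracZero) (M.seq x) ∧
    SeqLe (M.seq x) (fun _ => M.fracOne)}

/-- `f` represents a function from `D` (a subset of the reals) to the reals: it sends reals to
reals and equal reals to equal reals. -/
def IsFunOn (D : Set (M.el .one)) (f : M.el .realFn) : Prop :=
  (∀ x ∈ D, f x ∈ M.Reals) ∧ ∀ x ∈ D, ∀ y ∈ D, M.REq x y → M.REq (f x) (f y)

/-- The reals `s n` converge to the real `x`. -/
def ConvergesTo (s : M.Nt → M.el .one) (x : M.el .one) : Prop :=
  ∀ k : M.Nt, ∃ m : M.Nt, ∀ n : M.Nt, M.NLe m n → M.Near k (s n) x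

/-- `f` is continuous at every point of `D`, as a function on `D`. -/
def IsContOn (D : Set (M.el .one)) (f : M.el .realFn) : Prop :=
  ∀ x ∈ D, ∀ k : M.Nt, ∃ m : M.Nt, ∀ y ∈ D, M.Near m x y → M.Near k (f x) (f y)

/-! ## Sets of reals inside a structure

Sets of reals that are quantified over are objects `F` of type `2` that represent characteristic
functions. Lean sets of reals only stand for formulas with a free variable of type `1`; in this way
closures, interiors and inverse images make sense whether or not they exist as objects. -/

/-- `F` represents a function from the reals to `{0, 1}`. -/
def IsCharFun (F : M.el .two) : Prop :=
  (∀ x ∈ M.Reals, F x = M.zero ∨ F x = M.one) ∧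
    ∀ x ∈ M.Reals, ∀ y ∈ M.Reals, M.REq x y → F x = F y

/-- The set of reals with the characteristic function `F`. -/
def setOf (F : M.el .two) : Set (M.el .one) := {x | x ∈ M.Reals ∧ F x = M.one}

/-- The closure of `S` in the subspace `D`. -/
def clIn (D S : Set (M.el .one)) : Set (M.el .one) :=
  {x | x ∈ D ∧ ∀ k : M.Nt, ∃ y ∈ D ∩ S, M.Near k x y}

/-- The interior of `S` in the subspace `D`, that is, the points of `D` of which `S` is a
neighbourhood in `D`. -/
def intIn (D S : Set (M.el .one)) : Set (M.el .one) :=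
  {x | x ∈ D ∧ ∃ k : M.Nt, ∀ y ∈ D, M.Near k x y → y ∈ S}

/-- The boundary of `S` in the subspace `D`. -/
def bdIn (D S : Set (M.el .one)) : Set (M.el .one) := M.clIn D S ∩ M.clIn D Sᶜ

/-- `D ∩ S` is open in the subspace `D`. -/
def IsOpenIn (D S : Set (M.el .one)) : Prop := D ∩ S ⊆ M.intIn D S

/-- `S` is pre-open in the subspace `D`: it is contained in the interior of its closure. -/
def IsPreOpenIn (D S : Set (M.el .one)) : Prop := D ∩ S ⊆ M.intIn D (M.clIn D S)

/-- `S` is a `𝒞`-set in the subspace `D`: it is the intersection of an open set with a pre-open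
one. -/
def IsCSetIn (D S : Set (M.el .one)) : Prop :=
  ∃ O A : M.el .two, M.IsCharFun O ∧ M.IsCharFun A ∧
    M.IsOpenIn D (M.setOf O) ∧ M.IsPreOpenIn D (M.setOf A) ∧
    D ∩ S = D ∩ (M.setOf O ∩ M.setOf A)

/-- The inverse image `f⁻¹(S) ⊆ [0,1]` of `S` under `f : [0,1] → ℝ`. -/
def preim (f : M.el .realFn) (S : Set (M.el .one)) : Set (M.el .one) := {x | x ∈ M.UnitI ∧ f x ∈ S}

/-! ## Weak continuity notions for (representatives of) functions `f : [0,1] → ℝ`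

All topological notions for subsets of `[0,1]` are relative to `[0,1]`. -/

/-- The Young condition: every `x` is the limit of sequences in `[0,1]` on the left and on the
right of `x` along which `f` converges to `f x` (at an end-point, only the one side on which there
are points of `[0,1]` is considered). -/
def Young (f : M.el .realFn) : Prop :=
  ∀ x ∈ M.UnitI,
    (M.RPos x → ∃ s : M.el (.fn .nat .one), (∀ n : M.Nt, s n ∈ M.UnitI ∧ M.RLt (s n) x) ∧
      M.ConvergesTo (fun n => s n) x ∧ M.ConvergesTo (fun n => f (s n)) (f x)) ∧
    (M.RLtOne x → ∃ s : M.el (.fn .nat .one), (∀ n : M.Nt, s n ∈ M.UnitI ∧ M.RLt x (s n)) ∧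
      M.ConvergesTo (fun n => s n) x ∧ M.ConvergesTo (fun n => f (s n)) (f x))

/-- Almost continuity in the sense of Husain. -/
def HusainAlmostCont (f : M.el .realFn) : Prop :=
  ∀ x ∈ M.UnitI, ∀ G : M.el .two, M.IsCharFun G → M.IsOpenIn M.Reals (M.setOf G) →
    f x ∈ M.setOf G → x ∈ M.intIn M.UnitI (M.clIn M.UnitI (M.preim f (M.setOf G)))

/-- Graph continuity: the graph of some continuous `g : [0,1] → ℝ` is contained in the closure of
the graph of `f` in the plane. -/
def GraphCont (f : M.el .realFn) : Prop :=
  ∃ g : M.el .realFn, M.IsFunOn M.UnitI g ∧ M.IsContOn M.UnitI g ∧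
    ∀ x ∈ M.UnitI, ∀ k : M.Nt, ∃ z ∈ M.UnitI, M.Near k x z ∧ M.Near k (g x) (f z)

/-- `f` is of Cesàro type: there are non-empty open `U ⊆ [0,1]` and `V ⊆ ℝ` such that `U` is
contained in the closure of `f⁻¹(y)` for every `y` in `V`. -/
def CesaroType (f : M.el .realFn) : Prop :=
  ∃ U V : M.el .two, M.IsCharFun U ∧ M.IsCharFun V ∧
    M.IsOpenIn M.Reals (M.setOf U) ∧ M.IsOpenIn M.Reals (M.setOf V) ∧
    (M.setOf U).Nonempty ∧ (M.setOf V).Nonempty ∧ M.setOf U ⊆ M.UnitI ∧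
    ∀ y ∈ M.setOf V, M.setOf U ⊆ M.clIn M.UnitI (M.preim f {w | M.REq w y})

/-- Peripheral continuity: for `x ∈ [0,1]` and open intervals `U = (a, b)` and `V = (c, d)` with
`x ∈ U` and `f x ∈ V`, there is an open `W ⊆ U` with `x ∈ W` and `f(∂W) ⊆ V`. -/
def PeriphCont (f : M.el .realFn) : Prop :=
  ∀ x ∈ M.UnitI, ∀ a ∈ M.Reals, ∀ b ∈ M.Reals, ∀ c ∈ M.Reals, ∀ d ∈ M.Reals,
    M.RLt a x → M.RLt x b → M.RLt c (f x) → M.RLt (f x) d →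
    ∃ W : M.el .two, M.IsCharFun W ∧ M.IsOpenIn M.UnitI (M.setOf W) ∧ x ∈ M.setOf W ∧
      (∀ y ∈ M.UnitI ∩ M.setOf W, M.RLt a y ∧ M.RLt y b) ∧
      ∀ z ∈ M.bdIn M.UnitI (M.setOf W), M.RLt c (f z) ∧ M.RLt (f z) d

/-- Pre-continuity: inverse images of open sets are pre-open. -/
def PreCont (f : M.el .realFn) : Prop :=
  ∀ G : M.el .two, M.IsCharFun G → M.IsOpenIn M.Reals (M.setOf G) →
    M.IsPreOpenIn M.UnitI (M.preim f (M.setOf G))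

/-- `𝒞`-continuity: inverse images of open sets are `𝒞`-sets. -/
def CCont (f : M.el .realFn) : Prop :=
  ∀ G : M.el .two, M.IsCharFun G → M.IsOpenIn M.Reals (M.setOf G) →
    M.IsCSetIn M.UnitI (M.preim f (M.setOf G))

/-! ## Supremum functionals -/

/-- The sequence of rationals that follows the first value of `e`. -/
noncomputable def tailSeq (e : M.el .one) (n : M.Nt) : Frac M := M.decode (e (M.succ n))

/-- `e` represents the real number given by the values of `e` after the first one. -/
def IsFinite (e : M.el .one) : Prop := e M.zero = M.zero ∧ FastCauchy (M.tailSeq e)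

/-- `e` represents `+∞`. -/
def IsPosInf (e : M.el .one) : Prop := e M.zero = M.one

/-- `e` represents `-∞`. -/
def IsNegInf (e : M.el .one) : Prop := e M.zero = M.two

/-- The (representatives of) extended reals. -/
def ExtReals : Set (M.el .one) := {e | M.IsFinite e ∨ M.IsPosInf e ∨ M.IsNegInf e}

/-- Equality of extended reals. -/
def ExtEq (e e' : M.el .one) : Prop :=
  (M.IsFinite e ∧ M.IsFinite e' ∧ SeqEq (M.tailSeq e) (M.tailSeq e')) ∨
    (M.IsPosInf e ∧ M.IsPosInf e') ∨ (M.IsNegInf e ∧ M.IsNegInf e')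

/-- `x ≤ e` for a real `x` and an extended real `e`. -/
def RealLeExt (x e : M.el .one) : Prop :=
  (M.IsFinite e ∧ SeqLe (M.seq x) (M.tailSeq e)) ∨ M.IsPosInf e

/-- `e ≤ x` for an extended real `e` and a real `x`. -/
def ExtLeReal (e x : M.el .one) : Prop :=
  (M.IsFinite e ∧ SeqLe (M.tailSeq e) (M.seq x)) ∨ M.IsNegInf e

/-- The extended real `e` is the supremum, that is, the least upper bound, of `f` on `[0,1]`.
(It is enough to compare `e` with the real upper bounds: `+∞` is above everything, and `-∞` is not
an upper bound.) -/
def IsSup (f : M.el .realFn) (e : M.el .one) : Prop :=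
  e ∈ M.ExtReals ∧ (∀ x ∈ M.UnitI, M.RealLeExt (f x) e) ∧
    ∀ b ∈ M.Reals, (∀ x ∈ M.UnitI, M.RLe (f x) b) → M.ExtLeReal e b

/-- `Ξ` represents a functional from `ℝ → ℝ` to the extended reals: it sends functions to extended
reals and equal functions to equal extended reals. -/
def IsExtFunctional (Ξ : M.el (.fn .realFn .one)) : Prop :=
  (∀ f : M.el .realFn, M.IsFunOn M.Reals f → Ξ f ∈ M.ExtReals) ∧
    ∀ f g : M.el .realFn, M.IsFunOn M.Reals f → M.IsFunOn M.Reals g →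
      (∀ x ∈ M.Reals, M.REq (f x) (g x)) → M.ExtEq (Ξ f) (Ξ g)

/-- `Ξ : (ℝ → ℝ) → ℝ̄` is a supremum functional for the class `Γ`: for every `f : [0,1] → ℝ` in `Γ`,
`Ξ f` is the supremum of `f` on `[0,1]`. -/
def IsSupFunctional (Γ : M.el .realFn → Prop) (Ξ : M.el (.fn .realFn .one)) : Prop :=
  M.IsExtFunctional Ξ ∧
    ∀ f : M.el .realFn, M.IsFunOn M.UnitI f → Γ f → M.IsSup f (Ξ f)

end TypeStr

/-- The seven weak continuity notions. -/
inductive WeakCont : Type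
  | young
  | husainAlmostContinuous
  | graphContinuous
  | notOfCesaroType
  | peripherallyContinuous
  | preContinuous
  | cContinuous

/-- The class of functions `f : [0,1] → ℝ` given by a weak continuity notion. -/
def WeakCont.Class (M : TypeStr.{u}) : WeakCont → M.el .realFn → Prop
  | .young, f => M.Young f
  | .husainAlmostContinuous, f => M.HusainAlmostCont f
  | .graphContinuous, f => M.GraphCont f
  | .notOfCesaroType, f => ¬ M.CesaroType f
  | .peripherallyContinuous, f => M.PeriphCont f
  | .preContinuous, f => M.PreCont f
  | .cContinuous, f => M.CCont f

end HigherOrderRM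

/-!
Everything takes place inside an arbitrary model `M` of `RCA₀^ω`. Four tools make it possible to
argue there as in ordinary mathematics.

* Combinatory completeness: a function of finitely many variables is `IsDef` if an object of `M`
  represents it. This is a class, so that instance search builds the `λ`-terms.
* Under `(∃²)`, a predicate is `Dec` if it is the zero set of a definable function. These predicates
  are closed under connectives and number quantifiers (`Dec.exists`), admit induction
  (`dec_induction`), and have definable least witnesses (`exists_select`): this is arithmetical
  comprehension with parameters of all types.
* The natural numbers of `M` form an ordered semiring, whose field of fractions `Rat` is the field
  of rationals of `M`.
* An ultrapower `Hyper` of `Rat` gives each real of `M` a value `realVal`; order, equality and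
  distance of reals are those of the values up to errors `2 ^ (-n)` (`rLe_iff`, `near_iff`), so that
  estimates between reals are linear arithmetic in an ordered field.

From `(∃³)` to a supremum functional: `(∃³)` decides whether a function exceeds a given rational on
`[0,1]`. For every `n`, take the least code of a rational below the supremum by at most
`2 ^ (-(n + 2))`. These rationals form a fast converging sequence, which depends on the values of
the function only (`exists_isSupFunctional`), and no weak continuity is needed.

From a supremum functional `Ξ` and `(∃²)` to `(∃³)`: relative to a position `k`, a real codes the
function that sends `n` to the least `m` such that the real has the digit `1` at the position
`k + 2 c`, where `c` is the code of the pair `(n, m)`. For a functional `Y`, let `f_Y` be the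
characteristic function of the reals that code a zero of `Y` relative to some position; it is given
by `(∃²)`, uniformly in `Y`. The first digits are free, so the reals that code a given zero are
dense (`exists_codesZero_grid`), while dyadic rationals code no function, as their digits are
eventually `0` (`exists_not_codesZero_grid`). So on `[0,1]` the function `f_Y` is constantly `0` or
the characteristic function of a dense set with a dense complement. Such functions satisfy all seven
conditions (`IsSplit.mem_class`), mainly because every point is a limit, from both sides, of points
with the same value. Now `Y` has a zero if and only if `Ξ f_Y` differs from the value of `Ξ` at the
zero function, and `(∃²)` decides this (`exists3_of_isSupFunctional`).
-/

namespace HigherOrderRM.TypeStr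

/-! ### Definability in a model -/

/-- The structures that satisfy the axioms of `RCA₀^ω`, as a class. -/
class Model (M : TypeStr.{u}) : Prop where
  axioms : M.ModelsRCA₀ω

variable {M : TypeStr.{u}}

theorem Eqv.refl : ∀ (σ : Ty) (x : M.el σ), M.Eqv σ x x
  | .nat, _ => rfl
  | .fn _ τ, x => fun y => Eqv.refl τ (x y)

theorem Eqv.symm : ∀ {σ : Ty} {x y : M.el σ}, M.Eqv σ x y → M.Eqv σ y x
  | .nat, _, _, h => Eq.symm h
  | .fn _ _, _, _, h => fun z => Eqv.symm (h z)

theorem Eqv.trans : ∀ {σ : Ty} {x y z : M.el σ}, M.Eqv σ x y → M.Eqv σ y z → M.Eqv σ x z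
  | .nat, _, _, _, h, h' => Eq.trans h h'
  | .fn _ _, _, _, _, h, h' => fun w => Eqv.trans (h w) (h' w)

theorem Eqv.app [hM : Model M] {σ τ : Ty} {f g : M.el (.fn σ τ)} {x y : M.el σ}
    (h : M.Eqv (.fn σ τ) f g) (h' : M.Eqv σ x y) : M.Eqv τ (f x) (g y) :=
  (h x).trans (hM.axioms.ext σ τ g x y h')

/-- Lean types that serve as contexts of variables: an environment `e : C` assigns objects to
finitely many variables. An object of type `arr τ` takes the values of these variables as its
successive arguments, and `ap` applies it to all of them. -/
class Context (M : TypeStr.{u}) (C : Type u) where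
  arr : Ty → Ty
  ap : ∀ {τ : Ty}, M.el (arr τ) → C → M.el τ
  const : ∀ {τ : Ty} (c : M.el τ), ∃ F : M.el (arr τ), ∀ e, M.Eqv τ (ap F e) c
  comp : ∀ {σ τ : Ty} (F : M.el (arr (.fn σ τ))) (G : M.el (arr σ)),
    ∃ H : M.el (arr τ), ∀ e, M.Eqv τ (ap H e) (ap F e (ap G e))

instance : Context M PUnit.{u + 1} where
  arr τ := τ
  ap F _ := F
  const c := ⟨c, fun _ => Eqv.refl _ c⟩
  comp F G := ⟨F G, fun _ => Eqv.refl _ _⟩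

instance {C : Type u} [Model M] [Context M C] {ρ : Ty} : Context M (C × M.el ρ) where
  arr τ := Context.arr M C (.fn ρ τ)
  ap F e := Context.ap F e.1 e.2
  const {τ} c := by
    obtain ⟨F, hF⟩ := Context.const (C := C) (M.combK τ ρ c)
    exact ⟨F, fun e => (hF e.1 e.2).trans (Model.axioms.combK_eq _ _ _ _)⟩
  comp {σ τ} F G := by
    obtain ⟨S, hS⟩ := Context.const (C := C) (M.combS ρ σ τ)
    obtain ⟨A, hA⟩ := Context.comp S F
    obtain ⟨H, hH⟩ := Context.comp A G
    refine ⟨H, fun e => (hH e.1 e.2).trans ?_⟩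
    have h1 := (hA e.1).trans ((hS e.1).app (Eqv.refl _ (Context.ap F e.1)))
    exact (h1 (Context.ap G e.1) e.2).trans (Model.axioms.combS_eq _ _ _ _ _ _)

section definability

variable {C : Type u} [Context M C]

/-- A function of the variables of a context is definable if an object of the structure
represents it. Being a class, it lets instance search assemble the `λ`-terms. -/
class IsDef {τ : Ty} (φ : C → M.el τ) : Prop where
  exists_rep : ∃ F : M.el (Context.arr M C τ), ∀ e, M.Eqv τ (Context.ap F e) (φ e)

theorem IsDef.congr {τ : Ty} {φ : C → M.el τ} (h : IsDef φ) {ψ : C → M.el τ}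
    (h' : ∀ e, M.Eqv τ (φ e) (ψ e)) : IsDef ψ :=
  let ⟨F, hF⟩ := h.exists_rep
  ⟨F, fun e => (hF e).trans (h' e)⟩

instance (priority := 900) IsDef.const {τ : Ty} (c : M.el τ) : IsDef (fun _ : C => c) :=
  ⟨Context.const c⟩

variable [Model M]

instance IsDef.app {σ τ : Ty} (φ : C → M.el (.fn σ τ)) (ψ : C → M.el σ) [hφ : IsDef φ]
    [hψ : IsDef ψ] : IsDef (fun e => M.app (φ e) (ψ e)) := by
  obtain ⟨F, hF⟩ := hφ.exists_rep
  obtain ⟨G, hG⟩ := hψ.exists_rep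
  obtain ⟨H, hH⟩ := Context.comp F G
  exact ⟨H, fun e => (hH e).trans ((hF e).app (hG e))⟩

theorem IsDef.weaken {σ τ : Ty} {φ : C → M.el τ} (hφ : IsDef φ) :
    IsDef (fun e : C × M.el σ => φ e.1) := by
  obtain ⟨F, hF⟩ := (IsDef.app (fun _ : C => M.combK τ σ) φ).exists_rep
  exact ⟨F, fun e => (hF e.1 e.2).trans (Model.axioms.combK_eq _ _ _ _)⟩

instance (priority := 800) IsDef.weaken₁ {σ τ : Ty} (φ : C → M.el τ) [hφ : IsDef φ] :
    IsDef (fun e : C × M.el σ => φ e.1) := hφ.weaken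

instance (priority := 800) IsDef.weaken₂ {ρ σ τ : Ty} (φ : C → M.el τ) [hφ : IsDef φ] :
    IsDef (fun e : (C × M.el ρ) × M.el σ => φ e.1.1) := hφ.weaken.weaken

instance (priority := 800) IsDef.weaken₃ {π ρ σ τ : Ty} (φ : C → M.el τ) [hφ : IsDef φ] :
    IsDef (fun e : ((C × M.el π) × M.el ρ) × M.el σ => φ e.1.1.1) := hφ.weaken.weaken.weaken

/-- The identity of type `σ`. -/
def iden (M : TypeStr.{u}) (σ : Ty) : M.el (.fn σ σ) :=
  M.combS σ (.fn σ σ) σ (M.combK σ (.fn σ σ)) (M.combK σ σ)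

theorem iden_app {σ : Ty} (x : M.el σ) : M.Eqv σ (M.iden σ x) x :=
  (Model.axioms.combS_eq _ _ _ _ _ _).trans (Model.axioms.combK_eq _ _ _ _)

section var

variable {σ₀ σ₁ σ₂ σ₃ : Ty}

instance IsDef.var0 : IsDef (fun e : C × M.el σ₀ => e.2) := by
  obtain ⟨F, hF⟩ := (IsDef.const (C := C) (M.iden σ₀)).exists_rep
  exact ⟨F, fun e => (hF e.1 e.2).trans (iden_app _)⟩

instance IsDef.var1 : IsDef (fun e : (C × M.el σ₁) × M.el σ₀ => e.1.2) := IsDef.var0.weaken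

instance IsDef.var2 : IsDef (fun e : ((C × M.el σ₂) × M.el σ₁) × M.el σ₀ => e.1.1.2) :=
  IsDef.var1.weaken

instance IsDef.var3 :
    IsDef (fun e : (((C × M.el σ₃) × M.el σ₂) × M.el σ₁) × M.el σ₀ => e.1.1.1.2) :=
  IsDef.var2.weaken

end var

/-- Abstraction of the last variable. -/
theorem IsDef.lam {σ τ : Ty} (φ : C → M.el σ → M.el τ)
    [h : IsDef (fun e : C × M.el σ => φ e.1 e.2)] :
    ∃ ψ : C → M.el (.fn σ τ), IsDef ψ ∧ ∀ e x, M.Eqv τ (ψ e x) (φ e x) := by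
  obtain ⟨F, hF⟩ := h.exists_rep
  exact ⟨fun e => Context.ap (τ := .fn σ τ) F e, ⟨F, fun e => Eqv.refl _ _⟩, fun e x => hF (e, x)⟩

end definability

variable [Model M]

theorem exists_object {σ τ : Ty} (φ : M.el σ → M.el τ)
    [h : IsDef (fun e : PUnit × M.el σ => φ e.2)] :
    ∃ F : M.el (.fn σ τ), ∀ x, M.Eqv τ (F x) (φ x) :=
  let ⟨F, hF⟩ := h.exists_rep
  ⟨F, fun x => hF (⟨⟩, x)⟩

theorem exists_object₂ {ρ σ τ : Ty} (φ : M.el ρ → M.el σ → M.el τ)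
    [h : IsDef (fun e : (PUnit × M.el ρ) × M.el σ => φ e.1.2 e.2)] :
    ∃ F : M.el (.fn ρ (.fn σ τ)), ∀ x y, M.Eqv τ (F x y) (φ x y) :=
  let ⟨F, hF⟩ := h.exists_rep
  ⟨F, fun x y => hF ((⟨⟩, x), y)⟩

theorem exists_object₃ {ρ σ τ υ : Ty} (φ : M.el ρ → M.el σ → M.el τ → M.el υ)
    [h : IsDef (fun e : ((PUnit × M.el ρ) × M.el σ) × M.el τ => φ e.1.1.2 e.1.2 e.2)] :
    ∃ F : M.el (.fn ρ (.fn σ (.fn τ υ))), ∀ x y z, M.Eqv υ (F x y z) (φ x y z) :=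
  let ⟨F, hF⟩ := h.exists_rep
  ⟨F, fun x y z => hF (((⟨⟩, x), y), z)⟩

theorem Exists3.exists2 (h : M.Exists3) : M.Exists2 := by
  obtain ⟨E, hE⟩ := h
  obtain ⟨ψ, hψ, hψ'⟩ := IsDef.lam (C := PUnit × M.el .one) (σ := .one) (τ := .nat)
    (fun e g => e.2 (g M.zero))
  obtain ⟨F, hF⟩ := IsDef.exists_rep (φ := fun e : PUnit × M.el .one => M.app E (ψ e))
  refine ⟨F, fun f => ?_⟩
  have h1 : M.app F f = M.app E (ψ (⟨⟩, f)) := hF (⟨⟩, f)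
  rw [h1, hE]
  constructor
  · rintro ⟨g, hg⟩
    exact ⟨g M.zero, (hψ' (⟨⟩, f) g).symm.trans hg⟩
  · rintro ⟨n, hn⟩
    refine ⟨M.combK .nat .nat n, (hψ' (⟨⟩, f) _).trans ?_⟩
    have h2 : M.combK .nat .nat n M.zero = n := Model.axioms.combK_eq .nat .nat n M.zero
    exact (congrArg (M.app f) h2).trans hn

end HigherOrderRM.TypeStr

namespace HigherOrderRM.TypeStr

/-! ### The ordered semiring of natural numbers of a model -/

variable {M : TypeStr.{u}}

/-- A default object of each type. -/
def dflt (M : TypeStr.{u}) : ∀ σ : Ty, M.el σ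
  | .nat => M.zero
  | .fn σ τ => M.combK τ σ (dflt M τ)

section induction

variable [Model M]

/-- Induction for a disjunction of two equations between objects of type `1`. -/
theorem induction_or_obj (F G F' G' : M.el .one)
    (h0 : F M.zero = G M.zero ∨ F' M.zero = G' M.zero)
    (hs : ∀ n : M.Nt, (F n = G n ∨ F' n = G' n) →
      (F (M.succ n) = G (M.succ n) ∨ F' (M.succ n) = G' (M.succ n)))
    (n : M.Nt) : F n = G n ∨ F' n = G' n := by
  let t : ℕ → Term .nat := fun i => .app (.var .one i) (.var .nat 0)
  let v : M.Valuation := fun σ i =>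
    if h : σ = .one then h ▸ (if i = 0 then F else if i = 1 then G else if i = 2 then F' else G')
    else M.dflt σ
  have hv : ∀ n, M.Sat (v.set .nat 0 n) (.or (.eq (t 0) (t 1)) (.eq (t 2) (t 3))) ↔
      (F n = G n ∨ F' n = G' n) := fun n => by
    simp [Sat, eval, t, Valuation.set, v]
  have h := Model.axioms.qfInd (M := M) (.or (.eq (t 0) (t 1)) (.eq (t 2) (t 3))) v 0
  simp only [hv] at h
  exact h h0 hs n

theorem induction_or (φ ψ φ' ψ' : M.Nt → M.Nt)
    [h1 : IsDef (fun e : PUnit × M.el .nat => φ e.2)]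
    [h2 : IsDef (fun e : PUnit × M.el .nat => ψ e.2)]
    [h3 : IsDef (fun e : PUnit × M.el .nat => φ' e.2)]
    [h4 : IsDef (fun e : PUnit × M.el .nat => ψ' e.2)]
    (h0 : φ M.zero = ψ M.zero ∨ φ' M.zero = ψ' M.zero)
    (hs : ∀ n : M.Nt, (φ n = ψ n ∨ φ' n = ψ' n) →
      (φ (M.succ n) = ψ (M.succ n) ∨ φ' (M.succ n) = ψ' (M.succ n)))
    (n : M.Nt) : φ n = ψ n ∨ φ' n = ψ' n := by
  obtain ⟨F, hF⟩ := exists_object φ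
  obtain ⟨G, hG⟩ := exists_object ψ
  obtain ⟨F', hF'⟩ := exists_object φ'
  obtain ⟨G', hG'⟩ := exists_object ψ'
  have := induction_or_obj F G F' G'
  simp only [show ∀ x, M.app F x = φ x from hF, show ∀ x, M.app G x = ψ x from hG,
    show ∀ x, M.app F' x = φ' x from hF', show ∀ x, M.app G' x = ψ' x from hG'] at this
  exact this h0 hs n

theorem induction_eq (φ ψ : M.Nt → M.Nt)
    [h1 : IsDef (fun e : PUnit × M.el .nat => φ e.2)]
    [h2 : IsDef (fun e : PUnit × M.el .nat => ψ e.2)]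
    (h0 : φ M.zero = ψ M.zero)
    (hs : ∀ n : M.Nt, φ n = ψ n → φ (M.succ n) = ψ (M.succ n)) (n : M.Nt) : φ n = ψ n := by
  have := induction_or φ ψ φ ψ
  simp only [or_self] at this
  exact this h0 hs n

end induction

section semiring

variable [hM : Model M] {C : Type u} [Context M C]

instance IsDef.ignoreSnd (φ : C → M.el .one) [IsDef φ] : IsDef (fun e => M.ignoreSnd (φ e)) := by
  unfold TypeStr.ignoreSnd; infer_instance

instance IsDef.nAdd (φ ψ : C → M.Nt) [IsDef φ] [IsDef ψ] : IsDef (fun e => M.add (φ e) (ψ e)) := by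
  unfold TypeStr.add; infer_instance

instance IsDef.addRight (φ : C → M.Nt) [IsDef φ] : IsDef (fun e => M.addRight (φ e)) := by
  unfold TypeStr.addRight; infer_instance

instance IsDef.nMul (φ ψ : C → M.Nt) [IsDef φ] [IsDef ψ] : IsDef (fun e => M.mul (φ e) (ψ e)) := by
  unfold TypeStr.mul; infer_instance

instance IsDef.pow2 (φ : C → M.Nt) [IsDef φ] : IsDef (fun e => M.pow2 (φ e)) := by
  unfold TypeStr.pow2; infer_instance

theorem nAdd_zero (a : M.Nt) : M.add a M.zero = a := hM.axioms.add_zero a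

theorem nAdd_succ (a b : M.Nt) : M.add a (M.succ b) = M.succ (M.add a b) := hM.axioms.add_succ a b

theorem nMul_zero (a : M.Nt) : M.mul a M.zero = M.zero := hM.axioms.mul_zero a

theorem nMul_succ (a b : M.Nt) : M.mul a (M.succ b) = M.add (M.mul a b) a := hM.axioms.mul_succ a b

theorem zero_nAdd (a : M.Nt) : M.add M.zero a = a :=
  induction_eq (fun n => M.add M.zero n) (fun n => n) (nAdd_zero _)
    (fun n h => by simp only [nAdd_succ] at h ⊢; rw [h]) a

theorem succ_nAdd (a b : M.Nt) : M.add (M.succ a) b = M.succ (M.add a b) :=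
  induction_eq (fun n => M.add (M.succ a) n) (fun n => M.succ (M.add a n))
    (by simp only [nAdd_zero]) (fun n h => by simp only [nAdd_succ] at h ⊢; rw [h]) b

theorem nAdd_comm (a b : M.Nt) : M.add a b = M.add b a :=
  induction_eq (fun n => M.add a n) (fun n => M.add n a)
    (by simp only [nAdd_zero, zero_nAdd])
    (fun n h => by simp only [nAdd_succ, succ_nAdd] at h ⊢; rw [h]) b

theorem nAdd_assoc (a b c : M.Nt) : M.add (M.add a b) c = M.add a (M.add b c) :=
  induction_eq (fun n => M.add (M.add a b) n) (fun n => M.add a (M.add b n))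
    (by simp only [nAdd_zero]) (fun n h => by simp only [nAdd_succ] at h ⊢; rw [h]) c

theorem zero_nMul (a : M.Nt) : M.mul M.zero a = M.zero :=
  induction_eq (fun n => M.mul M.zero n) (fun _ => M.zero) (nMul_zero _)
    (fun n h => by simp only [nMul_succ, nAdd_zero] at h ⊢; rw [h]) a

theorem succ_nMul (a b : M.Nt) : M.mul (M.succ a) b = M.add (M.mul a b) b :=
  induction_eq (fun n => M.mul (M.succ a) n) (fun n => M.add (M.mul a n) n)
    (by simp only [nMul_zero, nAdd_zero])
    (fun n h => by
      simp only [nMul_succ, nAdd_succ] at h ⊢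
      rw [h, nAdd_assoc, nAdd_comm n a, ← nAdd_assoc]) b

theorem nMul_comm (a b : M.Nt) : M.mul a b = M.mul b a :=
  induction_eq (fun n => M.mul a n) (fun n => M.mul n a)
    (by simp only [nMul_zero, zero_nMul])
    (fun n h => by simp only [nMul_succ, succ_nMul] at h ⊢; rw [h]) b

theorem nMul_add (a b c : M.Nt) : M.mul a (M.add b c) = M.add (M.mul a b) (M.mul a c) :=
  induction_eq (fun n => M.mul a (M.add b n)) (fun n => M.add (M.mul a b) (M.mul a n))
    (by simp only [nMul_zero, nAdd_zero])
    (fun n h => by simp only [nMul_succ, nAdd_succ] at h ⊢; rw [h, nAdd_assoc]) c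

theorem nMul_assoc (a b c : M.Nt) : M.mul (M.mul a b) c = M.mul a (M.mul b c) :=
  induction_eq (fun n => M.mul (M.mul a b) n) (fun n => M.mul a (M.mul b n))
    (by simp only [nMul_zero])
    (fun n h => by simp only [nMul_succ, nMul_add] at h ⊢; rw [h]) c

theorem nMul_one (a : M.Nt) : M.mul a M.one = a := by
  rw [TypeStr.one, nMul_succ, nMul_zero, zero_nAdd]

/-- The natural numbers of a model of `RCA₀^ω` form a commutative semiring. -/
instance : CommSemiring (M.el .nat) where
  add := M.add
  zero := M.zero
  mul := M.mul
  one := M.one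
  add_assoc := nAdd_assoc
  zero_add := zero_nAdd
  add_zero := nAdd_zero
  add_comm := nAdd_comm
  nsmul := @nsmulRec _ ⟨M.zero⟩ ⟨M.add⟩
  left_distrib := nMul_add
  right_distrib a b c := by
    change M.mul (M.add a b) c = M.add (M.mul a c) (M.mul b c)
    rw [nMul_comm, nMul_add, nMul_comm c, nMul_comm c]
  zero_mul := zero_nMul
  mul_zero := nMul_zero
  mul_assoc := nMul_assoc
  one_mul a := (nMul_comm _ _).trans (nMul_one a)
  mul_one := nMul_one
  mul_comm := nMul_comm

theorem zero_eq : M.zero = 0 := rfl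

theorem one_eq : M.one = 1 := rfl

theorem add_eq (a b : M.Nt) : M.add a b = a + b := rfl

theorem mul_eq (a b : M.Nt) : M.mul a b = a * b := rfl

theorem succ_eq (a : M.Nt) : M.succ a = a + 1 :=
  ((nAdd_succ a M.zero).trans (congrArg _ (nAdd_zero a))).symm

theorem two_eq : M.two = 2 := by
  rw [TypeStr.two, succ_eq, one_eq, one_add_one_eq_two]

instance IsDef.hAdd (φ ψ : C → M.el .nat) [IsDef φ] [IsDef ψ] : IsDef (fun e => φ e + ψ e) :=
  IsDef.nAdd φ ψ

instance IsDef.hMul (φ ψ : C → M.el .nat) [IsDef φ] [IsDef ψ] : IsDef (fun e => φ e * ψ e) :=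
  IsDef.nMul φ ψ

end semiring

section order

variable [hM : Model M] {C : Type u} [Context M C]

/-- The predecessor function. -/
def pred (a : M.Nt) : M.Nt := M.recr a M.zero (M.combK .one .nat (M.iden .nat))

instance IsDef.pred (φ : C → M.Nt) [IsDef φ] : IsDef (fun e => pred (φ e)) := by
  unfold TypeStr.pred; infer_instance

theorem pred_zero : pred (M := M) 0 = 0 := hM.axioms.recr_zero _ _

theorem pred_succ (a : M.Nt) : pred (a + 1) = a := by
  rw [← succ_eq]
  exact (hM.axioms.recr_succ _ _ _).trans
    ((hM.axioms.combK_eq .one .nat _ _ _).trans (iden_app a))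

theorem induction_eq' (φ ψ : M.Nt → M.Nt)
    [IsDef (fun e : PUnit × M.el .nat => φ e.2)] [IsDef (fun e : PUnit × M.el .nat => ψ e.2)]
    (h0 : φ 0 = ψ 0) (hs : ∀ n : M.Nt, φ n = ψ n → φ (n + 1) = ψ (n + 1)) (n : M.Nt) :
    φ n = ψ n :=
  induction_eq φ ψ h0 (by simpa only [succ_eq] using hs) n

theorem add_one_ne_zero' (a : M.Nt) : a + 1 ≠ 0 := by
  rw [← succ_eq]; exact hM.axioms.succ_ne_zero a

theorem eq_zero_or_eq_succ (a : M.Nt) : a = 0 ∨ ∃ b, a = b + 1 := by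
  have h := induction_or (M := M) (fun n => n) (fun _ => 0) (fun n => n) (fun n => pred n + 1)
    (Or.inl rfl) (fun n _ => Or.inr (by simp only [succ_eq, pred_succ])) a
  exact h.imp id (fun h => ⟨_, h⟩)

theorem exists_pred_object : ∃ P : M.el .one, ∀ a, P a = pred a :=
  exists_object (M := M) (fun n => pred n)

/-- Truncated subtraction, by iteration of the predecessor. -/
noncomputable def tsub (a b : M.Nt) : M.Nt :=
  M.recr b a (M.ignoreSnd (exists_pred_object (M := M)).choose)

instance IsDef.tsub (φ ψ : C → M.Nt) [IsDef φ] [IsDef ψ] :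
    IsDef (fun e => tsub (φ e) (ψ e)) := by
  unfold TypeStr.tsub; infer_instance

theorem tsub_zero' (a : M.Nt) : tsub a 0 = a := hM.axioms.recr_zero _ _

theorem tsub_add_one (a b : M.Nt) : tsub a (b + 1) = pred (tsub a b) := by
  rw [← succ_eq]
  exact (hM.axioms.recr_succ _ _ _).trans ((hM.axioms.ignoreSnd_app _ _ _).trans
    ((exists_pred_object (M := M)).choose_spec _))

theorem add_one_tsub_add_one (a b : M.Nt) : tsub (a + 1) (b + 1) = tsub a b :=
  induction_eq' (fun n => tsub (a + 1) (n + 1)) (fun n => tsub a n)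
    (by simp only [tsub_add_one, tsub_zero', pred_succ])
    (fun n h => by rw [tsub_add_one, h, tsub_add_one]) b

theorem add_tsub_self (a b : M.Nt) : tsub (a + b) b = a :=
  induction_eq' (fun n => tsub (a + n) n) (fun _ => a) (by simp only [add_zero, tsub_zero'])
    (fun n h => by rw [← add_assoc, add_one_tsub_add_one, h]) b

theorem nat_add_right_cancel {a b c : M.Nt} (h : a + c = b + c) : a = b := by
  rw [← add_tsub_self a c, h, add_tsub_self]

theorem add_tsub_or (a b : M.Nt) : a + tsub b a = b ∨ b + tsub a b = a := by
  refine induction_or (M := M) (fun n => a + tsub n a) (fun n => n) (fun n => n + tsub a n)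
    (fun _ => a) ?_ ?_ b
  · right
    simp only [zero_eq, tsub_zero', zero_add]
  · intro n h
    simp only [succ_eq] at h ⊢
    have up : ∀ c, a + c = n → a + tsub (n + 1) a = n + 1 := fun c hc => by
      have : n + 1 = (c + 1) + a := by rw [← hc]; ring
      rw [this, add_tsub_self]; ring
    rcases h with h | h
    · exact Or.inl (up _ h)
    · rcases eq_zero_or_eq_succ (tsub a n) with h0 | ⟨c, hc⟩
      · rw [h0, add_zero] at h
        exact Or.inl (up 0 (by rw [add_zero, h]))
      · right
        rw [hc] at h
        have : a = c + (n + 1) := by rw [← h]; ring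
        rw [this, add_tsub_self]; ring

theorem eq_zero_of_add_eq_zero {a b : M.Nt} (h : a + b = 0) : a = 0 := by
  rcases eq_zero_or_eq_succ b with rfl | ⟨c, rfl⟩
  · simpa using h
  · exact absurd (by rw [← h]; ring) (add_one_ne_zero' (a + c))

noncomputable instance : LinearOrder (M.el .nat) where
  le := M.NLe
  le_refl a := ⟨0, add_zero a⟩
  le_trans := by
    rintro a _ _ ⟨c, rfl⟩ ⟨d, rfl⟩
    exact ⟨c + d, (add_assoc a c d).symm⟩
  le_antisymm := by
    rintro a b ⟨c, hc⟩ ⟨d, hd⟩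
    rw [add_eq] at hc hd
    have h : (c + d) + a = 0 + a := by
      rw [zero_add]; nth_rewrite 2 [← hd]; rw [← hc]; ring
    rw [← hc, eq_zero_of_add_eq_zero (nat_add_right_cancel h), add_zero]
  le_total a b := (add_tsub_or a b).imp (fun h => ⟨_, h⟩) (fun h => ⟨_, h⟩)
  toDecidableLE := Classical.decRel _

theorem nLe_iff (a b : M.Nt) : M.NLe a b ↔ a ≤ b := Iff.rfl

theorem nLt_iff (a b : M.Nt) : M.NLt a b ↔ a < b := by
  rw [NLt, succ_eq, nLe_iff, lt_iff_not_ge]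
  constructor
  · rintro ⟨c, hc⟩ ⟨d, hd⟩
    rw [add_eq] at hc hd
    have h : (d + c + 1) + a = 0 + a := by
      rw [zero_add]; nth_rewrite 2 [← hd]; rw [← hc]; ring
    exact add_one_ne_zero' _ (nat_add_right_cancel h)
  · intro h
    obtain ⟨c, hc⟩ := (le_total a b).resolve_right h
    rcases eq_zero_or_eq_succ c with rfl | ⟨d, rfl⟩
    · exact absurd (by rw [← hc]; exact (add_zero a).le) h
    · exact ⟨d, by rw [add_eq, ← hc, add_eq]; ring⟩

instance : CanonicallyOrderedAdd (M.el .nat) where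
  exists_add_of_le := by
    rintro a _ ⟨c, rfl⟩
    exact ⟨c, rfl⟩
  le_self_add a b := ⟨b, rfl⟩
  le_add_self a b := ⟨b, add_comm a b⟩

instance : IsOrderedCancelAddMonoid (M.el .nat) where
  add_le_add_left := by
    rintro a _ ⟨c, rfl⟩ d
    exact ⟨c, by simp only [add_eq]; ring⟩
  le_of_add_le_add_left := by
    rintro a b c ⟨d, hd⟩
    rw [add_eq] at hd
    refine ⟨d, nat_add_right_cancel (c := a) ?_⟩
    rw [add_eq, add_comm c a, ← hd]; ring

instance : Nontrivial (M.el .nat) := ⟨1, 0, by simpa using add_one_ne_zero' (0 : M.el .nat)⟩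

theorem nat_mul_pos {a b : M.Nt} (ha : 0 < a) (hb : 0 < b) : 0 < a * b := by
  rw [pos_iff_ne_zero] at *
  obtain ⟨c, rfl⟩ := (eq_zero_or_eq_succ a).resolve_left ha
  obtain ⟨d, rfl⟩ := (eq_zero_or_eq_succ b).resolve_left hb
  have := add_one_ne_zero' (c * d + c + d)
  intro h
  exact this (by rw [← h]; ring)

theorem nat_lt_iff_add_one_le {a b : M.Nt} : a < b ↔ a + 1 ≤ b := by
  rw [← nLt_iff, NLt, succ_eq, nLe_iff]

instance : IsStrictOrderedRing (M.el .nat) where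
  zero_le_one := zero_le
  mul_lt_mul_of_pos_left a ha b c h := by
    obtain ⟨d, rfl⟩ := exists_add_of_le h.le
    have hd : 0 < d := by
      rw [pos_iff_ne_zero]; rintro rfl; simp at h
    simp only [mul_add]
    exact lt_add_of_pos_right _ (nat_mul_pos ha hd)
  mul_lt_mul_of_pos_right a ha b c h := by
    obtain ⟨d, rfl⟩ := exists_add_of_le h.le
    have hd : 0 < d := by
      rw [pos_iff_ne_zero]; rintro rfl; simp at h
    simp only [add_mul]
    exact lt_add_of_pos_right _ (nat_mul_pos hd ha)

theorem tsub_eq_zero_iff (a b : M.Nt) : tsub a b = 0 ↔ a ≤ b := by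
  constructor
  · intro h
    rcases add_tsub_or b a with h' | h'
    · rw [h, add_zero] at h'; exact h'.ge
    · exact ⟨_, h'⟩
  · rintro ⟨c, rfl⟩
    refine induction_eq' (fun n => tsub a (a + n)) (fun _ => 0) ?_ ?_ c
    · simpa using add_tsub_self 0 a
    · intro n h
      rw [← add_assoc, tsub_add_one, h, pred_zero]

theorem pow2_zero' : M.pow2 0 = 1 := hM.axioms.pow2_zero

theorem pow2_add_one (n : M.Nt) : M.pow2 (n + 1) = 2 * M.pow2 n := by
  rw [← succ_eq, hM.axioms.pow2_succ, add_eq, two_mul]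

theorem pow2_add (m n : M.Nt) : M.pow2 (m + n) = M.pow2 m * M.pow2 n :=
  induction_eq' (fun n => M.pow2 (m + n)) (fun n => M.pow2 m * M.pow2 n)
    (by simp only [add_zero, pow2_zero', mul_one])
    (fun n h => by simp only [← add_assoc, pow2_add_one] at h ⊢; rw [h]; ring) n

end order

end HigherOrderRM.TypeStr

namespace HigherOrderRM.TypeStr

/-! ### Decidable predicates and arithmetical comprehension -/

/-- The models of `RCA₀^ω + (∃²)`, as a class. -/
class Arith (M : TypeStr.{u}) : Prop extends Model M where
  exists2 : M.Exists2

variable {M : TypeStr.{u}}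

section decidable

variable {C : Type u} [Context M C]

/-- A predicate on a context is decidable if it is the zero set of a definable function. -/
class Dec (P : C → Prop) : Prop where
  exists_char : ∃ χ : C → M.Nt, IsDef χ ∧ ∀ e, P e ↔ χ e = M.zero

theorem Dec.congr {P Q : C → Prop} (hP : Dec (M := M) P) (h : ∀ e, Q e ↔ P e) :
    Dec (M := M) Q :=
  let ⟨χ, hχ, h'⟩ := hP.exists_char
  ⟨χ, hχ, fun e => (h e).trans (h' e)⟩

instance (priority := 800) Dec.weaken₁ {σ : Ty} (P : C → Prop) [Model M] [h : Dec (M := M) P] :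
    Dec (M := M) (fun e : C × M.el σ => P e.1) :=
  let ⟨χ, hχ, hP⟩ := h.exists_char
  ⟨fun e => χ e.1, hχ.weaken, fun e => hP e.1⟩

variable [Arith M]

instance Dec.eq (φ ψ : C → M.el .nat) [IsDef φ] [IsDef ψ] :
    Dec (M := M) (fun e => φ e = ψ e) := by
  refine ⟨fun e => TypeStr.tsub (φ e) (ψ e) + TypeStr.tsub (ψ e) (φ e), inferInstance, fun e => ?_⟩
  change _ ↔ _ = 0
  rw [add_eq_zero, tsub_eq_zero_iff, tsub_eq_zero_iff]
  exact le_antisymm_iff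

instance Dec.not (P : C → Prop) [h : Dec (M := M) P] : Dec (M := M) (fun e => ¬ P e) := by
  obtain ⟨χ, hχ, hP⟩ := h.exists_char
  refine ⟨fun e => tsub 1 (χ e), inferInstance, fun e => ?_⟩
  change _ ↔ _ = 0
  rw [hP, tsub_eq_zero_iff]
  change ¬ χ e = 0 ↔ _
  rw [← ne_eq, ← pos_iff_ne_zero, nat_lt_iff_add_one_le, zero_add]

instance Dec.and (P Q : C → Prop) [hP : Dec (M := M) P] [hQ : Dec (M := M) Q] :
    Dec (M := M) (fun e => P e ∧ Q e) := by
  obtain ⟨χ, hχ, hP⟩ := hP.exists_char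
  obtain ⟨χ', hχ', hQ⟩ := hQ.exists_char
  refine ⟨fun e => χ e + χ' e, inferInstance, fun e => ?_⟩
  change _ ↔ _ = 0
  rw [hP, hQ, add_eq_zero]
  rfl

instance Dec.or (P Q : C → Prop) [Dec (M := M) P] [Dec (M := M) Q] :
    Dec (M := M) (fun e => P e ∨ Q e) :=
  Dec.congr (P := fun e => ¬ (¬ P e ∧ ¬ Q e)) inferInstance (fun _ => or_iff_not_and_not)

instance Dec.imp (P Q : C → Prop) [Dec (M := M) P] [Dec (M := M) Q] :
    Dec (M := M) (fun e => P e → Q e) :=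
  Dec.congr (P := fun e => ¬ P e ∨ Q e) inferInstance (fun _ => imp_iff_not_or)

instance Dec.exists (P : C → M.el .nat → Prop)
    [h : Dec (M := M) (fun e : C × M.el .nat => P e.1 e.2)] :
    Dec (M := M) (fun e => ∃ n, P e n) := by
  obtain ⟨χ, hχ, hP⟩ := h.exists_char
  obtain ⟨ψ, hψ, hψ'⟩ := IsDef.lam (C := C) (σ := .nat) (τ := .nat) (fun e n => χ (e, n))
  obtain ⟨E, hE⟩ := Arith.exists2 (M := M)
  refine ⟨fun e => M.app E (ψ e), inferInstance, fun e => ?_⟩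
  rw [hE]
  exact exists_congr fun n => by
    rw [hP (e, n), show M.app (ψ e) n = χ (e, n) from hψ' e n]

instance Dec.forall (P : C → M.el .nat → Prop)
    [h : Dec (M := M) (fun e : C × M.el .nat => P e.1 e.2)] :
    Dec (M := M) (fun e => ∀ n, P e n) :=
  Dec.congr (P := fun e => ¬ ∃ n, ¬ P e n) inferInstance (fun e => by push Not; rfl)

instance Dec.le (φ ψ : C → M.el .nat) [IsDef φ] [IsDef ψ] :
    Dec (M := M) (fun e => φ e ≤ ψ e) :=
  Dec.congr (P := fun e => ∃ c, φ e + c = ψ e) inferInstance (fun _ => Iff.rfl)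

instance Dec.lt (φ ψ : C → M.el .nat) [IsDef φ] [IsDef ψ] :
    Dec (M := M) (fun e => φ e < ψ e) :=
  Dec.congr (P := fun e => φ e + 1 ≤ ψ e) inferInstance (fun _ => nat_lt_iff_add_one_le)

instance Dec.nLe (φ ψ : C → M.el .nat) [IsDef φ] [IsDef ψ] :
    Dec (M := M) (fun e => M.NLe (φ e) (ψ e)) :=
  Dec.le φ ψ

instance Dec.nLt (φ ψ : C → M.el .nat) [IsDef φ] [IsDef ψ] :
    Dec (M := M) (fun e => M.NLt (φ e) (ψ e)) := by
  unfold NLt; infer_instance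

end decidable

variable [Arith M]

/-- Induction for decidable predicates. -/
theorem dec_induction (P : M.Nt → Prop) [h : Dec (M := M) (fun e : PUnit × M.el .nat => P e.2)]
    (h0 : P 0) (hs : ∀ n, P n → P (n + 1)) (n : M.Nt) : P n := by
  obtain ⟨χ, hχ, hP⟩ := h.exists_char
  have hP' : ∀ n, P n ↔ χ (⟨⟩, n) = 0 := fun n => hP (⟨⟩, n)
  have : IsDef (fun e : PUnit × M.el .nat => (fun n => χ (⟨⟩, n)) e.2) := hχ
  rw [hP']
  exact induction_eq' (fun n => χ (⟨⟩, n)) (fun _ => 0) ((hP' _).1 h0)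
    (fun n hn => (hP' _).1 (hs n ((hP' _).2 hn))) n

/-- A decidable predicate of a number variable is the zero set of a family of objects of type `1`,
so that it may be used with other number variables. -/
theorem Dec.exists_family {C : Type u} [Context M C] (R : C → M.Nt → Prop)
    [h : Dec (M := M) (fun e : C × M.el .nat => R e.1 e.2)] :
    ∃ ψ : C → M.el .one, IsDef ψ ∧ ∀ e n, R e n ↔ ψ e n = 0 := by
  obtain ⟨χ, hχ, hR⟩ := h.exists_char
  obtain ⟨ψ, hψ, hψ'⟩ := IsDef.lam (C := C) (σ := .nat) (τ := .nat) (fun e n => χ (e, n))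
  refine ⟨ψ, hψ, fun e n => ?_⟩
  rw [hR (e, n), show M.app (ψ e) n = χ (e, n) from hψ' e n]
  rfl

theorem exists_least (P : M.Nt → Prop) [Dec (M := M) (fun e : PUnit × M.el .nat => P e.2)]
    (h : ∃ n, P n) : ∃ n, P n ∧ ∀ m, P m → n ≤ m := by
  obtain ⟨ψ, -, hψ⟩ := Dec.exists_family (M := M) (C := PUnit) (fun _ n => P n)
  have hP : P = fun n => M.app (ψ ⟨⟩) n = 0 := funext fun n => propext (hψ ⟨⟩ n)
  generalize ψ ⟨⟩ = F at hP
  subst hP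
  by_contra! hc
  obtain ⟨n, hn⟩ := h
  have key : ∀ n m : M.Nt, m ≤ n → ¬ F m = 0 := by
    refine dec_induction (fun n => ∀ m : M.Nt, m ≤ n → ¬ F m = 0) ?_ ?_
    · intro m hm hP
      obtain ⟨k, -, hk⟩ := hc m hP
      exact absurd (hk.trans_le hm) not_lt_zero
    · intro n ih m hm hP
      obtain ⟨k, hk, hkm⟩ := hc m hP
      refine ih k ?_ hk
      have := nat_lt_iff_add_one_le.1 (hkm.trans_le hm)
      exact le_of_add_le_add_right this
  exact key n n le_rfl hn

/-- The unbounded search operator `μ`, from `(∃²)` by quantifier-free choice. -/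
theorem exists_mu : ∃ μ : M.el .two, ∀ f : M.el .one, (∃ n, f n = 0) → f (μ f) = 0 := by
  obtain ⟨E, hE⟩ := Arith.exists2 (M := M)
  let v : M.Valuation := fun σ _ => if h : σ = .two then h ▸ E else M.dflt σ
  let A : QFFormula := .imp (.eq (.app (.var .two 0) (.var .one 0)) .zero)
    (.eq (.app (.var .one 0) (.var .nat 0)) .zero)
  have hv : ∀ f n, M.Sat ((v.set .one 0 f).set .nat 0 n) A ↔
      (M.app E f = M.zero → M.app f n = M.zero) := fun f n => by
    simp [Sat, eval, A, Valuation.set, v]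
  have h := Model.axioms.qfAC (M := M) A v 0 0
  simp only [hv] at h
  obtain ⟨F, hF⟩ := h (fun f => by
    by_cases hf : M.app E f = M.zero
    · obtain ⟨n, hn⟩ := (hE f).1 hf
      exact ⟨n, fun _ => hn⟩
    · exact ⟨M.zero, fun h => absurd h hf⟩)
  exact ⟨F, fun f hf => hF f ((hE f).2 hf)⟩

section comprehension

variable {C : Type u} [Context M C]

/-- Least witnesses of a decidable relation form a definable function. -/
theorem exists_select (R : C → M.Nt → Prop)
    [h : Dec (M := M) (fun e : C × M.el .nat => R e.1 e.2)] :
    ∃ φ : C → M.Nt, IsDef φ ∧ ∀ e, (∃ n, R e n) → R e (φ e) ∧ ∀ m, R e m → φ e ≤ m := by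
  obtain ⟨μ, hμ⟩ := exists_mu (M := M)
  obtain ⟨ψ, hψ, hR⟩ := Dec.exists_family (M := M) R
  obtain ⟨θ, hθ, hθ'⟩ := Dec.exists_family (M := M) (C := C)
    (fun e n => ψ e n = 0 ∧ ∀ m : M.Nt, ψ e m = 0 → n ≤ m)
  refine ⟨fun e => μ (θ e), inferInstance, fun e he => ?_⟩
  simp only [hR] at he ⊢
  obtain ⟨n, hn⟩ := exists_least (fun n => ψ e n = 0) he
  exact (hθ' e _).2 (hμ (θ e) ⟨n, (hθ' e n).1 hn⟩)

/-- A function with a decidable graph is definable. -/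
theorem IsDef.of_graph (φ : C → M.Nt)
    [h : Dec (M := M) (fun e : C × M.el .nat => φ e.1 = e.2)] : IsDef φ := by
  obtain ⟨ψ, hψ, hψ'⟩ := exists_select (M := M) (C := C) (fun e n => φ e = n)
  exact hψ.congr fun e => ((hψ' e ⟨_, rfl⟩).1).symm

/-- Definition by cases. -/
theorem exists_ite (P : C → Prop) [h : Dec (M := M) P] (a b : M.Nt) :
    ∃ φ : C → M.Nt, IsDef φ ∧ ∀ e, (P e → φ e = a) ∧ (¬ P e → φ e = b) := by
  obtain ⟨φ, hφ, hφ'⟩ := exists_select (M := M) (C := C)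
    (fun e n => (P e ∧ n = a) ∨ (¬ P e ∧ n = b))
  refine ⟨φ, hφ, fun e => ⟨fun h => ?_, fun h => ?_⟩⟩
  · have := (hφ' e ⟨a, Or.inl ⟨h, rfl⟩⟩).1
    simpa [h] using this
  · have := (hφ' e ⟨b, Or.inr ⟨h, rfl⟩⟩).1
    simpa [h] using this

end comprehension

end HigherOrderRM.TypeStr

namespace HigherOrderRM

/-! ### The ordered field of fractions of an ordered semiring -/

section fractionField

variable (N : Type u) [CommSemiring N] [LinearOrder N] [IsStrictOrderedRing N]

/-- The congruence `(a, b) ∼ (c, d) ↔ a + d = c + b` on pairs of elements of a semiring. The pairs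
form the quadratic algebra with `ω² = 1`, where `(a, b) = a + b ω` stands for `a - b`. -/
def diffCon : RingCon (QuadraticAlgebra N 1 0) where
  r x y := x.re + y.im = y.re + x.im
  iseqv :=
    { refl := fun _ => rfl
      symm := fun h => Eq.symm h
      trans := fun {x y z} h h' => by
        refine add_right_cancel (b := y.re + y.im) ?_
        calc x.re + z.im + (y.re + y.im) = (x.re + y.im) + (y.re + z.im) := by ring
          _ = (y.re + x.im) + (z.re + y.im) := by rw [h, h']
          _ = _ := by ring }
  add' {w x y z} h h' := by
    change w.re + y.re + (x.im + z.im) = x.re + z.re + (w.im + y.im)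
    calc w.re + y.re + (x.im + z.im) = (w.re + x.im) + (y.re + z.im) := by ring
      _ = (x.re + w.im) + (z.re + y.im) := by rw [h, h']
      _ = _ := by ring
  mul' {w x y z} h h' := by
    simp only [QuadraticAlgebra.re_mul, QuadraticAlgebra.im_mul]
    have h1 : w.re + x.im = x.re + w.im := h
    have h2 : y.re + z.im = z.re + y.im := h'
    refine add_right_cancel (b := x.re * y.im + x.im * y.re + x.re * y.re + x.im * y.im) ?_
    calc _ = (w.re + x.im) * y.re + (x.re + w.im) * y.im + x.re * (z.im + y.re)
          + x.im * (z.re + y.im) := by ring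
      _ = (x.re + w.im) * y.re + (w.re + x.im) * y.im + x.re * (z.re + y.im)
          + x.im * (y.re + z.im) := by rw [h1, h2, add_comm z.im, h2]
      _ = _ := by ring

/-- The ring of differences of an ordered semiring. -/
abbrev DiffRing : Type u := (diffCon N).Quotient

variable {N}

/-- The difference `a - b`. -/
def DiffRing.mk (a b : N) : DiffRing N := ((⟨a, b⟩ : QuadraticAlgebra N 1 0) : (diffCon N).Quotient)

theorem DiffRing.mk_eq_mk {a b c d : N} : mk a b = mk c d ↔ a + d = c + b :=
  (diffCon N).eq

theorem DiffRing.mk_add (a b c d : N) : mk a b + mk c d = mk (a + c) (b + d) := rfl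

theorem DiffRing.mk_mul (a b c d : N) :
    mk a b * mk c d = mk (a * c + b * d) (a * d + b * c) := by
  have : (⟨a, b⟩ * ⟨c, d⟩ : QuadraticAlgebra N 1 0) = ⟨a * c + b * d, a * d + b * c⟩ := by
    ext <;> simp
  exact congrArg (fun x : QuadraticAlgebra N 1 0 => (x : (diffCon N).Quotient)) this

theorem DiffRing.ind {P : DiffRing N → Prop} (h : ∀ a b, P (mk a b)) (x : DiffRing N) : P x :=
  Quotient.inductionOn' x fun y => h y.re y.im

instance : CommRing (DiffRing N) where
  neg := Quotient.map' (fun x => ⟨x.im, x.re⟩) fun x y (h : x.re + y.im = y.re + x.im) => by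
    change x.im + y.re = y.im + x.re
    rw [add_comm, ← h, add_comm]
  neg_add_cancel := DiffRing.ind fun a b => by
    change DiffRing.mk b a + DiffRing.mk a b = DiffRing.mk 0 0
    rw [DiffRing.mk_add, DiffRing.mk_eq_mk]; ring
  zsmul := @zsmulRec _ _ _ ⟨_⟩ (nsmulRec)

/-- The embedding of an ordered semiring into its ring of differences. -/
def DiffRing.of : N →+* DiffRing N where
  toFun a := mk a 0
  map_one' := rfl
  map_zero' := rfl
  map_add' a b := by rw [mk_add, add_zero]
  map_mul' a b := by rw [mk_mul]; simp

theorem DiffRing.of_injective : Function.Injective (of (N := N)) := fun a b h => by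
  simpa using mk_eq_mk.1 h

theorem DiffRing.mk_eq_sub (a b : N) : mk a b = of a - of b := by
  rw [eq_sub_iff_add_eq]
  change mk a b + mk b 0 = mk a 0
  rw [mk_add, mk_eq_mk]; ring

section canonical

variable [CanonicallyOrderedAdd N]

theorem DiffRing.eq_of_or_eq_neg (x : DiffRing N) : ∃ a, x = of a ∨ x = -of a := by
  induction x using DiffRing.ind with
  | h a b =>
    rw [mk_eq_sub]
    rcases le_total a b with h | h <;> obtain ⟨c, rfl⟩ := exists_add_of_le h
    · exact ⟨c, Or.inr (by rw [map_add]; ring)⟩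
    · exact ⟨c, Or.inl (by rw [map_add]; ring)⟩

instance : Nontrivial (DiffRing N) := DiffRing.of_injective.nontrivial

instance : NoZeroDivisors (DiffRing N) where
  eq_zero_or_eq_zero_of_mul_eq_zero {x y} h := by
    obtain ⟨a, ha⟩ := DiffRing.eq_of_or_eq_neg x
    obtain ⟨b, hb⟩ := DiffRing.eq_of_or_eq_neg y
    have key : DiffRing.of (a * b) = DiffRing.of 0 := by
      rw [map_mul, map_zero]
      rcases ha with rfl | rfl <;> rcases hb with rfl | rfl <;> simpa using h
    rcases mul_eq_zero.1 (DiffRing.of_injective key) with rfl | rfl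
    · left; simpa using ha
    · right; simpa using hb

instance : IsDomain (DiffRing N) := NoZeroDivisors.to_isDomain _

end canonical

variable (N) in
/-- The field of fractions of the ring of differences of an ordered semiring. -/
abbrev FracField : Type u := FractionRing (DiffRing N)

namespace FracField

/-- The embedding of an ordered semiring into its field of fractions. -/
noncomputable def of : N →+* FracField N := (algebraMap (DiffRing N) (FracField N)).comp DiffRing.of

theorem of_injective : Function.Injective (of (N := N)) :=
  (IsFractionRing.injective (DiffRing N) (FracField N)).comp DiffRing.of_injective

theorem of_ne_zero {a : N} (h : a ≠ 0) : of a ≠ 0 := fun h' =>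
  h (of_injective (h'.trans (map_zero _).symm))

variable [CanonicallyOrderedAdd N]

/-- The cone of the fractions `a / b` with `a` and `b` in the semiring. -/
def cone (N : Type u) [CommSemiring N] [LinearOrder N] [IsStrictOrderedRing N]
    [CanonicallyOrderedAdd N] : RingCone (FracField N) where
  carrier := {x | ∃ a b : N, b ≠ 0 ∧ x = of a / of b}
  mul_mem' := by
    rintro _ _ ⟨a, b, hb, rfl⟩ ⟨c, d, hd, rfl⟩
    exact ⟨a * c, b * d, mul_ne_zero hb hd, by rw [map_mul, map_mul, div_mul_div_comm]⟩
  one_mem' := ⟨1, 1, one_ne_zero, by simp⟩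
  add_mem' := by
    rintro _ _ ⟨a, b, hb, rfl⟩ ⟨c, d, hd, rfl⟩
    refine ⟨a * d + b * c, b * d, mul_ne_zero hb hd, ?_⟩
    rw [map_add, map_mul, map_mul, map_mul, div_add_div _ _ (of_ne_zero hb) (of_ne_zero hd)]
  zero_mem' := ⟨0, 1, one_ne_zero, by simp⟩
  eq_zero_of_mem_of_neg_mem' := by
    rintro _ ⟨a, b, hb, rfl⟩ ⟨c, d, hd, h⟩
    have hb' := of_ne_zero hb
    have hd' := of_ne_zero hd
    have key : of (a * d + c * b) = of 0 := by
      rw [map_add, map_mul, map_mul, map_zero]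
      field_simp at h
      linear_combination -h
    have := (add_eq_zero.1 (of_injective key)).1
    rw [(mul_eq_zero.1 this).resolve_right hd]
    simp

instance : HasMemOrNegMem (cone N) where
  mem_or_neg_mem x := by
    obtain ⟨y, z, hz, rfl⟩ := IsFractionRing.div_surjective (A := DiffRing N) x
    have hz0 : z ≠ 0 := nonZeroDivisors.ne_zero hz
    obtain ⟨a, ha⟩ := DiffRing.eq_of_or_eq_neg y
    obtain ⟨b, hb⟩ := DiffRing.eq_of_or_eq_neg z
    have hb0 : b ≠ 0 := by
      rintro rfl
      exact hz0 (by simpa using hb)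
    have h : (of a / of b : FracField N) ∈ cone N := ⟨a, b, hb0, rfl⟩
    rcases ha with rfl | rfl <;> rcases hb with rfl | rfl
    · left; simpa [of] using h
    · right; simpa [of, div_neg] using h
    · right; simpa [of, neg_div] using h
    · left; simpa [of] using h

noncomputable instance : LinearOrder (FracField N) :=
  letI : DecidablePred (· ∈ cone N) := Classical.decPred _
  LinearOrder.mkOfAddGroupCone (cone N)

instance : IsOrderedRing (FracField N) := IsOrderedRing.mkOfCone (cone N)

instance : IsStrictOrderedRing (FracField N) := IsOrderedRing.toIsStrictOrderedRing _

theorem exists_eq_div {q : FracField N} (h : 0 ≤ q) : ∃ a b : N, b ≠ 0 ∧ q = of a / of b := by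
  have h' : q - 0 ∈ cone N := h
  rwa [sub_zero] at h'

theorem of_le_of {a b : N} : of a ≤ of b ↔ a ≤ b := by
  have mono : ∀ a b : N, a ≤ b → of a ≤ of b := fun a b h => by
    obtain ⟨c, rfl⟩ := exists_add_of_le h
    change _ ∈ cone N
    exact ⟨c, 1, one_ne_zero, by simp⟩
  refine ⟨fun h => ?_, mono a b⟩
  by_contra hc
  exact hc (of_injective (le_antisymm h (mono _ _ (le_of_not_ge hc)))).le

end FracField

end fractionField

end HigherOrderRM

namespace HigherOrderRM.TypeStr

/-! ### Rational numbers and real numbers of a model -/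

variable {M : TypeStr.{u}}

section rationals

/-- The rational numbers of a model: the ordered field of fractions of its natural numbers. -/
def Rat (M : TypeStr.{u}) [Model M] : Type u := FracField (M.el .nat)

variable [Model M]

noncomputable instance : Field M.Rat := inferInstanceAs (Field (FracField (M.el .nat)))

noncomputable instance : LinearOrder M.Rat := inferInstanceAs (LinearOrder (FracField (M.el .nat)))

instance : IsStrictOrderedRing M.Rat :=
  inferInstanceAs (IsStrictOrderedRing (FracField (M.el .nat)))

instance : IsOrderedRing M.Rat := inferInstance

instance : IsOrderedAddMonoid M.Rat := inferInstance

instance : AddLeftMono M.Rat := inferInstance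

instance : AddRightMono M.Rat := inferInstance

/-- The embedding of the natural numbers of a model into its rational numbers. -/
noncomputable def toRat : M.el .nat →+* M.Rat := FracField.of (N := M.el .nat)

theorem toRat_le {a b : M.el .nat} : toRat a ≤ toRat b ↔ a ≤ b := FracField.of_le_of

theorem toRat_lt {a b : M.el .nat} : toRat a < toRat b ↔ a < b := lt_iff_lt_of_le_iff_le toRat_le

theorem toRat_inj {a b : M.el .nat} : toRat a = toRat b ↔ a = b :=
  FracField.of_injective.eq_iff

theorem toRat_nonneg (a : M.el .nat) : 0 ≤ toRat a := by
  rw [← map_zero toRat, toRat_le]; exact zero_le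

theorem toRat_pos {a : M.el .nat} (h : a ≠ 0) : 0 < toRat a := by
  rw [← map_zero toRat, toRat_lt]; exact pos_iff_ne_zero.2 h

theorem toRat_add_one_le {a b : M.el .nat} (h : toRat a < toRat b) : toRat a + 1 ≤ toRat b := by
  rw [← map_one toRat, ← map_add, toRat_le, ← nat_lt_iff_add_one_le]
  exact toRat_lt.1 h

theorem one_le_toRat {a : M.el .nat} (h : a ≠ 0) : 1 ≤ toRat a := by
  have := toRat_add_one_le (a := 0) (b := a) (by rw [map_zero]; exact toRat_pos h)
  simpa using this

/-- The rational numbers of a model are archimedean with respect to its natural numbers. -/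
theorem exists_le_toRat (q : M.Rat) : ∃ n : M.el .nat, q ≤ toRat n := by
  rcases le_total 0 q with h | h
  · obtain ⟨a, b, hb, rfl⟩ : ∃ a b : M.el .nat, b ≠ 0 ∧ q = toRat a / toRat b :=
      FracField.exists_eq_div h
    exact ⟨a, div_le_self (toRat_nonneg a) (one_le_toRat hb)⟩
  · exact ⟨0, by rwa [map_zero]⟩

theorem pow2_ne_zero (n : M.el .nat) : M.pow2 n ≠ 0 := by
  intro h
  -- `2 ^ n ≠ 0` as the equation `pred (2 ^ n) + 1 = 2 ^ n`; the second disjunct is idle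
  have h1 := induction_or (M := M) (fun n => pred (M.pow2 n) + 1) (fun n => M.pow2 n)
    (fun _ => 0) (fun _ => 1)
    (Or.inl (by rw [zero_eq, pow2_zero', ← zero_add 1, pred_succ, zero_add, zero_add]))
    (fun n hn => by
      left
      rcases hn with hn | hn
      · rw [succ_eq, pow2_add_one]
        have : 2 * M.pow2 n = (2 * pred (M.pow2 n) + 1) + 1 := by
          nth_rewrite 1 [← hn]; ring
        rw [this, pred_succ]
      · exact absurd hn (by simp)) n
  rcases h1 with h1 | h1
  · rw [h] at h1; exact add_one_ne_zero' _ h1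
  · exact absurd h1 (by simp)

/-- The rational number `2 ^ (-n)`. -/
noncomputable def eps (n : M.el .nat) : M.Rat := (toRat (M.pow2 n))⁻¹

theorem eps_pos (n : M.el .nat) : 0 < eps n := inv_pos.2 (toRat_pos (pow2_ne_zero n))

theorem eps_zero : eps (0 : M.el .nat) = 1 := by rw [eps, pow2_zero', map_one, inv_one]

theorem eps_add (m n : M.el .nat) : eps (m + n) = eps m * eps n := by
  rw [eps, pow2_add, map_mul, mul_inv]; rfl

theorem eps_one : eps (1 : M.el .nat) = 1 / 2 := by
  rw [← zero_add 1, eps, pow2_add_one, pow2_zero', map_mul, map_ofNat]; simp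

theorem eps_add_one (n : M.el .nat) : eps (n + 1) = eps n / 2 := by
  rw [eps_add, eps_one]; ring

theorem eps_add_two (n : M.el .nat) : eps (n + 2) = eps n / 4 := by
  rw [← one_add_one_eq_two, ← add_assoc, eps_add_one, eps_add_one]; ring

theorem eps_le_one (n : M.el .nat) : eps n ≤ 1 :=
  inv_le_one_of_one_le₀ (one_le_toRat (pow2_ne_zero n))

theorem eps_anti {m n : M.el .nat} (h : m ≤ n) : eps n ≤ eps m := by
  obtain ⟨k, rfl⟩ := exists_add_of_le h
  rw [eps_add]
  exact mul_le_of_le_one_right (eps_pos m).le (eps_le_one k)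

theorem eps_mul_pow2 (n : M.el .nat) : eps n * toRat (M.pow2 n) = 1 :=
  inv_mul_cancel₀ (toRat_pos (pow2_ne_zero n)).ne'

end rationals

section

variable [Arith M]

theorem lt_pow2 (n : M.el .nat) : n < M.pow2 n := by
  refine dec_induction (fun n => n < M.pow2 n) ?_ ?_ n
  · rw [pow2_zero']; exact zero_lt_one
  · intro n h
    rw [pow2_add_one, two_mul]
    exact add_lt_add_of_lt_of_le h (by
      have := nat_lt_iff_add_one_le.1 (pos_iff_ne_zero.2 (pow2_ne_zero n))
      rwa [zero_add] at this)

theorem exists_eps_lt {q : M.Rat} (hq : 0 < q) : ∃ n, eps n < q := by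
  obtain ⟨n, hn⟩ := exists_le_toRat q⁻¹
  exact ⟨n, inv_lt_of_inv_lt₀ hq (hn.trans_lt (toRat_lt.2 (lt_pow2 n)))⟩

theorem le_of_forall_eps {p q : M.Rat} (h : ∀ n, p ≤ q + eps n) : p ≤ q := by
  by_contra hc
  obtain ⟨n, hn⟩ := exists_eps_lt (sub_pos.2 (not_le.1 hc))
  linarith [h n]

end

section limits

variable [Model M]

/-- An ultrafilter of sets of natural numbers of the model that contains all final segments. -/
noncomputable def ultra (M : TypeStr.{u}) [Model M] : Ultrafilter (M.el .nat) :=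
  Ultrafilter.of Filter.atTop

/-- An ordered field extension of the rational numbers of a model: an ultrapower. A sequence of
rationals takes a value in it, namely its class, which is its term at an infinite index. If the
sequence represents a real number, the value is within `2 ^ (-n)` of its `n`-th term, so that the
order and distance of reals are those of their values up to infinitesimals. -/
def Hyper (M : TypeStr.{u}) [Model M] : Type u := Filter.Germ (M.ultra : Filter (M.el .nat)) M.Rat

noncomputable instance : Field M.Hyper :=
  inferInstanceAs (Field (Filter.Germ (M.ultra : Filter (M.el .nat)) M.Rat))

noncomputable instance : LinearOrder M.Hyper :=
  inferInstanceAs (LinearOrder (Filter.Germ (M.ultra : Filter (M.el .nat)) M.Rat))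

instance : IsStrictOrderedRing M.Hyper :=
  inferInstanceAs (IsStrictOrderedRing (Filter.Germ (M.ultra : Filter (M.el .nat)) M.Rat))

instance : IsOrderedRing M.Hyper := inferInstance

instance : IsOrderedAddMonoid M.Hyper := inferInstance

/-- The value of a sequence of rationals. -/
noncomputable def lim (a : M.el .nat → M.Rat) : M.Hyper := Filter.Germ.ofFun a

/-- The embedding of the rationals of a model into their extension. -/
noncomputable def hyp : M.Rat →+* M.Hyper where
  toFun q := lim fun _ => q
  map_one' := rfl
  map_zero' := rfl
  map_add' _ _ := rfl
  map_mul' _ _ := rfl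

theorem lim_le {a b : M.el .nat → M.Rat} (N : M.el .nat) (h : ∀ n, N ≤ n → a n ≤ b n) :
    lim a ≤ lim b :=
  Filter.Germ.coe_le.2 ((Filter.eventually_ge_atTop N).filter_mono (Ultrafilter.of_le _) |>.mono h)

theorem hyp_le {p q : M.Rat} : hyp p ≤ hyp q ↔ p ≤ q :=
  Filter.Germ.const_le_iff

theorem hyp_lt {p q : M.Rat} : hyp p < hyp q ↔ p < q := lt_iff_lt_of_le_iff_le hyp_le

theorem lim_le_hyp {a : M.el .nat → M.Rat} {q : M.Rat} (N : M.el .nat)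
    (h : ∀ n, N ≤ n → a n ≤ q) : lim a ≤ hyp q := lim_le N h

theorem hyp_le_lim {a : M.el .nat → M.Rat} {q : M.Rat} (N : M.el .nat)
    (h : ∀ n, N ≤ n → q ≤ a n) : hyp q ≤ lim a := lim_le N h

end limits

end HigherOrderRM.TypeStr

namespace HigherOrderRM.TypeStr

/-! ### Values of fractions and of sequences of fractions -/

variable {M : TypeStr.{u}}

section fractions

variable [Model M]

/-- The rational number denoted by a fraction. -/
noncomputable def Frac.val (q : Frac M) : M.Rat := (toRat q.pos - toRat q.neg) / toRat q.den

variable {q r e : Frac M}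

theorem Frac.val_add (hq : q.den ≠ 0) (hr : r.den ≠ 0) : (q.add r).val = q.val + r.val := by
  have h1 := (toRat_pos hq).ne'
  have h2 := (toRat_pos hr).ne'
  simp only [val, Frac.add, add_eq, mul_eq, map_add, map_mul]
  field_simp
  ring

theorem Frac.add_den (hq : q.den ≠ 0) (hr : r.den ≠ 0) : (q.add r).den ≠ 0 := mul_ne_zero hq hr

theorem Frac.sub_den (hq : q.den ≠ 0) (hr : r.den ≠ 0) : (q.sub r).den ≠ 0 := mul_ne_zero hq hr

theorem Frac.val_sub (hq : q.den ≠ 0) (hr : r.den ≠ 0) : (q.sub r).val = q.val - r.val := by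
  rw [Frac.sub, Frac.val_add hq (by exact hr)]
  simp only [val]
  ring

theorem Frac.le_iff (hq : q.den ≠ 0) (hr : r.den ≠ 0) : q.Le r ↔ q.val ≤ r.val := by
  have h1 := toRat_pos hq
  have h2 := toRat_pos hr
  rw [Frac.Le, nLe_iff, ← toRat_le, val, val, div_le_div_iff₀ h1 h2]
  simp only [add_eq, mul_eq, map_add, map_mul]
  constructor <;> intro h <;> linarith

theorem Frac.lt_iff (hq : q.den ≠ 0) (hr : r.den ≠ 0) : q.Lt r ↔ q.val < r.val := by
  rw [← not_le, ← Frac.le_iff hr hq, Frac.Lt, Frac.Le, nLt_iff, nLe_iff, not_le]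

theorem Frac.distLe_iff (hq : q.den ≠ 0) (hr : r.den ≠ 0) (he : e.den ≠ 0) :
    q.DistLe r e ↔ |q.val - r.val| ≤ e.val := by
  rw [DistLe, le_iff (sub_den hq hr) he, le_iff (sub_den hr hq) he, val_sub hq hr, val_sub hr hq,
    abs_sub_le_iff]

theorem Frac.distLt_iff (hq : q.den ≠ 0) (hr : r.den ≠ 0) (he : e.den ≠ 0) :
    q.DistLt r e ↔ |q.val - r.val| < e.val := by
  rw [DistLt, lt_iff (sub_den hq hr) he, lt_iff (sub_den hr hq) he, val_sub hq hr, val_sub hr hq,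
    abs_sub_lt_iff]

theorem fracZero_den : M.fracZero.den ≠ 0 := one_ne_zero (α := M.el .nat)

theorem fracOne_den : M.fracOne.den ≠ 0 := one_ne_zero (α := M.el .nat)

theorem inv2_den (n : M.Nt) : (M.inv2 n).den ≠ 0 := pow2_ne_zero n

theorem twoInv2_den (n : M.Nt) : (M.twoInv2 n).den ≠ 0 := pow2_ne_zero n

theorem fracZero_val : M.fracZero.val = 0 := by simp [fracZero, Frac.val]

theorem fracOne_val : M.fracOne.val = 1 := by simp [fracOne, Frac.val, one_eq, zero_eq]

theorem inv2_val (n : M.Nt) : (M.inv2 n).val = eps n := by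
  simp [inv2, Frac.val, one_eq, zero_eq, eps]

theorem twoInv2_val (n : M.Nt) : (M.twoInv2 n).val = 2 * eps n := by
  rw [twoInv2, Frac.val, two_eq, zero_eq, map_zero, map_ofNat, sub_zero, eps, div_eq_mul_inv]

end fractions

section reals

/-- A sequence of fractions that represents a real number. -/
structure IsReal [Model M] (s : M.Nt → Frac M) : Prop where
  den : ∀ n, (s n).den ≠ 0
  fast : FastCauchy s

/-- The value of a sequence of fractions. -/
noncomputable def limF [Model M] (s : M.Nt → Frac M) : M.Hyper := lim fun n => (s n).val

/-- The number `2 ^ (-n)` among the values. -/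
noncomputable def del [Model M] (n : M.Nt) : M.Hyper := hyp (eps n)

section
variable [Model M]

theorem del_pos (n : M.Nt) : 0 < del n := by
  rw [del, ← map_zero hyp, hyp_lt]; exact eps_pos n

theorem del_add_one (n : M.Nt) : del (n + 1) = del n / 2 := by
  rw [del, eps_add_one, map_div₀, map_ofNat]; rfl

theorem del_add_two (n : M.Nt) : del (n + 2) = del n / 4 := by
  rw [del, eps_add_two, map_div₀, map_ofNat]; rfl

theorem del_anti {m n : M.Nt} (h : m ≤ n) : del n ≤ del m := hyp_le.2 (eps_anti h)

theorem IsReal.const {q : Frac M} (hq : q.den ≠ 0) : IsReal (fun _ => q) where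
  den _ := hq
  fast n i := by
    rw [Frac.distLt_iff hq hq (inv2_den n), sub_self, abs_zero, inv2_val]
    exact eps_pos n

variable {s t : M.Nt → Frac M}

theorem isReal_iff (hs : ∀ n, (s n).den ≠ 0) :
    FastCauchy s ↔ ∀ n i : M.el .nat, |(s n).val - (s (n + i)).val| < eps n := by
  refine forall₂_congr fun n i => ?_
  rw [Frac.distLt_iff (hs _) (hs _) (inv2_den n), inv2_val]; rfl

theorem IsReal.near (hs : IsReal s) {n m : M.el .nat} (h : n ≤ m) :
    |(s n).val - (s m).val| < eps n := by
  obtain ⟨k, rfl⟩ := exists_add_of_le h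
  exact (isReal_iff hs.den).1 hs.fast n k

theorem IsReal.limF_le (hs : IsReal s) (n : M.el .nat) :
    limF s ≤ hyp (s n).val + del n := by
  rw [del, ← map_add]
  refine lim_le_hyp n fun m hm => ?_
  linarith [(abs_lt.1 (hs.near hm)).1]

theorem IsReal.le_limF (hs : IsReal s) (n : M.el .nat) :
    hyp (s n).val ≤ limF s + del n := by
  have : hyp ((s n).val - eps n) ≤ limF s := by
    refine hyp_le_lim n fun m hm => ?_
    linarith [(abs_lt.1 (hs.near hm)).2]
  rw [map_sub] at this
  linarith [show hyp (eps n) = del n from rfl]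

theorem seqLe_iff_val (hs : ∀ n, (s n).den ≠ 0) (ht : ∀ n, (t n).den ≠ 0) :
    SeqLe s t ↔ ∀ n, (s n).val ≤ (t n).val + 2 * eps n := by
  refine forall_congr' fun n => ?_
  rw [Frac.le_iff (hs n) (Frac.add_den (ht n) (twoInv2_den n)), Frac.val_add (ht n) (twoInv2_den n),
    twoInv2_val]

end

variable [Arith M] {s t : M.Nt → Frac M}

theorem IsReal.seqLe_iff (hs : IsReal s) (ht : IsReal t) :
    SeqLe s t ↔ ∀ n, limF s ≤ limF t + del n := by
  rw [seqLe_iff_val hs.den ht.den]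
  constructor
  · intro h n
    have h1 := hs.limF_le (n + 2)
    have h2 := ht.le_limF (n + 2)
    have h3 := hyp_le.2 (h (n + 2))
    rw [map_add, map_mul, map_ofNat, show hyp (eps (n + 2)) = del (n + 2) from rfl] at h3
    rw [del_add_two] at *
    linarith
  · intro h n
    refine le_of_forall_eps fun m => ?_
    rw [← hyp_le]
    simp only [map_add, map_mul, map_ofNat]
    have h1 := hs.le_limF n
    have h2 := ht.limF_le n
    have h3 := h m
    simp only [del] at *
    linarith

theorem IsReal.not_seqLe_iff (hs : IsReal s) (ht : IsReal t) :
    ¬ SeqLe s t ↔ ∃ n, limF t + del n < limF s := by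
  constructor
  · intro h
    rw [seqLe_iff_val hs.den ht.den] at h
    push Not at h
    obtain ⟨n, hn⟩ := h
    obtain ⟨m, hm⟩ := exists_eps_lt (sub_pos.2 hn)
    refine ⟨m, ?_⟩
    have h1 := hs.le_limF n
    have h2 := ht.limF_le n
    have h3 := hyp_lt.2 hm
    simp only [map_sub, map_add, map_mul, map_ofNat, del] at *
    linarith
  · rintro ⟨n, hn⟩ h
    exact absurd hn (not_lt.2 ((hs.seqLe_iff ht).1 h n))

theorem IsReal.seqEq_iff (hs : IsReal s) (ht : IsReal t) :
    SeqEq s t ↔ ∀ n, limF s ≤ limF t + del n ∧ limF t ≤ limF s + del n := by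
  rw [forall_and, ← hs.seqLe_iff ht, ← ht.seqLe_iff hs, seqLe_iff_val hs.den ht.den,
    seqLe_iff_val ht.den hs.den, ← forall_and]
  refine forall_congr' fun n => ?_
  rw [Frac.distLe_iff (hs.den n) (ht.den n) (twoInv2_den n), twoInv2_val, abs_sub_le_iff]
  constructor <;> rintro ⟨h1, h2⟩ <;> constructor <;> linarith

theorem IsReal.near_iff (hs : IsReal s) (ht : IsReal t) (k : M.Nt) :
    (∃ n : M.Nt, (((s n).sub (t n)).add (M.twoInv2 n)).Lt (M.inv2 k) ∧
      (((t n).sub (s n)).add (M.twoInv2 n)).Lt (M.inv2 k)) ↔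
      ∃ n, limF s - limF t + del n < del k ∧ limF t - limF s + del n < del k := by
  have key : ∀ n, ((((s n).sub (t n)).add (M.twoInv2 n)).Lt (M.inv2 k) ∧
      (((t n).sub (s n)).add (M.twoInv2 n)).Lt (M.inv2 k)) ↔
      ((s n).val - (t n).val + 2 * eps n < eps k ∧ (t n).val - (s n).val + 2 * eps n < eps k) := by
    intro n
    have h1 := Frac.sub_den (hs.den n) (ht.den n)
    have h2 := Frac.sub_den (ht.den n) (hs.den n)
    rw [Frac.lt_iff (Frac.add_den h1 (twoInv2_den n)) (inv2_den k),
      Frac.lt_iff (Frac.add_den h2 (twoInv2_den n)) (inv2_den k),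
      Frac.val_add h1 (twoInv2_den n), Frac.val_add h2 (twoInv2_den n),
      Frac.val_sub (hs.den n) (ht.den n), Frac.val_sub (ht.den n) (hs.den n), inv2_val, twoInv2_val]
  simp only [key]
  constructor
  · rintro ⟨n, h1, h2⟩
    obtain ⟨m, hm⟩ := exists_eps_lt (lt_min (sub_pos.2 h1) (sub_pos.2 h2))
    obtain ⟨h1', h2'⟩ := lt_min_iff.1 hm
    refine ⟨m, ?_⟩
    have a1 := hs.le_limF n
    have a2 := ht.limF_le n
    have a3 := ht.le_limF n
    have a4 := hs.limF_le n
    have h3 := hyp_lt.2 h1'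
    have h4 := hyp_lt.2 h2'
    simp only [map_sub, map_add, map_mul, map_ofNat, del] at *
    constructor <;> linarith
  · rintro ⟨m, h1, h2⟩
    refine ⟨m + 2, ?_⟩
    rw [← hyp_lt, ← hyp_lt]
    have a1 := hs.le_limF (m + 2)
    have a2 := ht.limF_le (m + 2)
    have a3 := ht.le_limF (m + 2)
    have a4 := hs.limF_le (m + 2)
    simp only [map_sub, map_add, map_mul, map_ofNat]
    change _ + 2 * del (m + 2) < del k ∧ _ + 2 * del (m + 2) < del k
    rw [del_add_two] at *
    constructor <;> linarith

end reals

end HigherOrderRM.TypeStr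

namespace HigherOrderRM.TypeStr

/-! ### Codes of pairs and of rational numbers -/

variable {M : TypeStr.{u}} [Arith M]

theorem isPair_iff {c n m : M.el .nat} :
    M.IsPair c n m ↔
      2 * toRat c = (toRat n + toRat m) ^ 2 + 3 * toRat n + toRat m := by
  rw [IsPair, ← toRat_inj]
  simp only [add_eq, mul_eq, map_add, map_mul]
  constructor <;> intro h <;> linarith

theorem IsPair.sum_le {c n m n' m' : M.el .nat} (h : M.IsPair c n m) (h' : M.IsPair c n' m') :
    n + m ≤ n' + m' := by
  rw [isPair_iff] at h h'
  by_contra hc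
  have h1 := toRat_add_one_le (toRat_lt.2 (not_le.1 hc))
  simp only [map_add] at h1
  have := toRat_nonneg n
  have := toRat_nonneg m
  have := toRat_nonneg n'
  have := toRat_nonneg m'
  nlinarith

theorem IsPair.unique {c n m n' m' : M.el .nat} (h : M.IsPair c n m) (h' : M.IsPair c n' m') :
    n = n' ∧ m = m' := by
  have hs := congrArg toRat (le_antisymm (h.sum_le h') (h'.sum_le h))
  rw [isPair_iff] at h h'
  simp only [map_add] at hs
  rw [hs] at h
  constructor <;> rw [← toRat_inj] <;> linarith

theorem IsPair.le {c n m : M.el .nat} (h : M.IsPair c n m) : n ≤ c := by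
  rw [isPair_iff] at h
  rw [← toRat_le]
  nlinarith [toRat_nonneg n, toRat_nonneg m]

instance Dec.isPair {C : Type u} [Context M C] (φ ψ χ : C → M.el .nat) [IsDef φ] [IsDef ψ]
    [IsDef χ] : Dec (M := M) (fun e => M.IsPair (φ e) (ψ e) (χ e)) := by
  unfold IsPair; infer_instance

theorem exists_isPair (n m : M.el .nat) : ∃ c, M.IsPair c n m := by
  have h : ∀ s : M.el .nat, ∃ t : M.el .nat, t + t = s * s + s := by
    refine dec_induction (fun s => ∃ t : M.el .nat, t + t = s * s + s) ⟨0, by simp⟩ ?_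
    rintro s ⟨t, ht⟩
    exact ⟨t + s + 1, by linear_combination ht⟩
  obtain ⟨t, ht⟩ := h (n + m)
  refine ⟨t + n, ?_⟩
  rw [isPair_iff]
  have := congrArg toRat ht
  simp only [map_add, map_mul] at this ⊢
  linarith

theorem exists_isPair_of_code (c : M.el .nat) : ∃ n m, M.IsPair c n m := by
  refine dec_induction (fun c => ∃ n m, M.IsPair c n m) ⟨0, 0, by rw [isPair_iff]; simp⟩ ?_ c
  rintro c ⟨n, m, h⟩
  rw [isPair_iff] at h
  rcases eq_zero_or_eq_succ m with rfl | ⟨m, rfl⟩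
  · refine ⟨0, n + 1, ?_⟩
    rw [isPair_iff]
    simp only [map_add, map_one, map_zero] at *
    linarith
  · refine ⟨n + 1, m, ?_⟩
    rw [isPair_iff]
    simp only [map_add, map_one] at *
    linarith

theorem exists_half (n : M.el .nat) : ∃ k, n = k + k ∨ n + 1 = k + k := by
  refine dec_induction (fun n => ∃ k : M.el .nat, n = k + k ∨ n + 1 = k + k)
    ⟨0, Or.inl (by simp)⟩ ?_ n
  rintro n ⟨k, h | h⟩
  · exact ⟨k + 1, Or.inr (by rw [h]; ring)⟩
  · exact ⟨k, Or.inl h⟩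

theorem half_unique {k k' : M.el .nat} (h : k + k = k' + k') : k = k' := by
  have := congrArg toRat h
  simp only [map_add] at this
  rw [← toRat_inj]; linarith

theorem not_even_and_odd {k k' : M.el .nat} (h : k + k + 1 = k' + k') : False := by
  have := congrArg toRat h
  simp only [map_add, map_one] at this
  rcases lt_or_ge k k' with h1 | h1
  · have := toRat_add_one_le (toRat_lt.2 h1); linarith
  · have := toRat_le.2 h1; linarith

theorem Codes.unique {c : M.el .nat} {q r : Frac M} (h : M.Codes c q) (h' : M.Codes c r) :
    q = r := by
  obtain ⟨n, m, hp, hd, hn⟩ := h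
  obtain ⟨n', m', hp', hd', hn'⟩ := h'
  obtain ⟨rfl, rfl⟩ := hp.unique hp'
  obtain ⟨qp, qn, qd⟩ := q
  obtain ⟨rp, rn, rd⟩ := r
  simp only [succ_eq, add_eq, zero_eq] at *
  rcases hn with ⟨h1, h2⟩ | ⟨h1, h2⟩ <;> rcases hn' with ⟨h3, h4⟩ | ⟨h3, h4⟩
  · rw [Frac.mk.injEq]
    exact ⟨half_unique (h1.symm.trans h3), h2.trans h4.symm, hd.trans hd'.symm⟩
  · exact (not_even_and_odd (h1 ▸ h3)).elim
  · exact (not_even_and_odd (h3 ▸ h1)).elim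
  · rw [Frac.mk.injEq]
    exact ⟨h2.trans h4.symm, half_unique (h1.symm.trans h3), hd.trans hd'.symm⟩

theorem exists_codes (c : M.el .nat) : ∃ q, M.Codes c q := by
  obtain ⟨n, m, h⟩ := exists_isPair_of_code c
  obtain ⟨k, hk | hk⟩ := exists_half n
  · exact ⟨⟨k, 0, M.succ m⟩, n, m, h, rfl, Or.inl ⟨hk, rfl⟩⟩
  · exact ⟨⟨0, k, M.succ m⟩, n, m, h, rfl, Or.inr ⟨(succ_eq n).trans hk, rfl⟩⟩

theorem codes_decode (c : M.el .nat) : M.Codes c (M.decode c) :=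
  Classical.epsilon_spec (exists_codes c)

theorem codes_iff {c : M.el .nat} {q : Frac M} : M.Codes c q ↔ M.decode c = q :=
  ⟨fun h => (codes_decode c).unique h, fun h => h ▸ codes_decode c⟩

theorem decode_den (c : M.el .nat) : (M.decode c).den ≠ 0 := by
  obtain ⟨n, m, -, hd, -⟩ := codes_decode c
  rw [hd, succ_eq]
  exact add_one_ne_zero' m

theorem exists_decode_val {q : Frac M} (hq : q.den ≠ 0) : ∃ c, (M.decode c).val = q.val := by
  obtain ⟨d, hd⟩ := (eq_zero_or_eq_succ q.den).resolve_left hq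
  have key : ∀ n a b : M.el .nat, ((n = a + a ∧ b = 0) ∨ (n + 1 = b + b ∧ a = 0)) →
      ∃ c, M.decode c = ⟨a, b, q.den⟩ := fun n a b h => by
    obtain ⟨c, hc⟩ := exists_isPair n d
    refine ⟨c, codes_iff.1 ⟨n, d, hc, hd.trans (succ_eq d).symm, ?_⟩⟩
    rwa [succ_eq]
  rcases le_total q.neg q.pos with h | h <;> obtain ⟨a, ha⟩ := exists_add_of_le h
  · obtain ⟨c, hc⟩ := key (a + a) a 0 (Or.inl ⟨rfl, rfl⟩)
    exact ⟨c, by rw [hc]; simp [Frac.val, ha]⟩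
  · rcases eq_zero_or_eq_succ a with rfl | ⟨b, rfl⟩
    · obtain ⟨c, hc⟩ := key (0 + 0) 0 0 (Or.inl ⟨rfl, rfl⟩)
      exact ⟨c, by rw [hc]; simp [Frac.val, ha]⟩
    · obtain ⟨c, hc⟩ := key (b + b + 1) 0 (b + 1) (Or.inr ⟨by ring, rfl⟩)
      exact ⟨c, by rw [hc]; simp [Frac.val, ha]⟩

/-! ### Decidability of the relations between real numbers -/

section

variable {C : Type u} [Context M C]

/-- A function with values in the fractions is definable if its components are. -/
class IsDefFrac (φ : C → Frac M) : Prop where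
  pos : IsDef fun e => (φ e).pos
  neg : IsDef fun e => (φ e).neg
  den : IsDef fun e => (φ e).den

instance IsDefFrac.mk' (φ ψ χ : C → M.el .nat) [h1 : IsDef φ] [h2 : IsDef ψ] [h3 : IsDef χ] :
    IsDefFrac (fun e => (⟨φ e, ψ e, χ e⟩ : Frac M)) := ⟨h1, h2, h3⟩

instance IsDefFrac.const (q : Frac M) : IsDefFrac (fun _ : C => q) :=
  ⟨inferInstance, inferInstance, inferInstance⟩

instance (priority := 800) IsDefFrac.weaken₁ {σ : Ty} (φ : C → Frac M) [h : IsDefFrac φ] :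
    IsDefFrac (fun e : C × M.el σ => φ e.1) :=
  ⟨h.pos.weaken, h.neg.weaken, h.den.weaken⟩

instance IsDefFrac.add (φ ψ : C → Frac M) [h1 : IsDefFrac φ] [h2 : IsDefFrac ψ] :
    IsDefFrac (fun e => (φ e).add (ψ e)) := by
  have := h1.pos; have := h1.neg; have := h1.den; have := h2.pos; have := h2.neg; have := h2.den
  unfold Frac.add; infer_instance

instance IsDefFrac.sub (φ ψ : C → Frac M) [h1 : IsDefFrac φ] [h2 : IsDefFrac ψ] :
    IsDefFrac (fun e => (φ e).sub (ψ e)) := by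
  have := h1.pos; have := h1.neg; have := h1.den; have := h2.pos; have := h2.neg; have := h2.den
  unfold Frac.sub; infer_instance

instance IsDefFrac.inv2 (φ : C → M.el .nat) [IsDef φ] : IsDefFrac (fun e => M.inv2 (φ e)) := by
  unfold TypeStr.inv2; infer_instance

instance IsDefFrac.twoInv2 (φ : C → M.el .nat) [IsDef φ] :
    IsDefFrac (fun e => M.twoInv2 (φ e)) := by
  unfold TypeStr.twoInv2; infer_instance

instance Dec.fracLe (φ ψ : C → Frac M) [h1 : IsDefFrac φ] [h2 : IsDefFrac ψ] :
    Dec (M := M) (fun e => (φ e).Le (ψ e)) := by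
  have := h1.pos; have := h1.neg; have := h1.den; have := h2.pos; have := h2.neg; have := h2.den
  unfold Frac.Le; infer_instance

instance Dec.fracLt (φ ψ : C → Frac M) [h1 : IsDefFrac φ] [h2 : IsDefFrac ψ] :
    Dec (M := M) (fun e => (φ e).Lt (ψ e)) := by
  have := h1.pos; have := h1.neg; have := h1.den; have := h2.pos; have := h2.neg; have := h2.den
  unfold Frac.Lt; infer_instance

instance Dec.codes (φ ψ χ θ : C → M.el .nat) [IsDef φ] [IsDef ψ] [IsDef χ] [IsDef θ] :
    Dec (M := M) (fun e => M.Codes (φ e) ⟨ψ e, χ e, θ e⟩) := by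
  unfold Codes
  dsimp only
  infer_instance

instance IsDefFrac.decode (φ : C → M.el .nat) [IsDef φ] :
    IsDefFrac (fun e => M.decode (φ e)) where
  pos := by
    have : Dec (M := M) (fun e : C × M.el .nat => (M.decode (φ e.1)).pos = e.2) :=
      Dec.congr (P := fun e => ∃ b d, M.Codes (φ e.1) ⟨e.2, b, d⟩) inferInstance fun e => by
        simp only [codes_iff]
        exact ⟨fun h => ⟨_, _, by rw [← h]⟩, fun ⟨_, _, h⟩ => by rw [h]⟩
    exact IsDef.of_graph _
  neg := by
    have : Dec (M := M) (fun e : C × M.el .nat => (M.decode (φ e.1)).neg = e.2) :=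
      Dec.congr (P := fun e => ∃ b d, M.Codes (φ e.1) ⟨b, e.2, d⟩) inferInstance fun e => by
        simp only [codes_iff]
        exact ⟨fun h => ⟨_, _, by rw [← h]⟩, fun ⟨_, _, h⟩ => by rw [h]⟩
    exact IsDef.of_graph _
  den := by
    have : Dec (M := M) (fun e : C × M.el .nat => (M.decode (φ e.1)).den = e.2) :=
      Dec.congr (P := fun e => ∃ b d, M.Codes (φ e.1) ⟨b, d, e.2⟩) inferInstance fun e => by
        simp only [codes_iff]
        exact ⟨fun h => ⟨_, _, by rw [← h]⟩, fun ⟨_, _, h⟩ => by rw [h]⟩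
    exact IsDef.of_graph _

instance IsDefFrac.seq (φ : C → M.el .one) (ψ : C → M.el .nat) [IsDef φ] [IsDef ψ] :
    IsDefFrac (fun e => M.seq (φ e) (ψ e)) := by
  unfold TypeStr.seq; infer_instance

instance Dec.seqLe (φ ψ : C → M.el .nat → Frac M)
    [IsDefFrac (fun e : C × M.el .nat => φ e.1 e.2)]
    [IsDefFrac (fun e : C × M.el .nat => ψ e.1 e.2)] :
    Dec (M := M) (fun e => SeqLe (φ e) (ψ e)) := by
  unfold SeqLe; infer_instance

instance Dec.fastCauchy (φ : C → M.el .one) [IsDef φ] :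
    Dec (M := M) (fun e => FastCauchy (M.seq (φ e))) := by
  unfold FastCauchy Frac.DistLt; infer_instance

end

end HigherOrderRM.TypeStr

namespace HigherOrderRM.TypeStr

/-! ### Real numbers as objects of type `1` -/

variable {M : TypeStr.{u}}

section

variable {x y : M.el .one}

theorem unitI_subset : M.UnitI ⊆ M.Reals := fun _ h => h.1

theorem seq_congr (h : M.Eqv .one x y) : M.seq x = M.seq y :=
  funext fun n => congrArg M.decode (h n)

theorem mem_reals_congr (h : M.Eqv .one x y) : x ∈ M.Reals ↔ y ∈ M.Reals := by
  change FastCauchy _ ↔ FastCauchy _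
  rw [seq_congr h]

end

variable [Arith M]

section

variable {C : Type u} [Context M C]

instance Dec.memReals (φ : C → M.el .one) [IsDef φ] :
    Dec (M := M) (fun e => φ e ∈ M.Reals) := Dec.fastCauchy φ

instance Dec.memUnitI (φ : C → M.el .one) [IsDef φ] :
    Dec (M := M) (fun e => φ e ∈ M.UnitI) := by
  change Dec (M := M) (fun e => φ e ∈ M.Reals ∧ SeqLe (fun _ => M.fracZero) (M.seq (φ e)) ∧
    SeqLe (M.seq (φ e)) (fun _ => M.fracOne))
  infer_instance

instance Dec.rLe (φ ψ : C → M.el .one) [IsDef φ] [IsDef ψ] :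
    Dec (M := M) (fun e => M.RLe (φ e) (ψ e)) := by
  unfold RLe; infer_instance

instance Dec.rLt (φ ψ : C → M.el .one) [IsDef φ] [IsDef ψ] :
    Dec (M := M) (fun e => M.RLt (φ e) (ψ e)) := by
  unfold RLt; infer_instance

/-- A definable sequence of fractions is represented, up to the values of its terms, by a definable
object of type `1`. -/
theorem exists_seq_val (φ : C × M.el .nat → Frac M) [IsDefFrac φ] (hφ : ∀ e, (φ e).den ≠ 0) :
    ∃ ψ : C → M.el .one, IsDef ψ ∧ ∀ e n, (M.seq (ψ e) n).val = (φ (e, n)).val := by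
  obtain ⟨χ, hχ, hχ'⟩ := exists_select (M := M) (C := C × M.el .nat)
    (fun e c => (M.decode c).Le (φ e) ∧ (φ e).Le (M.decode c))
  obtain ⟨ψ, hψ, hψ'⟩ := IsDef.lam (C := C) (σ := .nat) (τ := .nat) (fun e n => χ (e, n))
  refine ⟨ψ, hψ, fun e n => ?_⟩
  rw [seq, show M.app (ψ e) n = χ (e, n) from hψ' e n]
  obtain ⟨c, hc⟩ := exists_decode_val (hφ (e, n))
  have key : ∀ c, ((M.decode c).Le (φ (e, n)) ∧ (φ (e, n)).Le (M.decode c)) ↔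
      (M.decode c).val = (φ (e, n)).val := fun c => by
    rw [Frac.le_iff (decode_den c) (hφ (e, n)), Frac.le_iff (hφ (e, n)) (decode_den c),
      le_antisymm_iff]
  exact (key _).1 (hχ' (e, n) ⟨c, (key c).2 hc⟩).1

end

/-! ### Order and distance of real numbers by their values -/

theorem isReal_seq {x : M.el .one} (hx : x ∈ M.Reals) : IsReal (M.seq x) where
  den _ := decode_den _
  fast := hx

theorem mem_reals_iff {x : M.el .one} : x ∈ M.Reals ↔
    ∀ n i : M.el .nat, |(M.seq x n).val - (M.seq x (n + i)).val| < eps n :=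
  isReal_iff fun _ => decode_den _

/-- The value of a real number. -/
noncomputable def realVal (x : M.el .one) : M.Hyper := limF (M.seq x)

section

variable {x y : M.el .one}

theorem rLe_iff (hx : x ∈ M.Reals) (hy : y ∈ M.Reals) :
    M.RLe x y ↔ ∀ n, realVal x ≤ realVal y + del n :=
  (isReal_seq hx).seqLe_iff (isReal_seq hy)

theorem rLt_iff (hx : x ∈ M.Reals) (hy : y ∈ M.Reals) :
    M.RLt x y ↔ ∃ n, realVal x + del n < realVal y :=
  (isReal_seq hy).not_seqLe_iff (isReal_seq hx)

theorem rEq_iff (hx : x ∈ M.Reals) (hy : y ∈ M.Reals) :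
    M.REq x y ↔ ∀ n, realVal x ≤ realVal y + del n ∧ realVal y ≤ realVal x + del n :=
  (isReal_seq hx).seqEq_iff (isReal_seq hy)

theorem near_iff (hx : x ∈ M.Reals) (hy : y ∈ M.Reals) (k : M.Nt) :
    M.Near k x y ↔
      ∃ n, realVal x - realVal y + del n < del k ∧ realVal y - realVal x + del n < del k :=
  (isReal_seq hx).near_iff (isReal_seq hy) k

theorem seqLe_const_iff (hx : x ∈ M.Reals) {q : Frac M} (hq : q.den ≠ 0) :
    SeqLe (M.seq x) (fun _ => q) ↔ ∀ n, realVal x ≤ hyp q.val + del n :=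
  (isReal_seq hx).seqLe_iff (IsReal.const hq)

theorem const_seqLe_iff (hx : x ∈ M.Reals) {q : Frac M} (hq : q.den ≠ 0) :
    SeqLe (fun _ => q) (M.seq x) ↔ ∀ n, hyp q.val ≤ realVal x + del n :=
  (IsReal.const hq).seqLe_iff (isReal_seq hx)

theorem not_seqLe_const_iff (hx : x ∈ M.Reals) {q : Frac M} (hq : q.den ≠ 0) :
    ¬ SeqLe (M.seq x) (fun _ => q) ↔ ∃ n, hyp q.val + del n < realVal x :=
  (isReal_seq hx).not_seqLe_iff (IsReal.const hq)

theorem not_const_seqLe_iff (hx : x ∈ M.Reals) {q : Frac M} (hq : q.den ≠ 0) :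
    ¬ SeqLe (fun _ => q) (M.seq x) ↔ ∃ n, realVal x + del n < hyp q.val :=
  (IsReal.const hq).not_seqLe_iff (isReal_seq hx)

theorem mem_unitI_iff (hx : x ∈ M.Reals) :
    x ∈ M.UnitI ↔ ∀ n, 0 ≤ realVal x + del n ∧ realVal x ≤ 1 + del n := by
  have h : x ∈ M.UnitI ↔ x ∈ M.Reals ∧ SeqLe (fun _ => M.fracZero) (M.seq x) ∧
    SeqLe (M.seq x) (fun _ => M.fracOne) := Iff.rfl
  rw [h, const_seqLe_iff hx fracZero_den, seqLe_const_iff hx fracOne_den, fracZero_val,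
    fracOne_val, map_zero, map_one, forall_and]
  exact and_iff_right hx

theorem rPos_iff (hx : x ∈ M.Reals) : M.RPos x ↔ ∃ n, del n < realVal x := by
  rw [RPos, not_seqLe_const_iff hx fracZero_den, fracZero_val, map_zero]
  simp only [zero_add]

theorem rLtOne_iff (hx : x ∈ M.Reals) : M.RLtOne x ↔ ∃ n, realVal x + del n < 1 := by
  rw [RLtOne, not_const_seqLe_iff hx fracOne_den, fracOne_val, map_one]

theorem rEq_refl (hx : x ∈ M.Reals) : M.REq x x :=
  (rEq_iff hx hx).2 fun n => ⟨by linarith [del_pos n], by linarith [del_pos n]⟩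

theorem near_refl (hx : x ∈ M.Reals) (k : M.Nt) : M.Near k x x :=
  (near_iff hx hx k).2 ⟨k + 1, by
    rw [del_add_one, sub_self]; constructor <;> linarith [del_pos k]⟩

theorem realVal_congr (h : M.Eqv .one x y) : realVal x = realVal y := by
  rw [realVal, seq_congr h]; rfl

end

/-- The constant sequence with the code `c`. -/
def constReal (c : M.Nt) : M.el .one := M.combK .nat .nat c

theorem constReal_app (c n : M.Nt) : constReal c n = c := Model.axioms.combK_eq .nat .nat c n

theorem seq_constReal (c : M.Nt) : M.seq (constReal c) = fun _ => M.decode c :=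
  funext fun n => congrArg M.decode (constReal_app c n)

theorem constReal_mem (c : M.Nt) : constReal c ∈ M.Reals := by
  change FastCauchy _
  rw [seq_constReal]
  exact (IsReal.const (decode_den c)).fast

theorem realVal_constReal (c : M.Nt) : realVal (constReal c) = hyp (M.decode c).val := by
  rw [realVal, seq_constReal]; rfl

instance IsDef.constReal {C : Type u} [Context M C] (φ : C → M.Nt) [IsDef φ] :
    IsDef (fun e => constReal (φ e)) := by
  unfold TypeStr.constReal; infer_instance

/-- The rational number denoted by a fraction, as a real number of the model. -/
theorem exists_constReal {q : Frac M} (hq : q.den ≠ 0) :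
    ∃ c : M.Nt, realVal (constReal c) = hyp q.val := by
  obtain ⟨c, hc⟩ := exists_decode_val hq
  exact ⟨c, by rw [realVal_constReal, hc]⟩

end HigherOrderRM.TypeStr

namespace HigherOrderRM.TypeStr

/-! ### The supremum functional from `(∃³)` -/

variable {M : TypeStr.{u}} [Arith M]

theorem Dec.exists_one (h3 : M.Exists3) {C : Type u} [Context M C] (P : C → M.el .one → Prop)
    [h : Dec (M := M) (fun e : C × M.el .one => P e.1 e.2)] :
    Dec (M := M) (fun e => ∃ x, P e x) := by
  obtain ⟨χ, hχ, hP⟩ := h.exists_char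
  obtain ⟨ψ, hψ, hψ'⟩ := IsDef.lam (C := C) (σ := .one) (τ := .nat) (fun e x => χ (e, x))
  obtain ⟨E, hE⟩ := h3
  refine ⟨fun e => M.app E (ψ e), inferInstance, fun e => ?_⟩
  rw [hE]
  exact exists_congr fun x => by
    rw [hP (e, x), show M.app (ψ e) x = χ (e, x) from hψ' e x]

/-- Some value of `f` on `[0,1]` is greater than `q`. -/
def Exceeds (f : M.el .realFn) (q : Frac M) : Prop :=
  ∃ x, x ∈ M.UnitI ∧ ¬ SeqLe (M.seq (f x)) (fun _ => q)

theorem Dec.exceeds (h3 : M.Exists3) {C : Type u} [Context M C] (φ : C → M.el .realFn)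
    (ψ : C → Frac M) [IsDef φ] [h : IsDefFrac ψ] :
    Dec (M := M) (fun e => Exceeds (φ e) (ψ e)) := by
  have : IsDefFrac (fun e : (C × M.el .one) × M.el .nat => ψ e.1.1) :=
    ⟨h.pos.weaken.weaken, h.neg.weaken.weaken, h.den.weaken.weaken⟩
  exact Dec.exists_one h3 _

section

variable {f : M.el .realFn}

theorem exceeds_iff (hf : M.IsFunOn M.UnitI f) {q : Frac M} (hq : q.den ≠ 0) :
    Exceeds f q ↔ ∃ x ∈ M.UnitI, ∃ n, hyp q.val + del n < realVal (f x) := by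
  refine exists_congr fun x => and_congr_right fun hx => ?_
  exact not_seqLe_const_iff (hf.1 x hx) hq

theorem not_exceeds_iff (hf : M.IsFunOn M.UnitI f) {q : Frac M} (hq : q.den ≠ 0) :
    ¬ Exceeds f q ↔ ∀ x ∈ M.UnitI, ∀ n, realVal (f x) ≤ hyp q.val + del n := by
  rw [exceeds_iff hf hq]; push Not; rfl

theorem Exceeds.mono (hf : M.IsFunOn M.UnitI f) {q r : Frac M} (hq : q.den ≠ 0) (hr : r.den ≠ 0)
    (h : q.val ≤ r.val) (h' : Exceeds f r) : Exceeds f q := by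
  rw [exceeds_iff hf hq]
  rw [exceeds_iff hf hr] at h'
  obtain ⟨x, hx, n, hn⟩ := h'
  exact ⟨x, hx, n, by linarith [hyp_le.2 h]⟩

theorem exists_mem_unitI : ∃ x, x ∈ M.UnitI := by
  obtain ⟨c, hc⟩ := exists_constReal (M := M) fracZero_den
  refine ⟨constReal c, (mem_unitI_iff (constReal_mem c)).2 fun n => ?_⟩
  rw [hc, fracZero_val, map_zero]
  have := del_pos n
  constructor <;> linarith

/-- A function bounded above has a rational number below its supremum by at most `2 ^ (-n)`: on a
grid of this width, take the last number that the function exceeds. -/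
theorem exists_exceeds_gap (h3 : M.Exists3) (hf : M.IsFunOn M.UnitI f)
    (hb : ∃ d, ¬ Exceeds f (M.decode d)) (n : M.el .nat) :
    ∃ c, Exceeds f (M.decode c) ∧ ¬ Exceeds f ((M.decode c).add (M.inv2 n)) := by
  obtain ⟨d, hd⟩ := hb
  obtain ⟨x, hx⟩ := exists_mem_unitI (M := M)
  -- the term `0` of the real `f x` is within `1` of it, so that `f x` exceeds `q` by at least `1`
  let q : Frac M := (M.seq (f x) 0).sub ⟨M.two, 0, 1⟩
  have hq : q.den ≠ 0 := Frac.sub_den (decode_den _) one_ne_zero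
  have hqv : q.val = (M.seq (f x) 0).val - 2 := by
    have h1 : Frac.val (M := M) ⟨M.two, 0, 1⟩ = 2 := by
      simp only [Frac.val, two_eq, map_ofNat, map_zero, map_one, sub_zero, div_one]
    exact (Frac.val_sub (r := ⟨M.two, 0, 1⟩) (decode_den _) one_ne_zero).trans (by rw [h1]; rfl)
  have hexq : Exceeds f q := by
    rw [exceeds_iff hf hq]
    refine ⟨x, hx, 1, ?_⟩
    have h1 := (isReal_seq (hf.1 x hx)).le_limF 0
    have h2 : del (0 : M.el .nat) = 1 := by rw [del, eps_zero, map_one]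
    have h3 : del (1 : M.el .nat) = 1 / 2 := by rw [← zero_add 1, del_add_one, h2]
    rw [hqv, map_sub, map_ofNat, h3, realVal]
    linarith
  let g : M.el .nat → Frac M := fun j => q.add ⟨j, 0, M.pow2 n⟩
  have hg : ∀ j, (g j).den ≠ 0 := fun j => Frac.add_den hq (pow2_ne_zero n)
  have hgv : ∀ j, (g j).val = q.val + toRat j * eps n := fun j => by
    rw [Frac.val_add hq (pow2_ne_zero n)]
    simp only [Frac.val, map_zero, sub_zero, eps, div_eq_mul_inv]
  have : Dec (M := M) (fun e : PUnit × M.el .nat => Exceeds f (g e.2)) := Dec.exceeds h3 _ _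
  obtain ⟨j, hj, hmin⟩ := exists_least (M := M) (fun j => ¬ Exceeds f (g j)) (by
    obtain ⟨N, hN⟩ := exists_le_toRat (((M.decode d).val - q.val) * toRat (M.pow2 n))
    refine ⟨N, fun h => hd (h.mono hf (decode_den d) (hg N) ?_)⟩
    rw [hgv]
    have h1 := mul_le_mul_of_nonneg_right hN (eps_pos n).le
    rw [mul_assoc, mul_comm (toRat (M.pow2 n)), eps_mul_pow2, mul_one] at h1
    linarith)
  rcases eq_zero_or_eq_succ j with rfl | ⟨k, rfl⟩
  · refine absurd (hexq.mono hf (hg 0) hq ?_) hj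
    rw [hgv, map_zero, zero_mul, add_zero]
  · have hk : Exceeds f (g k) := by
      by_contra hc
      have h1 := hmin k hc
      rw [← toRat_le, map_add, map_one] at h1
      linarith
    obtain ⟨c, hc⟩ := exists_decode_val (hg k)
    refine ⟨c, hk.mono hf (decode_den c) (hg k) hc.le, fun h => hj (h.mono hf (hg _) ?_ ?_)⟩
    · exact Frac.add_den (decode_den c) (inv2_den n)
    · rw [Frac.val_add (decode_den c) (inv2_den n), hc, hgv, hgv, inv2_val, map_add, map_one]
      linarith

end

/-- The conditions on the value `c` at `n` of the supremum of `f` as an extended real: the value at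
`0` tells whether `f` is bounded above, and the next ones are codes of rationals that approximate
the supremum from below. -/
def SupSpec (f : M.el .realFn) (n c : M.el .nat) : Prop :=
  (n = 0 ∧ (((∃ d, ¬ Exceeds f (M.decode d)) ∧ c = 0) ∨
    ((∀ d, Exceeds f (M.decode d)) ∧ c = 1))) ∨
  ∃ k, n = k + 1 ∧ Exceeds f (M.decode c) ∧ ¬ Exceeds f ((M.decode c).add (M.inv2 (k + 2)))

theorem exists_sup_object (h3 : M.Exists3) :
    ∃ Ξ : M.el (.fn .realFn .one), ∀ f n, (∃ c, SupSpec f n c) →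
      SupSpec f n (Ξ f n) ∧ ∀ c, SupSpec f n c → Ξ f n ≤ c := by
  have i1 {C : Type u} [Context M C] (φ : C → M.el .realFn) (ψ : C → Frac M) [IsDef φ]
    [IsDefFrac ψ] : Dec (M := M) (fun e => Exceeds (φ e) (ψ e)) := Dec.exceeds h3 φ ψ
  have : Dec (M := M) (fun e : ((PUnit × M.el .realFn) × M.el .nat) × M.el .nat =>
      SupSpec e.1.1.2 e.1.2 e.2) := by
    unfold SupSpec; infer_instance
  obtain ⟨φ, hφ, hφ'⟩ := exists_select (M := M) (C := (PUnit × M.el .realFn) × M.el .nat)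
    (fun e c => SupSpec e.1.2 e.2 c)
  obtain ⟨Ξ, hΞ⟩ := hφ.exists_rep
  refine ⟨Ξ, fun f n hc => ?_⟩
  rw [show M.app (M.app Ξ f) n = φ ((⟨⟩, f), n) from hΞ ((⟨⟩, f), n)]
  exact hφ' ((⟨⟩, f), n) hc

section sup

variable {f : M.el .realFn}

theorem exists_supSpec (h3 : M.Exists3) (hf : M.IsFunOn M.UnitI f)
    (hb : ∃ d, ¬ Exceeds f (M.decode d)) (n : M.el .nat) : ∃ c, SupSpec f n c := by
  rcases eq_zero_or_eq_succ n with rfl | ⟨k, rfl⟩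
  · exact ⟨0, Or.inl ⟨rfl, Or.inl ⟨hb, rfl⟩⟩⟩
  · obtain ⟨c, hc⟩ := exists_exceeds_gap h3 hf hb (k + 2)
    exact ⟨c, Or.inr ⟨k, rfl, hc⟩⟩

theorem isSup_of_unbounded (hf : M.IsFunOn M.UnitI f)
    (hb : ∀ d, Exceeds f (M.decode d)) {e : M.el .one} (he : e 0 = 1) : M.IsSup f e := by
  refine ⟨Or.inr (Or.inl he), fun x _ => Or.inr he, fun b hb' h => ?_⟩
  exfalso
  let q : Frac M := (M.seq b 0).add M.fracOne
  have hq : q.den ≠ 0 := Frac.add_den (decode_den _) fracOne_den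
  obtain ⟨c, hc⟩ := exists_decode_val hq
  obtain ⟨x, hx, n, hn⟩ := (exceeds_iff hf hq).1 ((hb c).mono hf hq (decode_den c) hc.ge)
  have h1 := (rLe_iff (hf.1 x hx) hb').1 (h x hx) n
  have h2 := (isReal_seq hb').limF_le 0
  rw [show q.val = _ from Frac.val_add (decode_den _) fracOne_den, fracOne_val, map_add,
    map_one] at hn
  rw [del, eps_zero, map_one] at h2
  rw [show realVal b = limF (M.seq b) from rfl] at h1
  have h3 : hyp ((M.seq b 0).val) = hyp (M.decode (b 0)).val := rfl
  linarith

/-- Rationals that approximate the supremum from below form a real number, the supremum. -/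
theorem isReal_of_gap (hf : M.IsFunOn M.UnitI f) {s : M.el .nat → Frac M}
    (hden : ∀ n, (s n).den ≠ 0) (hs : ∀ n, Exceeds f (s n))
    (hs' : ∀ n, ¬ Exceeds f ((s n).add (M.inv2 (n + 2)))) : IsReal s := by
  have key : ∀ n m : M.el .nat, (s m).val ≤ (s n).val + eps n / 4 := by
    intro n m
    by_contra hlt
    refine hs' n ((hs m).mono hf (Frac.add_den (hden n) (inv2_den _)) (hden m) ?_)
    rw [Frac.val_add (hden n) (inv2_den _), inv2_val, eps_add_two]
    exact (not_le.1 hlt).le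
  refine ⟨hden, (isReal_iff hden).2 fun n i => ?_⟩
  have h1 := key n (n + i)
  have h2 := key (n + i) n
  have h3 : eps (n + i) ≤ eps n := eps_anti le_self_add
  have h4 := eps_pos n
  rw [abs_lt]
  constructor <;> linarith

theorem isSup_of_bounded (hf : M.IsFunOn M.UnitI f) {e : M.el .one} (he : e 0 = 0)
    (hs : ∀ n, Exceeds f (M.tailSeq e n))
    (hs' : ∀ n : M.el .nat, ¬ Exceeds f ((M.tailSeq e n).add (M.inv2 (n + 2)))) :
    M.IsSup f e := by
  have hden : ∀ n, (M.tailSeq e n).den ≠ 0 := fun n => decode_den _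
  have hreal := isReal_of_gap hf hden hs hs'
  have hfin : M.IsFinite e := ⟨he, hreal.fast⟩
  refine ⟨Or.inl hfin, fun x hx => Or.inl ⟨hfin, ?_⟩, fun b hb h => Or.inl ⟨hfin, ?_⟩⟩
  · rw [(isReal_seq (hf.1 x hx)).seqLe_iff hreal]
    intro n
    have h1 := (not_exceeds_iff hf (Frac.add_den (hden _) (inv2_den _))).1 (hs' (n + 2)) x hx
      (n + 2)
    have h2 := hreal.le_limF (n + 2)
    rw [Frac.val_add (hden _) (inv2_den _), inv2_val, map_add,
      show hyp (eps (n + 2 + 2)) = del (n + 2 + 2) from rfl] at h1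
    simp only [del_add_two] at h1 h2
    rw [show realVal (f x) = limF (M.seq (f x)) from rfl] at h1
    linarith [del_pos n]
  · rw [hreal.seqLe_iff (isReal_seq hb)]
    intro n
    obtain ⟨x, hx, m, hm⟩ := (exceeds_iff hf (hden _)).1 (hs (n + 2))
    have h1 := (rLe_iff (hf.1 x hx) hb).1 (h x hx) (n + 2)
    have h2 := hreal.limF_le (n + 2)
    simp only [del_add_two] at h1 h2
    rw [show realVal b = limF (M.seq b) from rfl] at h1
    linarith [del_pos n, del_pos m]

theorem exceeds_congr {g : M.el .realFn} (hf : M.IsFunOn M.UnitI f) (hg : M.IsFunOn M.UnitI g)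
    (h : ∀ x ∈ M.UnitI, M.REq (f x) (g x)) {q : Frac M} (hq : q.den ≠ 0) (he : Exceeds f q) :
    Exceeds g q := by
  rw [exceeds_iff hf hq] at he
  rw [exceeds_iff hg hq]
  obtain ⟨x, hx, n, hn⟩ := he
  refine ⟨x, hx, n + 1, ?_⟩
  have h1 := ((rEq_iff (hf.1 x hx) (hg.1 x hx)).1 (h x hx) (n + 1)).1
  rw [del_add_one] at *
  linarith

end sup

theorem extEq_of_eqv {e e' : M.el .one} (he : e ∈ M.ExtReals) (h : M.Eqv .one e e') :
    M.ExtEq e e' := by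
  have ht : M.tailSeq e = M.tailSeq e' := funext fun n => congrArg M.decode (h (M.succ n))
  have h0 : M.app e M.zero = M.app e' M.zero := h M.zero
  rcases he with he | he | he
  · have hr : IsReal (M.tailSeq e) := ⟨fun n => decode_den _, he.2⟩
    refine Or.inl ⟨he, ⟨h0 ▸ he.1, ht ▸ he.2⟩, ?_⟩
    rw [← ht, hr.seqEq_iff hr]
    exact fun n => ⟨by linarith [del_pos n], by linarith [del_pos n]⟩
  · exact Or.inr (Or.inl ⟨he, h0.symm.trans he⟩)
  · exact Or.inr (Or.inr ⟨he, h0.symm.trans he⟩)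

/-- With `(∃³)` there is a functional that sends every function on `[0,1]` to its supremum. -/
theorem exists_isSupFunctional (h3 : M.Exists3) :
    ∃ Ξ : M.el (.fn .realFn .one), M.IsSupFunctional (fun _ => True) Ξ := by
  obtain ⟨Ξ, hΞ⟩ := exists_sup_object h3
  have h0 : ∀ k : M.el .nat, ¬ (0 = k + 1) := fun k h => add_one_ne_zero' k h.symm
  have unbounded : ∀ f, (∀ d, Exceeds f (M.decode d)) → M.app (M.app Ξ f) 0 = 1 := fun f hb => by
    rcases (hΞ f 0 ⟨1, Or.inl ⟨rfl, Or.inr ⟨hb, rfl⟩⟩⟩).1 with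
      ⟨-, ⟨⟨d, hd⟩, -⟩ | ⟨-, h⟩⟩ | ⟨k, hk, -⟩
    · exact absurd (hb d) hd
    · exact h
    · exact absurd hk (h0 k)
  have isSup : ∀ f, M.IsFunOn M.UnitI f → M.IsSup f (Ξ f) := fun f hf => by
    by_cases hb : ∀ d, Exceeds f (M.decode d)
    · exact isSup_of_unbounded hf hb (unbounded f hb)
    · have hb' := not_forall.1 hb
      have spec := fun n => (hΞ f n (exists_supSpec h3 hf hb' n)).1
      have hs : ∀ n : M.el .nat, Exceeds f (M.tailSeq (Ξ f) n) ∧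
          ¬ Exceeds f ((M.tailSeq (Ξ f) n).add (M.inv2 (n + 2))) := fun n => by
        rw [tailSeq, succ_eq]
        rcases spec (n + 1) with ⟨h, -⟩ | ⟨k, hk, h⟩
        · exact absurd h (add_one_ne_zero' n)
        · obtain rfl := add_right_cancel hk
          exact h
      refine isSup_of_bounded hf ?_ (fun n => (hs n).1) (fun n => (hs n).2)
      rcases spec 0 with ⟨-, ⟨-, h⟩ | ⟨h, -⟩⟩ | ⟨k, hk, -⟩
      · exact h
      · exact absurd h hb
      · exact absurd hk (h0 k)
  have restrict : ∀ f, M.IsFunOn M.Reals f → M.IsFunOn M.UnitI f := fun f hf =>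
    ⟨fun x hx => hf.1 x (unitI_subset hx),
      fun x hx y hy => hf.2 x (unitI_subset hx) y (unitI_subset hy)⟩
  refine ⟨Ξ, ⟨fun f hf => (isSup f (restrict f hf)).1, fun f g hf hg hfg => ?_⟩,
    fun f hf _ => isSup f hf⟩
  have hf' := restrict f hf
  have hg' := restrict g hg
  have hfg' : ∀ x ∈ M.UnitI, M.REq (f x) (g x) := fun x hx => hfg x (unitI_subset hx)
  have hgf' : ∀ x ∈ M.UnitI, M.REq (g x) (f x) := fun x hx => by
    have := hfg' x hx
    rw [rEq_iff (hf'.1 x hx) (hg'.1 x hx)] at this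
    rw [rEq_iff (hg'.1 x hx) (hf'.1 x hx)]
    exact fun n => (this n).symm
  have iff : ∀ {q : Frac M}, q.den ≠ 0 → (Exceeds f q ↔ Exceeds g q) := fun hq =>
    ⟨exceeds_congr hf' hg' hfg' hq, exceeds_congr hg' hf' hgf' hq⟩
  by_cases hb : ∀ d, Exceeds f (M.decode d)
  · exact Or.inr (Or.inl ⟨unbounded f hb, unbounded g fun d => (iff (decode_den d)).1 (hb d)⟩)
  · have hb' := not_forall.1 hb
    have specIff : ∀ n c, SupSpec f n c ↔ SupSpec g n c := fun n c => by
      simp only [SupSpec, iff (decode_den _), iff (Frac.add_den (decode_den _) (inv2_den _))]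
    refine extEq_of_eqv (isSup f hf').1 fun n => ?_
    have hex := exists_supSpec h3 hf' hb' n
    have h1 := hΞ f n hex
    have h2 := hΞ g n (hex.imp fun c => (specIff n c).1)
    exact le_antisymm (h1.2 _ ((specIff n _).2 h2.1)) (h2.2 _ ((specIff n _).1 h1.1))

end HigherOrderRM.TypeStr

namespace HigherOrderRM.TypeStr

/-! ### Reals with prescribed digits -/

variable {M : TypeStr.{u}} [Arith M]

/-- The real `x` has the digit `1` at the position `i`: for some natural number `p` it lies in
`[(p + 1/4) / 2 ^ i, (p + 1/2) / 2 ^ i]`. This is the next digit in base `4` after scaling by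
`2 ^ i`; the intervals are closed, so that the condition respects equality of reals. -/
def Digit (x : M.el .one) (i : M.el .nat) : Prop :=
  ∃ p : M.el .nat, SeqLe (fun _ => ⟨4 * p + 1, 0, 4 * M.pow2 i⟩) (M.seq x) ∧
    SeqLe (M.seq x) (fun _ => ⟨4 * p + 2, 0, 4 * M.pow2 i⟩)

instance Dec.digit {C : Type u} [Context M C] (φ : C → M.el .one) (ψ : C → M.el .nat) [IsDef φ]
    [IsDef ψ] : Dec (M := M) (fun e => Digit (φ e) (ψ e)) := by
  unfold Digit; infer_instance

theorem four_mul_pow2_ne_zero (i : M.el .nat) : 4 * M.pow2 i ≠ 0 :=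
  mul_ne_zero four_ne_zero (pow2_ne_zero i)

theorem digit_iff {x : M.el .one} (hx : x ∈ M.Reals) (i : M.el .nat) :
    Digit x i ↔ ∃ p : M.el .nat, ∀ n, hyp ((toRat p + 1 / 4) * eps i) ≤ realVal x + del n ∧
      realVal x ≤ hyp ((toRat p + 1 / 2) * eps i) + del n := by
  refine exists_congr fun p => ?_
  have h := (toRat_pos (pow2_ne_zero i)).ne'
  have h1 : Frac.val (M := M) ⟨4 * p + 1, 0, 4 * M.pow2 i⟩ = (toRat p + 1 / 4) * eps i := by
    simp only [Frac.val, map_add, map_mul, map_ofNat, map_one, map_zero, eps]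
    field_simp
    ring
  have h2 : Frac.val (M := M) ⟨4 * p + 2, 0, 4 * M.pow2 i⟩ = (toRat p + 1 / 2) * eps i := by
    simp only [Frac.val, map_add, map_mul, map_ofNat, map_zero, eps]
    field_simp
    ring
  rw [const_seqLe_iff hx (by exact four_mul_pow2_ne_zero i),
    seqLe_const_iff hx (by exact four_mul_pow2_ne_zero i), h1, h2, forall_and]

theorem Digit.congr {x y : M.el .one} (hx : x ∈ M.Reals) (hy : y ∈ M.Reals) (h : M.REq x y)
    {i : M.el .nat} (hd : Digit x i) : Digit y i := by
  rw [rEq_iff hx hy] at h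
  rw [digit_iff hx] at hd
  rw [digit_iff hy]
  obtain ⟨p, hp⟩ := hd
  refine ⟨p, fun n => ?_⟩
  have h1 := h (n + 1)
  have h2 := hp (n + 1)
  rw [del_add_one] at h1 h2
  constructor <;> linarith

/-- A real in the interval `[N / 2 ^ i, (N + 1/12) / 2 ^ i]` does not have the digit `1` at `i`. -/
theorem not_digit {x : M.el .one} (hx : x ∈ M.Reals) {i N : M.el .nat}
    (h1 : hyp (toRat N * eps i) ≤ realVal x) (h2 : realVal x ≤ hyp ((toRat N + 1 / 12) * eps i)) :
    ¬ Digit x i := by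
  rw [digit_iff hx]
  rintro ⟨p, hp⟩
  have hi := eps_pos i
  have h3 : (toRat p + 1 / 4) * eps i ≤ (toRat N + 1 / 12) * eps i := le_of_forall_eps fun n => by
    rw [← hyp_le, map_add]
    exact (hp n).1.trans (by rw [del]; linarith)
  have h4 : toRat N * eps i ≤ (toRat p + 1 / 2) * eps i := le_of_forall_eps fun n => by
    rw [← hyp_le, map_add]
    exact h1.trans (hp n).2
  have h5 := le_of_mul_le_mul_right h3 hi
  have h6 := le_of_mul_le_mul_right h4 hi
  have h7 := toRat_add_one_le (a := p) (b := N) (by linarith)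
  linarith

/-- A family of reals `X j k` in the intervals `[j / 2 ^ k, (j + 1/2) / 2 ^ k]`. -/
def IsGrid (X : M.el (.fn .nat (.fn .nat .one))) : Prop :=
  ∀ j k : M.el .nat, X j k ∈ M.Reals ∧ hyp (toRat j * eps k) ≤ realVal (X j k) ∧
    realVal (X j k) ≤ hyp ((toRat j + 1 / 2) * eps k)

/-- The grid of the dyadic rationals. -/
theorem exists_dyadic_grid : ∃ X : M.el (.fn .nat (.fn .nat .one)), IsGrid X ∧
    ∀ j k i : M.el .nat, k ≤ i → ¬ Digit (X j k) i := by
  obtain ⟨ψ, hψ, hψ'⟩ := exists_seq_val (M := M) (C := (PUnit × M.el .nat) × M.el .nat)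
    (fun e => ⟨e.1.1.2, 0, M.pow2 e.1.2⟩) (fun e => pow2_ne_zero _)
  obtain ⟨X, hX⟩ := exists_object₂ (fun j k => ψ ((⟨⟩, j), k)) (h := hψ)
  have hseq : ∀ j k n, (M.seq (X j k) n).val = toRat j * eps k := fun j k n => by
    rw [seq_congr (hX j k), hψ']
    simp [Frac.val, eps, div_eq_mul_inv]
  have hreal : ∀ j k, X j k ∈ M.Reals := fun j k =>
    mem_reals_iff.2 fun n i => by
      rw [hseq, hseq, sub_self, abs_zero]; exact eps_pos n
  have hval : ∀ j k, realVal (X j k) = hyp (toRat j * eps k) := fun j k =>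
    congrArg lim (funext fun n => hseq j k n)
  refine ⟨X, fun j k => ⟨hreal j k, (hval j k).ge, ?_⟩, fun j k i hki => ?_⟩
  · rw [hval, hyp_le]
    nlinarith [eps_pos k]
  · obtain ⟨d, rfl⟩ := exists_add_of_le hki
    have key : toRat j * eps k = toRat (j * M.pow2 d) * eps (k + d) := by
      rw [map_mul, eps_add]
      linear_combination (- toRat j * eps k) * eps_mul_pow2 d
    refine not_digit (hreal j k) (N := j * M.pow2 d) ?_ ?_
    · rw [hval, key]
    · rw [hval, key, hyp_le]
      nlinarith [eps_pos (k + d)]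

theorem exists_numerators (B : M.el .nat → Prop)
    [Dec (M := M) (fun e : PUnit × M.el .nat => B e.2)] :
    ∃ Z : M.el (.fn .nat .one), ∀ j : M.el .nat, M.recr 0 j Z = j ∧
      ∀ i : M.el .nat, (B i → M.recr (i + 1) j Z = 4 * M.recr i j Z + 1) ∧
        (¬ B i → M.recr (i + 1) j Z = 4 * M.recr i j Z) := by
  obtain ⟨φ, hφ, hφ'⟩ := exists_ite (M := M) (fun e : PUnit × M.el .nat => B e.2) 1 0
  obtain ⟨b, hb⟩ := exists_object (fun i => φ (⟨⟩, i)) (h := hφ)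
  obtain ⟨Z, hZ⟩ := exists_object₂ (M := M) (fun r x : M.el .nat => 4 * r + b x)
  refine ⟨Z, fun j => ⟨Model.axioms.recr_zero _ _, fun i => ?_⟩⟩
  have h1 : M.recr (i + 1) j Z = 4 * M.recr i j Z + b i := by
    rw [← succ_eq]
    exact (Model.axioms.recr_succ _ _ _).trans (hZ _ _)
  have h2 : M.app b i = φ (⟨⟩, i) := hb i
  rw [h1, h2]
  exact ⟨fun h => by rw [(hφ' (⟨⟩, i)).1 h], fun h => by rw [(hφ' (⟨⟩, i)).2 h, add_zero]⟩

/-- A grid of reals whose digits at every second position from `k` on are prescribed: the real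
`X j k` is `(j + ∑ c, B c / 4 ^ (c + 1)) / 2 ^ k`. -/
theorem exists_digit_grid (B : M.el .nat → Prop)
    [Dec (M := M) (fun e : PUnit × M.el .nat => B e.2)] :
    ∃ X : M.el (.fn .nat (.fn .nat .one)), IsGrid X ∧
      ∀ j k c : M.el .nat, Digit (X j k) (k + (c + c)) ↔ B c := by
  obtain ⟨Z, hZ⟩ := exists_numerators B
  obtain ⟨ψ, hψ, hψ'⟩ := exists_seq_val (M := M) (C := (PUnit × M.el .nat) × M.el .nat)
    (fun e => ⟨M.recr e.2 e.1.1.2 Z, 0, M.pow2 (e.1.2 + (e.2 + e.2))⟩) (fun e => pow2_ne_zero _)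
  obtain ⟨X, hX⟩ := exists_object₂ (fun j k => ψ ((⟨⟩, j), k)) (h := hψ)
  let P : M.el .nat → M.el .nat → M.el .nat := fun j i => M.recr i j Z
  have hP0 : ∀ j, P j 0 = j := fun j => (hZ j).1
  have hP1 : ∀ j i, B i → P j (i + 1) = 4 * P j i + 1 := fun j i => ((hZ j).2 i).1
  have hP2 : ∀ j i, ¬ B i → P j (i + 1) = 4 * P j i := fun j i => ((hZ j).2 i).2
  have hseq : ∀ j k i, (M.seq (X j k) i).val = toRat (P j i) * eps (k + (i + i)) := fun j k i => by
    rw [seq_congr (hX j k), hψ']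
    simp [Frac.val, eps, div_eq_mul_inv, P]
  -- the sum of the digits after position `i` is at most `∑ 4 ^ (-c)` over `c ≥ 1`, that is, `1 / 3`
  have grow : ∀ j i d, P j i * M.pow2 (d + d) ≤ P j (i + d) ∧
      3 * P j (i + d) + 1 ≤ (3 * P j i + 1) * M.pow2 (d + d) := fun j i d => by
    refine dec_induction (fun d => P j i * M.pow2 (d + d) ≤ P j (i + d) ∧
      3 * P j (i + d) + 1 ≤ (3 * P j i + 1) * M.pow2 (d + d)) ?_ ?_ d
    · simp only [add_zero, pow2_zero', mul_one]
      exact ⟨le_rfl, le_rfl⟩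
    · rintro d ⟨h1, h2⟩
      have h3 : M.pow2 (d + 1 + (d + 1)) = 4 * M.pow2 (d + d) := by
        rw [show d + 1 + (d + 1) = d + d + 1 + 1 by ring, pow2_add_one, pow2_add_one]; ring
      rw [h3, ← add_assoc i d 1]
      simp only [← toRat_le, map_add, map_mul, map_ofNat, map_one] at h1 h2 ⊢
      by_cases hB : B (i + d)
      · rw [hP1 j _ hB]
        simp only [map_add, map_mul, map_ofNat, map_one]
        constructor <;> linarith
      · rw [hP2 j _ hB]
        simp only [map_mul, map_ofNat]
        constructor <;> linarith
  have bounds : ∀ j k i i', i ≤ i' →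
      toRat (P j i) * eps (k + (i + i)) ≤ toRat (P j i') * eps (k + (i' + i')) ∧
      toRat (P j i') * eps (k + (i' + i')) ≤ (toRat (P j i) + 1 / 3) * eps (k + (i + i)) := by
    intro j k i i' hi
    obtain ⟨d, rfl⟩ := exists_add_of_le hi
    obtain ⟨h1, h2⟩ := grow j i d
    have h3 : eps (k + (i + i)) = toRat (M.pow2 (d + d)) * eps (k + (i + d + (i + d))) := by
      rw [show k + (i + d + (i + d)) = k + (i + i) + (d + d) by ring, eps_add _ (d + d)]
      linear_combination (- eps (k + (i + i))) * eps_mul_pow2 (d + d)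
    have h4 := eps_pos (k + (i + d + (i + d)))
    simp only [← toRat_le, map_add, map_mul, map_ofNat, map_one] at h1 h2
    rw [h3]
    have h5 := mul_le_mul_of_nonneg_right h1 h4.le
    have h6 := mul_le_mul_of_nonneg_right h2 h4.le
    constructor <;> linarith
  have hreal : ∀ j k, X j k ∈ M.Reals := fun j k =>
    mem_reals_iff.2 fun n i => by
      rw [hseq, hseq]
      obtain ⟨h1, h2⟩ := bounds j k n (n + i) le_self_add
      have h3 : eps (k + (n + n)) ≤ eps n :=
        eps_anti (le_self_add.trans (b := n + n) le_add_self)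
      have h4 := eps_pos n
      rw [abs_sub_lt_iff]
      constructor <;> linarith
  have hval : ∀ j k i, hyp (toRat (P j i) * eps (k + (i + i))) ≤ realVal (X j k) ∧
      realVal (X j k) ≤ hyp ((toRat (P j i) + 1 / 3) * eps (k + (i + i))) := fun j k i =>
    ⟨hyp_le_lim i fun n hn => (hseq j k n).symm ▸ (bounds j k i n hn).1,
      lim_le_hyp i fun n hn => (hseq j k n).symm ▸ (bounds j k i n hn).2⟩
  refine ⟨X, fun j k => ⟨hreal j k, ?_⟩, fun j k c => ?_⟩
  · have h := hval j k 0
    rw [hP0, add_zero, add_zero] at h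
    refine ⟨h.1, h.2.trans (hyp_le.2 ?_)⟩
    linarith [eps_pos k]
  · have h := hval j k (c + 1)
    have h3 : eps (k + (c + 1 + (c + 1))) = eps (k + (c + c)) / 4 := by
      rw [show k + (c + 1 + (c + 1)) = k + (c + c) + 2 by ring, eps_add_two]
    have h4 := eps_pos (k + (c + c))
    by_cases hB : B c
    · rw [hP1 j c hB, h3] at h
      simp only [hB, iff_true]
      rw [digit_iff (hreal j k)]
      refine ⟨P j c, fun n => ?_⟩
      have h5 := del_pos n
      simp only [map_add toRat, map_mul toRat, map_ofNat, map_one toRat] at h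
      have h6 : hyp ((toRat (P j c) + 1 / 4) * eps (k + (c + c))) ≤ realVal (X j k) :=
        le_trans (hyp_le.2 (by linarith)) h.1
      have h7 : realVal (X j k) ≤ hyp ((toRat (P j c) + 1 / 2) * eps (k + (c + c))) :=
        le_trans h.2 (hyp_le.2 (by linarith))
      constructor <;> linarith
    · rw [hP2 j c hB, h3] at h
      simp only [hB, iff_false]
      simp only [map_mul toRat, map_ofNat] at h
      exact not_digit (hreal j k) (N := P j c) (le_trans (hyp_le.2 (by linarith)) h.1)
        (le_trans h.2 (hyp_le.2 (by linarith)))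

end HigherOrderRM.TypeStr

namespace HigherOrderRM.TypeStr

/-! ### Density of grids -/

variable {M : TypeStr.{u}} [Arith M]

theorem const_seqLe_grid_iff {x : M.el .one} (hx : x ∈ M.Reals) (j k : M.el .nat) :
    SeqLe (fun _ => ⟨j, 0, M.pow2 k⟩) (M.seq x) ↔
      ∀ n, hyp (toRat j * eps k) ≤ realVal x + del n := by
  rw [const_seqLe_iff hx (by exact pow2_ne_zero k)]
  simp [Frac.val, eps, div_eq_mul_inv]

theorem not_const_seqLe_grid_iff {x : M.el .one} (hx : x ∈ M.Reals) (j k : M.el .nat) :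
    ¬ SeqLe (fun _ => ⟨j, 0, M.pow2 k⟩) (M.seq x) ↔
      ∃ n, realVal x + del n < hyp (toRat j * eps k) := by
  rw [const_seqLe_grid_iff hx]; push Not; rfl

/-- Every point of the unit interval lies in an interval `[j / 2 ^ k, (j + 1) / 2 ^ k)`. -/
theorem exists_floor {x : M.el .one} (hx : x ∈ M.UnitI) (k : M.el .nat) : ∃ j : M.el .nat,
    SeqLe (fun _ => ⟨j, 0, M.pow2 k⟩) (M.seq x) ∧
      ¬ SeqLe (fun _ => ⟨j + 1, 0, M.pow2 k⟩) (M.seq x) := by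
  have hx' := (mem_unitI_iff hx.1).1 hx
  obtain ⟨j, hj, hmin⟩ := exists_least (M := M)
    (fun j => ¬ SeqLe (fun _ => ⟨j, 0, M.pow2 k⟩) (M.seq x)) ⟨2 * M.pow2 k, by
      rw [not_const_seqLe_grid_iff hx.1]
      refine ⟨2, ?_⟩
      have h1 : toRat (2 * M.pow2 k) * eps k = 2 := by
        rw [map_mul, map_ofNat, mul_assoc, mul_comm (toRat (M.pow2 k)), eps_mul_pow2, mul_one]
      have h2 : del (2 : M.el .nat) = 1 / 4 := by
        rw [← zero_add 2, del_add_two, del, eps_zero, map_one]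
      have h3 := (hx' 2).2
      rw [h1, map_ofNat]
      rw [h2] at *
      linarith⟩
  rcases eq_zero_or_eq_succ j with rfl | ⟨i, rfl⟩
  · refine absurd ?_ hj
    rw [const_seqLe_grid_iff hx.1, map_zero, zero_mul, map_zero]
    exact fun n => (hx' n).1
  · refine ⟨i, ?_, hj⟩
    by_contra hc
    have h1 := hmin i hc
    rw [← toRat_le, map_add, map_one] at h1
    linarith

/-- Points of a grid selected by a decidable condition form a sequence in the model. -/
theorem exists_grid_seq (X : M.el (.fn .nat (.fn .nat .one))) (R : M.el .nat → M.el .nat → Prop)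
    [Dec (M := M) (fun e : (PUnit × M.el .nat) × M.el .nat => R e.1.2 e.2)]
    (hR : ∀ n, ∃ j, R n j) (k : M.el .nat) :
    ∃ s : M.el (.fn .nat .one), ∀ n : M.el .nat, ∃ j, R n j ∧ M.Eqv .one (s n) (X j (k + n)) := by
  obtain ⟨φ, hφ, hφ'⟩ := exists_select (M := M) (C := PUnit × M.el .nat) (fun e j => R e.2 j)
  obtain ⟨s, hs⟩ := IsDef.exists_rep (φ := fun e : PUnit × M.el .nat =>
    M.app (M.app X (φ e)) (k + e.2))
  exact ⟨s, fun n => ⟨φ (⟨⟩, n), (hφ' (⟨⟩, n) (hR n)).1, hs (⟨⟩, n)⟩⟩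

variable {X : M.el (.fn .nat (.fn .nat .one))}

theorem IsGrid.exists_left (hX : IsGrid X) {x : M.el .one} (hx : x ∈ M.UnitI) (h0 : M.RPos x) :
    ∃ s : M.el (.fn .nat .one), ∀ n : M.el .nat, s n ∈ M.UnitI ∧ M.RLt (s n) x ∧
      (∀ i : M.el .nat, i ≤ n → M.Near i (s n) x) ∧ ∃ j k, M.Eqv .one (s n) (X j k) := by
  obtain ⟨k, hk⟩ := (rPos_iff hx.1).1 h0
  have hx' := (mem_unitI_iff hx.1).1 hx
  -- at width `2 ^ (-(k + 2 + n))`, the point `x` is not in the leftmost grid interval; the grid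
  -- point of the interval before that of `x` is within `2 ^ (-n)` of `x`
  have hle : ∀ n, del (k + 2 + n) ≤ del k / 4 ∧ del (k + 2 + n) ≤ del n / 4 := fun n => by
    rw [← del_add_two, ← del_add_two]
    exact ⟨del_anti le_self_add, del_anti (by
      rw [show k + 2 + n = k + (n + 2) by ring]; exact le_add_self)⟩
  obtain ⟨s, hs⟩ := exists_grid_seq X (fun n j =>
    SeqLe (fun _ => ⟨j + 1, 0, M.pow2 (k + 2 + n)⟩) (M.seq x) ∧
      ¬ SeqLe (fun _ => ⟨j + 1 + 1, 0, M.pow2 (k + 2 + n)⟩) (M.seq x)) (fun n => by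
    obtain ⟨j, hj, hj'⟩ := exists_floor hx (k + 2 + n)
    rcases eq_zero_or_eq_succ j with rfl | ⟨i, rfl⟩
    · obtain ⟨m, hm⟩ := (not_const_seqLe_grid_iff hx.1 _ _).1 hj'
      rw [zero_add, map_one, one_mul, show hyp (eps (k + 2 + n)) = del (k + 2 + n) from rfl] at hm
      linarith [(hle n).1, del_pos m, del_pos k]
    · exact ⟨i, hj, hj'⟩) (k + 2)
  refine ⟨s, fun n => ?_⟩
  obtain ⟨j, ⟨h1, h2⟩, hsn⟩ := hs n
  obtain ⟨hr, h3, h4⟩ := hX j (k + 2 + n)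
  have hr' := (mem_reals_congr hsn).2 hr
  rw [← realVal_congr hsn] at h3 h4
  rw [const_seqLe_grid_iff hx.1] at h1
  obtain ⟨m, h2⟩ := (not_const_seqLe_grid_iff hx.1 _ _).1 h2
  have hpos : (0 : M.Hyper) ≤ hyp (toRat j * eps (k + 2 + n)) := by
    rw [← map_zero hyp, hyp_le]
    exact mul_nonneg (toRat_nonneg j) (eps_pos _).le
  simp only [map_add, map_mul, map_one, map_ofNat, map_div₀,
    show hyp (eps (k + 2 + n)) = del (k + 2 + n) from rfl] at h1 h2 h3 h4 hpos
  have hd := del_pos (k + 2 + n)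
  have hm := del_pos m
  refine ⟨(mem_unitI_iff hr').2 fun i => ?_, (rLt_iff hr' hx.1).2 ⟨k + 2 + n + 2, ?_⟩,
    fun i hi => (near_iff hr' hx.1 i).2 ⟨i + 2, ?_⟩, j, _, hsn⟩
  · have h5 := h1 (k + 2 + n + 2)
    have h6 := (hx' i).2
    have h7 := del_pos i
    rw [del_add_two] at h5
    constructor <;> linarith
  · have h5 := h1 (k + 2 + n + 2 + 2)
    simp only [del_add_two] at h5 ⊢
    linarith
  · have h5 := h1 (k + 2 + n + 2)
    have h6 := (hle n).2
    have h7 := del_anti hi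
    rw [del_add_two] at h5 ⊢
    constructor <;> linarith

theorem IsGrid.exists_right (hX : IsGrid X) {x : M.el .one} (hx : x ∈ M.UnitI)
    (h0 : M.RLtOne x) :
    ∃ s : M.el (.fn .nat .one), ∀ n : M.el .nat, s n ∈ M.UnitI ∧ M.RLt x (s n) ∧
      (∀ i : M.el .nat, i ≤ n → M.Near i (s n) x) ∧ ∃ j k, M.Eqv .one (s n) (X j k) := by
  obtain ⟨k, hk⟩ := (rLtOne_iff hx.1).1 h0
  -- at width `2 ^ (-(k + 2 + n))`, the grid point of the interval after that of `x` is below `1`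
  have hle : ∀ n, del (k + 2 + n) ≤ del k / 4 ∧ del (k + 2 + n) ≤ del n / 4 := fun n => by
    rw [← del_add_two, ← del_add_two]
    exact ⟨del_anti le_self_add, del_anti (by
      rw [show k + 2 + n = k + (n + 2) by ring]; exact le_add_self)⟩
  obtain ⟨s, hs⟩ := exists_grid_seq X (fun n j => ∃ i, j = i + 1 ∧
    SeqLe (fun _ => ⟨i, 0, M.pow2 (k + 2 + n)⟩) (M.seq x) ∧
      ¬ SeqLe (fun _ => ⟨i + 1, 0, M.pow2 (k + 2 + n)⟩) (M.seq x)) (fun n => by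
    obtain ⟨i, hi⟩ := exists_floor hx (k + 2 + n)
    exact ⟨i + 1, i, rfl, hi⟩) (k + 2)
  refine ⟨s, fun n => ?_⟩
  obtain ⟨_, ⟨j, rfl, h1, h2⟩, hsn⟩ := hs n
  obtain ⟨hr, h3, h4⟩ := hX (j + 1) (k + 2 + n)
  have hr' := (mem_reals_congr hsn).2 hr
  rw [← realVal_congr hsn] at h3 h4
  rw [const_seqLe_grid_iff hx.1] at h1
  obtain ⟨m, h2⟩ := (not_const_seqLe_grid_iff hx.1 _ _).1 h2
  have hpos : (0 : M.Hyper) ≤ hyp (toRat j * eps (k + 2 + n)) := by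
    rw [← map_zero hyp, hyp_le]
    exact mul_nonneg (toRat_nonneg j) (eps_pos _).le
  simp only [map_add, map_mul, map_one, map_ofNat, map_div₀,
    show hyp (eps (k + 2 + n)) = del (k + 2 + n) from rfl] at h1 h2 h3 h4 hpos
  have hd := del_pos (k + 2 + n)
  have hm := del_pos m
  have hkn := hle n
  refine ⟨(mem_unitI_iff hr').2 fun i => ?_, (rLt_iff hx.1 hr').2 ⟨m, by linarith⟩,
    fun i hi => (near_iff hr' hx.1 i).2 ⟨i + 2, ?_⟩, j + 1, _, hsn⟩
  · have h5 := h1 (k + 2 + n + 2)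
    have h7 := del_pos i
    rw [del_add_two] at h5
    constructor <;> linarith
  · have h5 := h1 (k + 2 + n + 2)
    have h7 := del_anti hi
    rw [del_add_two] at h5 ⊢
    constructor <;> linarith

theorem rPos_or_rLtOne {x : M.el .one} (hx : x ∈ M.UnitI) : M.RPos x ∨ M.RLtOne x := by
  by_contra! hc
  rw [rPos_iff hx.1, rLtOne_iff hx.1] at hc
  push Not at hc
  have h1 := hc.1 2
  have h2 := hc.2 2
  have h3 : del (2 : M.el .nat) = 1 / 4 := by
    rw [← zero_add 2, del_add_two, del, eps_zero, map_one]
  rw [h3] at h1 h2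
  linarith

theorem IsGrid.exists_near (hX : IsGrid X) {x : M.el .one} (hx : x ∈ M.UnitI) (i : M.el .nat) :
    ∃ z ∈ M.UnitI, M.Near i z x ∧ ∃ j k, M.Eqv .one z (X j k) := by
  rcases rPos_or_rLtOne hx with h | h
  · obtain ⟨s, hs⟩ := hX.exists_left hx h
    exact ⟨s i, (hs i).1, (hs i).2.2.1 i le_rfl, (hs i).2.2.2⟩
  · obtain ⟨s, hs⟩ := hX.exists_right hx h
    exact ⟨s i, (hs i).1, (hs i).2.2.1 i le_rfl, (hs i).2.2.2⟩

end HigherOrderRM.TypeStr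

namespace HigherOrderRM.TypeStr

/-! ### Functions with two densely taken values -/

variable {M : TypeStr.{u}} [Arith M]

section congruence

variable {x y x' y' : M.el .one}

theorem near_symm (hx : x ∈ M.Reals) (hy : y ∈ M.Reals) {k : M.Nt} (h : M.Near k x y) :
    M.Near k y x := by
  rw [near_iff hx hy] at h
  rw [near_iff hy hx]
  exact h.imp fun n hn => hn.symm

theorem near_of_eqv (hx : x ∈ M.Reals) (h : M.Eqv .one x y) (k : M.Nt) : M.Near k x y := by
  have := near_refl hx k
  rw [near_iff hx hx] at this
  rwa [near_iff hx ((mem_reals_congr h).1 hx), ← realVal_congr h]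

theorem rEq_of_eqv (hx : x ∈ M.Reals) (h : M.Eqv .one x y) : M.REq x y := by
  rw [rEq_iff hx ((mem_reals_congr h).1 hx), ← realVal_congr h, ← rEq_iff hx hx]
  exact rEq_refl hx

theorem rEq_symm (hx : x ∈ M.Reals) (hy : y ∈ M.Reals) (h : M.REq x y) : M.REq y x := by
  rw [rEq_iff hx hy] at h
  rw [rEq_iff hy hx]
  exact fun n => (h n).symm

theorem rLt_congr (hx : x ∈ M.Reals) (hy : y ∈ M.Reals) (hx' : x' ∈ M.Reals)
    (hy' : y' ∈ M.Reals) (h : M.REq x x') (h' : M.REq y y') (hlt : M.RLt x y) : M.RLt x' y' := by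
  rw [rEq_iff hx hx'] at h
  rw [rEq_iff hy hy'] at h'
  rw [rLt_iff hx hy] at hlt
  rw [rLt_iff hx' hy']
  obtain ⟨n, hn⟩ := hlt
  refine ⟨n + 2, ?_⟩
  have h1 := (h (n + 2)).2
  have h2 := (h' (n + 2)).1
  rw [del_add_two] at *
  linarith [del_pos n]

theorem rLt_trans {z : M.el .one} (hx : x ∈ M.Reals) (hy : y ∈ M.Reals) (hz : z ∈ M.Reals)
    (h : M.RLt x y) (h' : M.RLt y z) : M.RLt x z := by
  rw [rLt_iff hx hy] at h
  rw [rLt_iff hy hz] at h'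
  rw [rLt_iff hx hz]
  obtain ⟨n, hn⟩ := h
  obtain ⟨m, hm⟩ := h'
  exact ⟨n, by linarith [del_pos m]⟩

end congruence

/-- A function that takes only the values `0` and `1`, with the codes `c₀` and `c₁`, such that each
value that is taken on the unit interval is taken on a whole grid, and `0` is taken in any case.
So it is constantly `0`, or the characteristic function of a dense set with a dense complement. -/
structure IsSplit (c₀ c₁ : M.Nt) (f : M.el .realFn) : Prop where
  zero : realVal (constReal c₀) = 0
  one : realVal (constReal c₁) = 1
  values : ∀ x, M.Eqv .one (f x) (constReal c₀) ∨ M.Eqv .one (f x) (constReal c₁)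
  congr : ∀ x ∈ M.Reals, ∀ y ∈ M.Reals, M.REq x y → M.Eqv .one (f x) (f y)
  grid : ∀ x ∈ M.UnitI, ∃ X, IsGrid X ∧ ∀ j k : M.el .nat, M.Eqv .one (f (X j k)) (f x)
  zeroGrid : ∃ X, IsGrid X ∧ ∀ j k : M.el .nat, M.Eqv .one (f (X j k)) (constReal c₀)

namespace IsSplit

variable {c₀ c₁ : M.Nt} {f : M.el .realFn}

theorem mem_reals (hf : IsSplit c₀ c₁ f) (x : M.el .one) : M.app f x ∈ M.Reals := by
  rcases hf.values x with h | h
  · exact (mem_reals_congr h).2 (constReal_mem _)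
  · exact (mem_reals_congr h).2 (constReal_mem _)

theorem isFunOn (hf : IsSplit c₀ c₁ f) : M.IsFunOn M.UnitI f :=
  ⟨fun x _ => hf.mem_reals x, fun x hx y hy h =>
    rEq_of_eqv (hf.mem_reals x) (hf.congr x (unitI_subset hx) y (unitI_subset hy) h)⟩

theorem realVal_eq (hf : IsSplit c₀ c₁ f) (x : M.el .one) :
    realVal (f x) = 0 ∨ realVal (f x) = 1 :=
  (hf.values x).imp (fun h => (realVal_congr h).trans hf.zero)
    (fun h => (realVal_congr h).trans hf.one)

theorem young (hf : IsSplit c₀ c₁ f) : M.Young f := by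
  intro x hx
  obtain ⟨X, hX, hfX⟩ := hf.grid x hx
  have hval : ∀ z, (∃ j k, M.Eqv .one z (X j k)) → M.Eqv .one (f z) (f x) := by
    rintro z ⟨j, k, h⟩
    exact ((Eqv.refl _ f).app h).trans (hfX j k)
  constructor <;> intro h0
  · obtain ⟨s, hs⟩ := hX.exists_left hx h0
    exact ⟨s, fun n => ⟨(hs n).1, (hs n).2.1⟩, fun k => ⟨k, fun n hn => (hs n).2.2.1 k hn⟩,
      fun k => ⟨k, fun n _ => near_of_eqv (hf.mem_reals _) (hval _ (hs n).2.2.2) k⟩⟩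
  · obtain ⟨s, hs⟩ := hX.exists_right hx h0
    exact ⟨s, fun n => ⟨(hs n).1, (hs n).2.1⟩, fun k => ⟨k, fun n hn => (hs n).2.2.1 k hn⟩,
      fun k => ⟨k, fun n _ => near_of_eqv (hf.mem_reals _) (hval _ (hs n).2.2.2) k⟩⟩

/-- A set that contains all points at which `f` takes a certain value is dense. -/
theorem mem_int_cl (hf : IsSplit c₀ c₁ f) {x : M.el .one} (hx : x ∈ M.UnitI)
    {S : Set (M.el .one)} (hS : ∀ z ∈ M.UnitI, M.Eqv .one (f z) (f x) → z ∈ S) :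
    x ∈ M.intIn M.UnitI (M.clIn M.UnitI S) := by
  obtain ⟨X, hX, hfX⟩ := hf.grid x hx
  refine ⟨hx, M.zero, fun y hy _ => ⟨hy, fun k => ?_⟩⟩
  obtain ⟨z, hz, hzy, i, j, hij⟩ := hX.exists_near hy k
  exact ⟨z, ⟨hz, hS z hz (((Eqv.refl _ f).app hij).trans (hfX i j))⟩,
    near_symm (unitI_subset hz) (unitI_subset hy) hzy⟩

theorem mem_setOf (hf : IsSplit c₀ c₁ f) {G : M.el .two} {x z : M.el .one}
    (h : M.Eqv .one (f z) (f x)) (hx : M.app f x ∈ M.setOf G) : M.app f z ∈ M.setOf G :=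
  ⟨hf.mem_reals z, (((Eqv.refl _ G).app h : M.app G (f z) = M.app G (f x))).trans hx.2⟩

theorem husainAlmostCont (hf : IsSplit c₀ c₁ f) : M.HusainAlmostCont f :=
  fun _ hx _ _ _ hfx => hf.mem_int_cl hx fun _ hz h => ⟨hz, hf.mem_setOf h hfx⟩

theorem preCont (hf : IsSplit c₀ c₁ f) : M.PreCont f :=
  fun _ _ _ _ hx => hf.mem_int_cl hx.1 fun _ hz h => ⟨hz, hf.mem_setOf h hx.2.2⟩

theorem cCont (hf : IsSplit c₀ c₁ f) : M.CCont f := by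
  intro G hG _
  obtain ⟨A, hA⟩ := exists_object (M := M) (fun x : M.el .one => G (f x))
  have hA' : ∀ x, M.app A x = G (f x) := hA
  have hO : ∀ x, M.app (M.combK .nat .one M.one) x = M.one :=
    fun x => Model.axioms.combK_eq .nat .one M.one x
  -- the inverse image itself is pre-open, and the open set is the whole line
  refine ⟨M.combK .nat .one M.one, A, ⟨fun x _ => Or.inr (hO x), fun x _ y _ _ => ?_⟩,
    ⟨fun x _ => ?_, fun x hx y hy h => ?_⟩, fun x hx => ⟨hx.1, M.zero, fun y hy _ => ?_⟩,
    fun x hx => hf.mem_int_cl hx.1 fun z hz h => ?_, ?_⟩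
  · rw [hO, hO]
  · rw [hA']; exact hG.1 _ (hf.mem_reals x)
  · rw [hA', hA']; exact (Eqv.refl _ G).app (hf.congr x hx y hy h)
  · exact ⟨unitI_subset hy, hO y⟩
  · refine ⟨unitI_subset hz, ?_⟩
    have h1 := hx.2.2
    rw [hA'] at h1 ⊢
    exact (((Eqv.refl _ G).app h : M.app G (f z) = M.app G (f x))).trans h1
  · ext x
    constructor
    · rintro ⟨hx, -, -, h⟩
      exact ⟨hx, ⟨unitI_subset hx, hO x⟩, unitI_subset hx, (hA' x).trans h⟩
    · rintro ⟨hx, -, -, h⟩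
      exact ⟨hx, hx, hf.mem_reals x, (hA' x).symm.trans h⟩

theorem graphCont (hf : IsSplit c₀ c₁ f) : M.GraphCont f := by
  have hg : ∀ x, M.Eqv .one (M.combK .one .one (constReal c₀) x) (constReal c₀) :=
    fun x => Model.axioms.combK_eq .one .one _ x
  have hg' : ∀ x, M.app (M.combK .one .one (constReal c₀)) x ∈ M.Reals :=
    fun x => (mem_reals_congr (hg x)).2 (constReal_mem _)
  have hgg : ∀ x y, M.Eqv .one (M.combK .one .one (constReal c₀) x)
    (M.combK .one .one (constReal c₀) y) := fun x y => (hg x).trans (hg y).symm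
  obtain ⟨X, hX, hfX⟩ := hf.zeroGrid
  refine ⟨M.combK .one .one (constReal c₀), ⟨fun x _ => hg' x, fun x _ y _ _ =>
    rEq_of_eqv (hg' x) (hgg x y)⟩, fun x _ k => ⟨M.zero, fun y _ _ =>
    near_of_eqv (hg' x) (hgg x y) k⟩, fun x hx k => ?_⟩
  obtain ⟨z, hz, hzx, i, j, hij⟩ := hX.exists_near hx k
  exact ⟨z, hz, near_symm (unitI_subset hz) (unitI_subset hx) hzx, near_of_eqv (hg' x)
    ((hg x).trans (((Eqv.refl _ f).app hij).trans (hfX i j)).symm) k⟩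

theorem not_cesaroType (hf : IsSplit c₀ c₁ f) : ¬ M.CesaroType f := by
  rintro ⟨U, V, -, -, -, hVo, ⟨u, hu⟩, ⟨v, hv⟩, -, hUV⟩
  obtain ⟨z, ⟨-, hz, hzv⟩, -⟩ := (hUV v hv hu).2 M.zero
  obtain ⟨-, k, hk⟩ := hVo ⟨hv.1, hv⟩
  have hfz := hf.mem_reals z
  -- near the value `f z` in `V`, the number `f z + 2 ^ (-(k + 1))` is in `V` but not a value of `f`
  obtain ⟨q, hq, hqv⟩ : ∃ q : Frac M, q.den ≠ 0 ∧ hyp q.val = realVal (f z) := by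
    rcases hf.realVal_eq z with h | h
    · exact ⟨_, fracZero_den, by rw [fracZero_val, map_zero, h]⟩
    · exact ⟨_, fracOne_den, by rw [fracOne_val, map_one, h]⟩
  obtain ⟨c, hc⟩ := exists_constReal (Frac.add_den hq (inv2_den (k + 1)))
  rw [Frac.val_add hq (inv2_den _), inv2_val, map_add, hqv,
    show hyp (eps (k + 1)) = del (k + 1) from rfl] at hc
  have hmem : constReal c ∈ M.setOf V := by
    refine hk _ (constReal_mem c) ((near_iff hv.1 (constReal_mem c) k).2 ⟨k + 2, ?_⟩)
    have h1 := (rEq_iff hfz hv.1).1 hzv (k + 1 + 2)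
    rw [hc]
    simp only [del_add_two, del_add_one] at h1 ⊢
    constructor <;> linarith [del_pos k]
  obtain ⟨w, ⟨-, hw, hwc⟩, -⟩ := (hUV _ hmem hu).2 M.zero
  have h1 := (rEq_iff (hf.mem_reals w) (constReal_mem c)).1 hwc (k + 2)
  rw [hc, del_add_one, del_add_two] at h1
  have h2 := del_pos k
  have h3 : del k ≤ 1 := by rw [← map_one hyp]; exact hyp_le.2 (eps_le_one k)
  rcases hf.realVal_eq z with h | h <;> rcases hf.realVal_eq w with h' | h' <;>
    rw [h, h'] at h1 <;> linarith [h1.1, h1.2]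

/-- There is a point `p` with `a < p < x` that is outside of the unit interval or where `f` has the
value `f x`. -/
theorem exists_left_end (hf : IsSplit c₀ c₁ f) {x a : M.el .one} (hx : x ∈ M.UnitI)
    (ha : a ∈ M.Reals) (hax : M.RLt a x) : ∃ p ∈ M.Reals, M.RLt a p ∧ M.RLt p x ∧
      ∀ z ∈ M.UnitI, M.REq z p → M.Eqv .one (f z) (f x) := by
  obtain ⟨m, hm⟩ := (rLt_iff ha hx.1).1 hax
  by_cases h0 : M.RPos x
  · obtain ⟨X, hX, hfX⟩ := hf.grid x hx
    obtain ⟨s, hs⟩ := hX.exists_left hx h0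
    obtain ⟨h1, h2, h3, i, j, hij⟩ := hs m
    obtain ⟨n, hn⟩ := (near_iff h1.1 hx.1 m).1 (h3 m le_rfl)
    refine ⟨s m, h1.1, (rLt_iff ha h1.1).2 ⟨n, by linarith⟩, h2, fun z hz hzp => ?_⟩
    exact (hf.congr z hz.1 _ h1.1 hzp).trans (((Eqv.refl _ f).app hij).trans (hfX i j))
  · rw [rPos_iff hx.1] at h0
    push Not at h0
    have hx' := (mem_unitI_iff hx.1).1 hx
    -- here `x` is `0`, and the negative number `-2 ^ (-(m + 1))` is a left end-point
    obtain ⟨c, hc⟩ := exists_constReal (M := M) (q := ⟨0, 1, M.pow2 (m + 1)⟩) (pow2_ne_zero _)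
    have hp : realVal (constReal c) = - (del m / 2) := by
      rw [hc, ← del_add_one, del, ← map_neg]
      congr 1
      simp [Frac.val, eps, neg_div]
    have hd := del_pos m
    refine ⟨constReal c, constReal_mem c, (rLt_iff ha (constReal_mem c)).2 ⟨m + 2, ?_⟩,
      (rLt_iff (constReal_mem c) hx.1).2 ⟨m + 2, ?_⟩, fun z hz hzp => ?_⟩
    · have := h0 (m + 2)
      rw [hp]
      rw [del_add_two] at *
      linarith
    · have := (hx' (m + 2 + 2)).1
      rw [hp]
      simp only [del_add_two] at *
      linarith
    · exfalso
      have h1 := ((rEq_iff hz.1 (constReal_mem c)).1 hzp (m + 2 + 2)).1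
      have h2 := ((mem_unitI_iff hz.1).1 hz (m + 2 + 2)).1
      rw [hp] at h1
      simp only [del_add_two] at *
      linarith

/-- There is a point `q` with `x < q < b` that is outside of the unit interval or where `f` has the
value `f x`. -/
theorem exists_right_end (hf : IsSplit c₀ c₁ f) {x b : M.el .one} (hx : x ∈ M.UnitI)
    (hb : b ∈ M.Reals) (hxb : M.RLt x b) : ∃ q ∈ M.Reals, M.RLt x q ∧ M.RLt q b ∧
      ∀ z ∈ M.UnitI, M.REq z q → M.Eqv .one (f z) (f x) := by
  obtain ⟨m, hm⟩ := (rLt_iff hx.1 hb).1 hxb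
  by_cases h0 : M.RLtOne x
  · obtain ⟨X, hX, hfX⟩ := hf.grid x hx
    obtain ⟨s, hs⟩ := hX.exists_right hx h0
    obtain ⟨h1, h2, h3, i, j, hij⟩ := hs m
    obtain ⟨n, hn⟩ := (near_iff h1.1 hx.1 m).1 (h3 m le_rfl)
    refine ⟨s m, h1.1, h2, (rLt_iff h1.1 hb).2 ⟨n, by linarith⟩, fun z hz hzp => ?_⟩
    exact (hf.congr z hz.1 _ h1.1 hzp).trans (((Eqv.refl _ f).app hij).trans (hfX i j))
  · rw [rLtOne_iff hx.1] at h0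
    push Not at h0
    have hx' := (mem_unitI_iff hx.1).1 hx
    -- here `x` is `1`, and `1 + 2 ^ (-(m + 1))` is a right end-point
    obtain ⟨c, hc⟩ := exists_constReal (M := M) (Frac.add_den fracOne_den (inv2_den (m + 1)))
    have hp : realVal (constReal c) = 1 + del m / 2 := by
      rw [hc, Frac.val_add fracOne_den (inv2_den _), inv2_val, fracOne_val, map_add, map_one,
        ← del_add_one, del]
    have hd := del_pos m
    refine ⟨constReal c, constReal_mem c, (rLt_iff hx.1 (constReal_mem c)).2 ⟨m + 2, ?_⟩,
      (rLt_iff (constReal_mem c) hb).2 ⟨m + 2, ?_⟩, fun z hz hzp => ?_⟩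
    · have := (hx' (m + 2 + 2)).2
      rw [hp]
      simp only [del_add_two] at *
      linarith
    · have := h0 (m + 2)
      rw [hp]
      rw [del_add_two] at *
      linarith
    · exfalso
      have h1 := ((rEq_iff hz.1 (constReal_mem c)).1 hzp (m + 2 + 2)).2
      have h2 := ((mem_unitI_iff hz.1).1 hz (m + 2 + 2)).2
      rw [hp] at h1
      simp only [del_add_two] at *
      linarith

end IsSplit

/-- Open intervals exist as objects. -/
theorem exists_interval {p q : M.el .one} (hp : p ∈ M.Reals) (hq : q ∈ M.Reals) :
    ∃ W : M.el .two, M.IsCharFun W ∧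
      ∀ z, z ∈ M.setOf W ↔ z ∈ M.Reals ∧ M.RLt p z ∧ M.RLt z q := by
  obtain ⟨φ, hφ, hφ'⟩ := exists_ite (M := M)
    (fun e : PUnit × M.el .one => M.RLt p e.2 ∧ M.RLt e.2 q) 1 0
  obtain ⟨W, hW⟩ := exists_object (fun z => φ (⟨⟩, z)) (h := hφ)
  have h1 : ∀ z, (M.RLt p z ∧ M.RLt z q) → M.app W z = 1 :=
    fun z h => (hW z).trans ((hφ' (⟨⟩, z)).1 h)
  have h0 : ∀ z, ¬ (M.RLt p z ∧ M.RLt z q) → M.app W z = 0 :=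
    fun z h => (hW z).trans ((hφ' (⟨⟩, z)).2 h)
  refine ⟨W, ⟨fun z _ => ?_, fun x hx y hy hxy => ?_⟩, fun z => ?_⟩
  · by_cases h : M.RLt p z ∧ M.RLt z q
    · exact Or.inr (h1 z h)
    · exact Or.inl (h0 z h)
  · have hxy' := rEq_symm hx hy hxy
    by_cases h : M.RLt p x ∧ M.RLt x q
    · rw [h1 x h, h1 y ⟨rLt_congr hp hx hp hy (rEq_refl hp) hxy h.1,
        rLt_congr hx hq hy hq hxy (rEq_refl hq) h.2⟩]
    · rw [h0 x h, h0 y fun h' => h ⟨rLt_congr hp hy hp hx (rEq_refl hp) hxy' h'.1,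
        rLt_congr hy hq hx hq hxy' (rEq_refl hq) h'.2⟩]
  · refine and_congr_right fun _ => ⟨fun h => ?_, fun h => h1 z h⟩
    by_contra hc
    rw [h0 z hc] at h
    exact zero_ne_one (α := M.el .nat) h

/-- A neighbourhood of a point of an open interval is contained in it. -/
theorem exists_near_subset {p q z : M.el .one} (hp : p ∈ M.Reals) (hq : q ∈ M.Reals)
    (hz : z ∈ M.Reals) (h1 : M.RLt p z) (h2 : M.RLt z q) :
    ∃ k, ∀ y ∈ M.Reals, M.Near k z y → M.RLt p y ∧ M.RLt y q := by
  obtain ⟨m, hm⟩ := (rLt_iff hp hz).1 h1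
  obtain ⟨n, hn⟩ := (rLt_iff hz hq).1 h2
  refine ⟨m + n, fun y hy hzy => ?_⟩
  obtain ⟨i, hi⟩ := (near_iff hz hy _).1 hzy
  have h3 : del (m + n) ≤ del m := del_anti le_self_add
  have h4 : del (m + n) ≤ del n := del_anti le_add_self
  exact ⟨(rLt_iff hp hy).2 ⟨i, by linarith⟩, (rLt_iff hy hq).2 ⟨i, by linarith⟩⟩

theorem rLe_of_forall_near {y : M.el .one} {z : M.el .one} (hy : y ∈ M.Reals) (hz : z ∈ M.Reals)
    (h : ∀ k, ∃ w ∈ M.Reals, M.Near k z w ∧ M.RLe w y) : M.RLe z y := by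
  rw [rLe_iff hz hy]
  intro n
  obtain ⟨w, hw, h1, h2⟩ := h (n + 1)
  obtain ⟨i, hi⟩ := (near_iff hz hw _).1 h1
  have h3 := (rLe_iff hw hy).1 h2 (n + 1)
  rw [del_add_one] at *
  linarith [del_pos i]

theorem rLe_of_forall_near' {y : M.el .one} {z : M.el .one} (hy : y ∈ M.Reals) (hz : z ∈ M.Reals)
    (h : ∀ k, ∃ w ∈ M.Reals, M.Near k z w ∧ M.RLe y w) : M.RLe y z := by
  rw [rLe_iff hy hz]
  intro n
  obtain ⟨w, hw, h1, h2⟩ := h (n + 1)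
  obtain ⟨i, hi⟩ := (near_iff hz hw _).1 h1
  have h3 := (rLe_iff hy hw).1 h2 (n + 1)
  rw [del_add_one] at *
  linarith [del_pos i]

theorem rLe_of_rLt {x y : M.el .one} (hx : x ∈ M.Reals) (hy : y ∈ M.Reals) (h : M.RLt x y) :
    M.RLe x y := by
  obtain ⟨n, hn⟩ := (rLt_iff hx hy).1 h
  exact (rLe_iff hx hy).2 fun m => by linarith [del_pos n, del_pos m]

theorem rEq_of_rLe {x y : M.el .one} (hx : x ∈ M.Reals) (hy : y ∈ M.Reals) (h : M.RLe x y)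
    (h' : M.RLe y x) : M.REq x y :=
  (rEq_iff hx hy).2 fun n => ⟨(rLe_iff hx hy).1 h n, (rLe_iff hy hx).1 h' n⟩

/-- A boundary point of an open interval is one of its end-points. -/
theorem rEq_or_rEq_of_mem_bdIn {p q z : M.el .one} (hp : p ∈ M.Reals) (hq : q ∈ M.Reals)
    {S : Set (M.el .one)} (hS : ∀ z, z ∈ S ↔ z ∈ M.Reals ∧ M.RLt p z ∧ M.RLt z q)
    (h : z ∈ M.bdIn M.UnitI S) : M.REq z p ∨ M.REq z q := by
  obtain ⟨⟨hz, hcl⟩, -, hcl'⟩ := h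
  have hpz : M.RLe p z := rLe_of_forall_near' hp hz.1 fun k => by
    obtain ⟨w, ⟨hw, hwS⟩, hzw⟩ := hcl k
    exact ⟨w, hw.1, hzw, rLe_of_rLt hp hw.1 ((hS w).1 hwS).2.1⟩
  have hzq : M.RLe z q := rLe_of_forall_near hq hz.1 fun k => by
    obtain ⟨w, ⟨hw, hwS⟩, hzw⟩ := hcl k
    exact ⟨w, hw.1, hzw, rLe_of_rLt hw.1 hq ((hS w).1 hwS).2.2⟩
  by_cases h1 : M.RLt p z
  · by_cases h2 : M.RLt z q
    · obtain ⟨k, hk⟩ := exists_near_subset hp hq hz.1 h1 h2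
      obtain ⟨w, ⟨hw, hwS⟩, hzw⟩ := hcl' k
      exact absurd ((hS w).2 ⟨hw.1, hk w hw.1 hzw⟩) hwS
    · exact Or.inr (rEq_of_rLe hz.1 hq hzq (not_not.1 h2))
  · exact Or.inl (rEq_of_rLe hz.1 hp (not_not.1 h1) hpz)

theorem IsSplit.periphCont {c₀ c₁ : M.Nt} {f : M.el .realFn} (hf : IsSplit c₀ c₁ f) :
    M.PeriphCont f := by
  intro x hx a ha b hb c hc d hd hax hxb hcx hxd
  obtain ⟨p, hp, hap, hpx, hfp⟩ := hf.exists_left_end hx ha hax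
  obtain ⟨q, hq, hxq, hqb, hfq⟩ := hf.exists_right_end hx hb hxb
  obtain ⟨W, hW, hW'⟩ := exists_interval hp hq
  refine ⟨W, hW, fun y hy => ?_, (hW' x).2 ⟨hx.1, hpx, hxq⟩, fun y hy => ?_, fun z hz => ?_⟩
  · obtain ⟨hyr, h1, h2⟩ := (hW' y).1 hy.2
    obtain ⟨k, hk⟩ := exists_near_subset hp hq hyr h1 h2
    exact ⟨hy.1, k, fun w hw hyw => (hW' w).2 ⟨hw.1, hk w hw.1 hyw⟩⟩
  · obtain ⟨hyr, h1, h2⟩ := (hW' y).1 hy.2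
    exact ⟨rLt_trans ha hp hyr hap h1, rLt_trans hyr hq hb h2 hqb⟩
  · have hfz : M.Eqv .one (f z) (f x) :=
      (rEq_or_rEq_of_mem_bdIn hp hq hW' hz).elim (hfp z hz.1.1) (hfq z hz.1.1)
    have h := rEq_of_eqv (hf.mem_reals x) hfz.symm
    exact ⟨rLt_congr hc (hf.mem_reals x) hc (hf.mem_reals z) (rEq_refl hc) h hcx,
      rLt_congr (hf.mem_reals x) hd (hf.mem_reals z) hd h (rEq_refl hd) hxd⟩

theorem IsSplit.mem_class {c₀ c₁ : M.Nt} {f : M.el .realFn} (hf : IsSplit c₀ c₁ f) :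
    ∀ Γ : WeakCont, Γ.Class M f
  | .young => hf.young
  | .husainAlmostContinuous => hf.husainAlmostCont
  | .graphContinuous => hf.graphCont
  | .notOfCesaroType => hf.not_cesaroType
  | .peripherallyContinuous => hf.periphCont
  | .preContinuous => hf.preCont
  | .cContinuous => hf.cCont

end HigherOrderRM.TypeStr

namespace HigherOrderRM.TypeStr

/-! ### The functions that code the zeros of a functional -/

variable {M : TypeStr.{u}} [Arith M]

/-- The digits of `x` from the position `k` on allow the value `m` at `n` for the coded function. -/
def CodesValue (x : M.el .one) (k n m : M.el .nat) : Prop :=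
  ∃ c, M.IsPair c n m ∧ Digit x (k + (c + c))

instance Dec.codesValue {C : Type u} [Context M C] (φ : C → M.el .one) (ψ χ θ : C → M.el .nat)
    [IsDef φ] [IsDef ψ] [IsDef χ] [IsDef θ] :
    Dec (M := M) (fun e => CodesValue (φ e) (ψ e) (χ e) (θ e)) := by
  unfold CodesValue; infer_instance

/-- The object `D` decodes a function from the digits of a real from a given position on. -/
def IsDecoder (D : M.el (.fn .one (.fn .nat .one))) : Prop :=
  ∀ (x : M.el .one) (k n : M.el .nat), (∃ m, CodesValue x k n m) →
    CodesValue x k n (D x k n) ∧ ∀ m, CodesValue x k n m → D x k n ≤ m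

theorem exists_decoder : ∃ D : M.el (.fn .one (.fn .nat .one)), IsDecoder D := by
  obtain ⟨φ, hφ, hφ'⟩ := exists_select (M := M) (C := ((PUnit × M.el .one) × M.el .nat) × M.el .nat)
    (fun e m => CodesValue e.1.1.2 e.1.2 e.2 m)
  obtain ⟨D, hD⟩ := exists_object₃ (fun x k n => φ (((⟨⟩, x), k), n)) (h := hφ)
  refine ⟨D, fun x k n h => ?_⟩
  rw [show M.app (M.app (M.app D x) k) n = φ (((⟨⟩, x), k), n) from hD x k n]
  exact hφ' (((⟨⟩, x), k), n) h

/-- The digits of `x` from some position on code a zero of `Y`. -/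
def CodesZero (D : M.el (.fn .one (.fn .nat .one))) (Y : M.el .two) (x : M.el .one) : Prop :=
  ∃ k : M.el .nat, (∀ n, ∃ m, CodesValue x k n m) ∧ Y (D x k) = 0

variable {D : M.el (.fn .one (.fn .nat .one))} {Y : M.el .two}

theorem CodesZero.congr (hD : IsDecoder D) {x y : M.el .one} (hx : x ∈ M.Reals) (hy : y ∈ M.Reals)
    (h : M.REq x y) (hc : CodesZero D Y x) : CodesZero D Y y := by
  have hiff : ∀ k n m, CodesValue x k n m ↔ CodesValue y k n m := fun k n m =>
    exists_congr fun c => and_congr_right fun _ =>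
      ⟨Digit.congr hx hy h, Digit.congr hy hx (rEq_symm hx hy h)⟩
  obtain ⟨k, hk, hY⟩ := hc
  have heq : M.Eqv .one (D x k) (D y k) := fun n => by
    have h1 := hD x k n (hk n)
    have h2 := hD y k n ((hk n).imp fun m => (hiff k n m).1)
    exact le_antisymm (h1.2 _ ((hiff k n _).2 h2.1)) (h2.2 _ ((hiff k n _).1 h1.1))
  exact ⟨k, fun n => (hk n).imp fun m => (hiff k n m).1,
    ((((Eqv.refl _ Y).app heq : M.app Y (D x k) = M.app Y (D y k))).symm.trans hY)⟩

/-- Every zero of `Y` is coded on a whole grid of reals. -/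
theorem exists_codesZero_grid (hD : IsDecoder D) {g : M.el .one} (hg : M.app Y g = 0) :
    ∃ X, IsGrid X ∧ ∀ j k : M.el .nat, CodesZero D Y (X j k) := by
  obtain ⟨X, hX, hXd⟩ := exists_digit_grid (M := M) (fun c => ∃ n m, M.IsPair c n m ∧ g n = m)
  have hval : ∀ j k n m, CodesValue (X j k) k n m ↔ g n = m := fun j k n m => by
    simp only [CodesValue, hXd]
    constructor
    · rintro ⟨c, hc, n', m', hc', h⟩
      obtain ⟨rfl, rfl⟩ := hc.unique hc'
      exact h
    · intro h
      obtain ⟨c, hc⟩ := exists_isPair n m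
      exact ⟨c, hc, n, m, hc, h⟩
  refine ⟨X, hX, fun j k => ⟨k, fun n => ⟨g n, (hval j k n _).2 rfl⟩, ?_⟩⟩
  have heq : M.Eqv .one (D (X j k) k) g := fun n =>
    ((hval j k n _).1 (hD (X j k) k n ⟨g n, (hval j k n _).2 rfl⟩).1).symm
  exact ((Eqv.refl _ Y).app heq : M.app Y (D (X j k) k) = M.app Y g).trans hg

/-- Dyadic rationals do not code functions, as they have finitely many digits `1`. -/
theorem exists_not_codesZero_grid :
    ∃ X, IsGrid X ∧ ∀ j k : M.el .nat, ¬ CodesZero D Y (X j k) := by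
  obtain ⟨X, hX, hXd⟩ := exists_dyadic_grid (M := M)
  refine ⟨X, hX, fun j k => ?_⟩
  rintro ⟨i, hi, -⟩
  -- the code `c` of a pair with the first component `k` is at least `k`, and so is the position
  obtain ⟨m, c, hc, hd⟩ := hi k
  exact hXd j k _ ((hc.le.trans le_self_add).trans le_add_self) hd

theorem exists_code_values : ∃ c₀ c₁ : M.Nt, realVal (constReal c₀) = 0 ∧
    realVal (constReal c₁) = 1 := by
  obtain ⟨c₀, h0⟩ := exists_constReal (M := M) fracZero_den
  obtain ⟨c₁, h1⟩ := exists_constReal (M := M) fracOne_den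
  exact ⟨c₀, c₁, by rw [h0, fracZero_val, map_zero], by rw [h1, fracOne_val, map_one]⟩

/-- The characteristic functions of the sets of reals that code zeros of `Y`, uniformly in `Y`. -/
theorem exists_codesZero_char (D : M.el (.fn .one (.fn .nat .one))) (c₀ c₁ : M.Nt) :
    ∃ F : M.el (.fn .two .realFn), ∀ Y x,
      (CodesZero D Y x → M.Eqv .one (F Y x) (constReal c₁)) ∧
      (¬ CodesZero D Y x → M.Eqv .one (F Y x) (constReal c₀)) := by
  have : Dec (M := M) (fun e : (PUnit × M.el .two) × M.el .one => CodesZero D e.1.2 e.2) := by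
    unfold CodesZero; infer_instance
  obtain ⟨φ, hφ, hφ'⟩ := exists_ite (M := M)
    (fun e : (PUnit × M.el .two) × M.el .one => CodesZero D e.1.2 e.2) c₁ c₀
  obtain ⟨F, hF⟩ := exists_object₂ (M := M) (fun (Y : M.el .two) (x : M.el .one) =>
    constReal (φ ((⟨⟩, Y), x))) (h := IsDef.constReal φ)
  refine ⟨F, fun Y x => ⟨fun h => ?_, fun h => ?_⟩⟩
  · have := hF Y x
    rwa [(hφ' ((⟨⟩, Y), x)).1 h] at this
  · have := hF Y x
    rwa [(hφ' ((⟨⟩, Y), x)).2 h] at this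

theorem isSplit_of_codesZero (hD : IsDecoder D) {c₀ c₁ : M.Nt}
    (h0 : realVal (constReal c₀) = 0) (h1 : realVal (constReal c₁) = 1) {f : M.el .realFn}
    (hf : ∀ x, (CodesZero D Y x → M.Eqv .one (f x) (constReal c₁)) ∧
      (¬ CodesZero D Y x → M.Eqv .one (f x) (constReal c₀))) : IsSplit c₀ c₁ f where
  zero := h0
  one := h1
  values x := by
    by_cases h : CodesZero D Y x
    · exact Or.inr ((hf x).1 h)
    · exact Or.inl ((hf x).2 h)
  congr x hx y hy hxy := by
    by_cases h : CodesZero D Y x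
    · exact ((hf x).1 h).trans ((hf y).1 (h.congr hD hx hy hxy)).symm
    · exact ((hf x).2 h).trans
        ((hf y).2 fun h' => h (h'.congr hD hy hx (rEq_symm hx hy hxy))).symm
  grid x _ := by
    by_cases h : CodesZero D Y x
    · obtain ⟨X, hX, hX'⟩ := exists_codesZero_grid hD h.choose_spec.2
      exact ⟨X, hX, fun j k => ((hf _).1 (hX' j k)).trans ((hf x).1 h).symm⟩
    · obtain ⟨X, hX, hX'⟩ := exists_not_codesZero_grid (D := D) (Y := Y)
      exact ⟨X, hX, fun j k => ((hf _).2 (hX' j k)).trans ((hf x).2 h).symm⟩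
  zeroGrid := by
    obtain ⟨X, hX, hX'⟩ := exists_not_codesZero_grid (D := D) (Y := Y)
    exact ⟨X, hX, fun j k => (hf _).2 (hX' j k)⟩

/-- The supremum of a function with a value `1` is not a supremum of a function bounded by `0`. -/
theorem not_isSup_of_isSup {f g : M.el .realFn} (hf : M.IsFunOn M.UnitI f)
    {x : M.el .one} (hx : x ∈ M.UnitI) (hfx : realVal (f x) = 1) {c₀ : M.Nt}
    (h0 : realVal (constReal c₀) = 0) (hg : ∀ x ∈ M.UnitI, M.RLe (g x) (constReal c₀))
    {e e' : M.el .one} (he : M.Eqv .one e e') (hfe : M.IsSup f e) (hge : M.IsSup g e') : False := by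
  have ht : M.tailSeq e = M.tailSeq e' := funext fun n => congrArg M.decode (he (M.succ n))
  have he0 : M.app e M.zero = M.app e' M.zero := he M.zero
  have h01 : M.zero ≠ M.one := zero_ne_one (α := M.el .nat)
  have h02 : M.zero ≠ M.two := by rw [two_eq]; exact (two_ne_zero (α := M.el .nat)).symm
  have h12 : M.one ≠ M.two := by rw [two_eq]; exact (OfNat.one_ne_ofNat (R := M.el .nat) 2)
  rcases hge.2.2 _ (constReal_mem c₀) hg with ⟨hfin', hle'⟩ | hinf' <;>
    rcases hfe.2.1 x hx with ⟨hfin, hle⟩ | hinf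
  · have hr : IsReal (M.tailSeq e) := ⟨fun n => decode_den _, hfin.2⟩
    rw [← ht] at hle'
    have h1 := ((isReal_seq (hf.1 x hx)).seqLe_iff hr).1 hle (2 : M.el .nat)
    have h2 := (hr.seqLe_iff (isReal_seq (constReal_mem c₀))).1 hle' (2 : M.el .nat)
    have h3 : del (2 : M.el .nat) = 1 / 4 := by
      rw [← zero_add 2, del_add_two, del, eps_zero, map_one]
    rw [show limF (M.seq (f x)) = 1 from hfx] at h1
    rw [show limF (M.seq (constReal c₀)) = 0 from h0] at h2
    linarith
  · exact h01 (hfin'.1.symm.trans (he0.symm.trans hinf))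
  · exact h02 (hfin.1.symm.trans (he0.trans hinf'))
  · exact h12 (hinf.symm.trans (he0.trans hinf'))

/-- A supremum functional for functions with two densely taken values decides whether a functional
has a zero. -/
theorem exists3_of_isSupFunctional {Ξ : M.el (.fn .realFn .one)}
    (hΞ : ∀ (c₀ c₁ : M.Nt) (f : M.el .realFn), IsSplit c₀ c₁ f → M.IsSup f (Ξ f)) : M.Exists3 := by
  obtain ⟨D, hD⟩ := exists_decoder (M := M)
  obtain ⟨c₀, c₁, h0, h1⟩ := exists_code_values (M := M)
  obtain ⟨F, hF⟩ := exists_codesZero_char D c₀ c₁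
  have split : ∀ Y, IsSplit c₀ c₁ (F Y) := fun Y => isSplit_of_codesZero hD h0 h1 (hF Y)
  -- a functional without zeros
  let Y₀ : M.el .two := M.combK .nat .one M.one
  have hY₀ : ∀ g, ¬ M.app Y₀ g = 0 := fun g h => by
    have h2 : M.app Y₀ g = M.one := Model.axioms.combK_eq .nat .one M.one g
    exact zero_ne_one (α := M.el .nat) (h.symm.trans h2)
  have noZero : ∀ Y : M.el .two, (∀ g, ¬ M.app Y g = 0) → ∀ x, ¬ CodesZero D Y x :=
    fun Y hY x ⟨k, _, h⟩ => hY _ h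
  have key : ∀ Y : M.el .two,
      (∃ g, M.app Y g = M.zero) ↔ ¬ ∀ n : M.el .nat, Ξ (F Y) n = Ξ (F Y₀) n := by
    intro Y
    constructor
    · rintro ⟨g, hg⟩ heq
      obtain ⟨X, hX, hX'⟩ := exists_codesZero_grid hD hg
      obtain ⟨x, hx⟩ := exists_mem_unitI (M := M)
      obtain ⟨z, hz, -, j, k, hjk⟩ := hX.exists_near hx 0
      have hfz : realVal (F Y z) = 1 := by
        rw [realVal_congr (((Eqv.refl _ (M.app F Y)).app hjk).trans ((hF Y _).1 (hX' j k))), h1]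
      refine not_isSup_of_isSup (split Y).isFunOn hz hfz h0 (fun w _ => ?_) heq
        (hΞ c₀ c₁ _ (split Y)) (hΞ c₀ c₁ _ (split Y₀))
      have h2 := realVal_congr ((hF Y₀ w).2 (noZero Y₀ hY₀ w))
      rw [rLe_iff ((split Y₀).mem_reals w) (constReal_mem c₀), h2]
      exact fun n => by linarith [del_pos n]
    · intro h
      by_contra hc
      push Not at hc
      refine h fun n => ?_
      have h2 : M.Eqv .realFn (F Y) (F Y₀) := fun x =>
        ((hF Y x).2 (noZero Y hc x)).trans ((hF Y₀ x).2 (noZero Y₀ hY₀ x)).symm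
      exact (Eqv.refl _ Ξ).app h2 n
  obtain ⟨χ, hχ, hχ'⟩ := (inferInstance : Dec (M := M) (fun e : PUnit × M.el .two =>
    ¬ ∀ n : M.el .nat, Ξ (F e.2) n = Ξ (F Y₀) n)).exists_char
  obtain ⟨E, hE⟩ := exists_object (fun Y => χ (⟨⟩, Y)) (h := hχ)
  refine ⟨E, fun Y => ?_⟩
  rw [key, hχ' (⟨⟩, Y), show M.app E Y = χ (⟨⟩, Y) from hE Y]

end HigherOrderRM.TypeStr

open HigherOrderRM.TypeStr in
theorem theorem2p3 (M : HigherOrderRM.TypeStr.{u}) (hM : M.ModelsRCA₀ω)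
    (Γ : HigherOrderRM.WeakCont) :
    M.Exists3 ↔
      (M.Exists2 ∧
        ∃ Ξ : M.el (.fn .realFn .one), M.IsSupFunctional (Γ.Class M) Ξ) := by
  have : Model M := ⟨hM⟩
  constructor
  · intro h3
    have : Arith M := ⟨h3.exists2⟩
    obtain ⟨Ξ, hΞ⟩ := exists_isSupFunctional h3
    exact ⟨h3.exists2, Ξ, hΞ.1, fun f hf _ => hΞ.2 f hf trivial⟩
  · rintro ⟨h2, Ξ, hΞ⟩
    have : Arith M := ⟨h2⟩
    exact exists3_of_isSupFunctional fun c₀ c₁ f hf => hΞ.2 f hf.isFunOn (hf.mem_class Γ)
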